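/- **Setting.** Let $n\ge 3$, $m>0$. Consider $1+n$ bodies in the plane with masses $m_0=m$, $m_1=\dots=m_n=1$, $M=\mathrm{diag}(m,m,1,1,\dots,1,1)$, $U(q)=\sum_{i<j}\frac{m_im_j}{\|q_i-q_j\|}$ and $H(P,Q)=\sum_i\frac{\|p_i\|^2}{2m_i}-U(Q)$. Phase vectors are ordered (momenta, positions), $J=\begin{pmatrix}0&-I\\ I&0\end{pmatrix}$, $\omega(x,y)=\langle Jx,y\rangle$, $J_2=\begin{pmatrix}0&-1\\1&0\end{pmatrix}$, $\mathbb J=\mathrm{diag}(J_2,\dots,J_2)$, $R(\varphi)=\cos\varphi\, I+\sin\varphi\,\mathbb J$. Let $\theta_k=2\pi k/n$, and let $a$ be the $(1+n)$-gon configuration $x_0=0$, $x_k=(\cos\theta_k,\sin\theta_k)$ $(1\le k\le n)$, $\lambda=U(a)/I(a)$ with $I(a)=\sum m_i\|x_i\|^2$. The symplectic sum is $$\begin{pmatrix}A_1&A_2\\A_3&A_4\end{pmatrix}\diamond\begin{pmatrix}B_1&B_2\\B_3&B_4\end{pmatrix}=\begin{pmatrix}A_1&0&A_2&0\\0&B_1&0&B_2\\A_3&0&A_4&0\\0&B_3&0&B_4\end{pmatrix}.$$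 **The matrix $A$.** Put $\hat c=(1,0,1,0,\dots,1,0)^T$, $\hat v=(-\tfrac nm,0,1,0,\dots,1,0)^T$, $\hat w=(0,0,\cos2\theta_1,\sin2\theta_1,\dots,\cos 2\theta_n,\sin 2\theta_n)^T$, and let $v(l),w(l)$ have central entry $0$ and $k$-th entry $\cos(l\theta_k)\,x_k$, resp. $\sin(l\theta_k)\,x_k$. Let $A_{cen}=\frac1{\sqrt{m+n}}(\hat c,\mathbb J\hat c)$, $A_{kep}=\frac1{\sqrt n}(a,\mathbb Ja)$, $A(1)=\Big(\sqrt{\tfrac m{n^2+mn}}\,\hat v,\sqrt{\tfrac m{n^2+mn}}\,\mathbb J\hat v,\tfrac1{\sqrt n}\hat w,\tfrac1{\sqrt n}\mathbb J\hat w\Big)$, $A(l)=\sqrt{\tfrac2n}\,(v(l),\mathbb Jv(l),w(l),\mathbb Jw(l))$ for $2\le l\le[\frac{n-1}2]$, and, for even $n$, $A(\tfrac n2)=\tfrac1{\sqrt n}(v(\tfrac n2),\mathbb Jv(\tfrac n2))$. Set $A=(A_{cen},A')$ with $A'=(A_{kep},A(1),\dots,A([\frac n2]))$. **The blocks.** With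 $d_{nj}=\|x_n-x_j\|$ and $\theta_{jl}=2\pi jl/n$ let $\sigma_n=\frac12\sum_{i=1}^{n-1}\csc\frac{\pi i}n$, $$P_l=\sum_{j=1}^{n-1}\tfrac{1-\cos\theta_{jl}\cos\theta_j}{2d_{nj}^3},\quad S_l=\sum_{j=1}^{n-1}\tfrac{\sin\theta_{jl}\sin\theta_j}{2d_{nj}^3},\quad Q_l=\sum_{j=1}^{n-1}\tfrac{\cos\theta_j-\cos\theta_{jl}}{2d_{nj}^3},$$ $a_l=P_l-3Q_l+2m$, $b_l=P_l+3Q_l-m$ for $l\ge 1$. With $\kappa=\frac32\sqrt{m(m+n)}$ and $\rho=\frac m2+2P_1$ put $$\mathcal U_{kep}=\mathrm{diag}\big(\sigma_n+2m,\,-\tfrac12\sigma_n-m\big),\qquad \mathcal U(1)=\begin{pmatrix}\frac{n+m}2&0&\kappa&0\\0&\frac{n+m}2&0&-\kappa\\ \kappa&0&\rho&0\\0&-\kappa&0&\rho\end{pmatrix},$$ $$\mathcal U(l)=\begin{pmatrix}a_l&0&0&S_l\\0&b_l&-S_l&0\\0&-S_l&a_l&0\\S_l&0&0&b_l\end{pmatrix}\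 \big(2\le l\le[\tfrac{n-1}2]\big),\qquad \mathcal U(\tfrac n2)=\mathrm{diag}(a_{n/2},b_{n/2})\ (n\text{ even}).$$ For $0\le e<1$ let $$\mathcal B_{Kep}(\vartheta)=\begin{pmatrix}I&-\mathbb J\\ \mathbb J&I-\frac{I+\lambda^{-1}\mathcal U_{kep}}{1+e\cos\vartheta}\end{pmatrix},\qquad \mathcal B_l(\vartheta)=\begin{pmatrix}I&-\mathbb J\\ \mathbb J&I-\frac{I+\lambda^{-1}\mathcal U(l)}{1+e\cos\vartheta}\end{pmatrix},\quad 1\le l\le[\tfrac n2].$$ **Homographic solution and coordinates.** Let $(r(t),\theta(t))$, $t\in\mathbb R$, be the radius and true anomaly of an elliptic Kepler orbit with parameter $\lambda$, semi-latus rectum $p>0$ and eccentricity $e\in[0,1)$: $r=\frac p{1+e\cos\theta}$, $r^2\dot\theta=\sqrt{\lambda p}$. The homographic motion is $Q_0(t)=r(t)R(\theta(t))a$, $P_0=M\dot Q_0$. With $s(t)=r(t)/(\lambda p)^{1/4}$, the Meyer–Schmidt coordinates $(\bar Y,\bar X)\in\mathbb R^{2n}\times\mathbb R^{2n}$ at time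 $t$ are given by $$(P,Q)=T(t)(\bar Y,\bar X):\qquad Q=A'\,sR(\theta)\bar X,\quad P=MA'\big(s^{-1}R(\theta)\bar Y+\dot s\,R(\theta)\bar X\big).$$ The blocks of $\bar X$ and $\bar Y$ are ordered like those of $A'$. **Theorem.** 1. $\lambda=\frac12\sigma_n+m$, $A^TMA=I$, $\mathbb JA=A\mathbb J$, $M^{-1}U''(a)A_{kep}=A_{kep}\,\mathcal U_{kep}$ and $M^{-1}U''(a)A(l)=A(l)\,\mathcal U(l)$ for $1\le l\le[\frac n2]$. 2. $\theta:\mathbb R\to\mathbb R$ is bijective. Each $T(t)$ is symplectic and has as its image the phase space reduced by the centre of mass, namely the $\omega$-orthogonal complement of $E_1=\mathrm{span}\{(0,\hat c),(0,\mathbb J\hat c),(M\hat c,0),(M\mathbb J\hat c,0)\}$. It maps the Kepler coordinates onto $E_2=\mathrm{span}\{(0,a),(0,\mathbb Ja),(Ma,0),(\mathbb JMa,0)\}$ and the remaining coordinates onto the essential space $E_3=(E_1\cup E_2)^{\perp_\omega}$. 3. $(P_0,Q_0)$ solves Hamilton's equations of $H$, and in the new coordinates it is the constant $\bar\xi_0=(0,\sigma,0,\dots,0,\sigma,0,\dots,0)^T\in\mathbb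 R^{4n}$ with $\sigma=\sqrt n\,(\lambda p)^{1/4}$. 4. In the new coordinates and with the true anomaly as time, the linearized Hamiltonian system along the homographic solution is $$\frac{d\zeta}{d\vartheta}=J_{4n}B(\vartheta)\zeta,\qquad B=B_2\diamond B_3,\quad B_2=\mathcal B_{Kep},\quad B_3=\mathcal B_1\diamond\cdots\diamond\mathcal B_{[n/2]};$$ that is, a function $\zeta:\mathbb R\to\mathbb R^{4n}$ solves this system if and only if $t\mapsto T(t)\zeta(\theta(t))$ solves $\dot\xi=J\,H''(P_0(t),Q_0(t))\,\xi$. 5. $B_2$ is the linearized Kepler problem: $x(t)=r(t)(\cos\theta(t),\sin\theta(t))$, $y=\dot x$, solves Hamilton's equations of $K(y,x)=\frac12\|y\|^2-\lambda/\|x\|$. In the coordinates $x=sR(\theta)\bar x$, $y=s^{-1}R(\theta)\bar y+\dot sR(\theta)\bar x$ this solution is the constant $(\bar y,\bar x)=(0,(\lambda p)^{1/4},(\lambda p)^{1/4},0)$, and the linearization of this Kepler problem along it, with the true anomaly as time, is $\zeta'=J\mathcal B_{Kep}(\vartheta)\zeta$. -/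

import Mathlib

open Matrix Real
open scoped Kronecker

noncomputable section

namespace NGon

/-! ## Gradients, Hessians, Hamiltonian systems and the symplectic sum

A phase space with configuration coordinates indexed by `ι` is `ι ⊕ ι → ℝ`; the left summand
carries the momenta, the right summand the positions. `Matrix.J ι ℝ` is the standard matrix
`(0, -I; I, 0)`. -/

/-- The gradient of `f` at `x`. -/
def grad {ι : Type} [Fintype ι] [DecidableEq ι] (f : (ι → ℝ) → ℝ) (x : ι → ℝ) : ι → ℝ :=
  fun i => fderiv ℝ f x (Pi.single i 1)

/-- The Hessian matrix of `f` at `x`. -/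
def hess {ι : Type} [Fintype ι] [DecidableEq ι] (f : (ι → ℝ) → ℝ) (x : ι → ℝ) : Matrix ι ι ℝ :=
  Matrix.of fun i j => fderiv ℝ (fun y => fderiv ℝ f y (Pi.single j 1)) x (Pi.single i 1)

/-- `x` is a solution of the Hamiltonian system `x' = J ∇H(x)`. -/
def IsHamSol {ι : Type} [Fintype ι] [DecidableEq ι] (H : (ι ⊕ ι → ℝ) → ℝ)
    (x : ℝ → ι ⊕ ι → ℝ) : Prop :=
  ∀ t : ℝ, HasDerivAt x (Matrix.J ι ℝ *ᵥ grad H (x t)) t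

/-- `ξ` is a solution of the linear Hamiltonian system `ξ' = J B(t) ξ`. -/
def IsLinSol {ι : Type} [Fintype ι] [DecidableEq ι] (B : ℝ → Matrix (ι ⊕ ι) (ι ⊕ ι) ℝ)
    (ξ : ℝ → ι ⊕ ι → ℝ) : Prop :=
  ∀ t : ℝ, HasDerivAt ξ ((Matrix.J ι ℝ * B t) *ᵥ ξ t) t

/-- The symplectic form `ω(x, y) = ⟨J x, y⟩`. -/
def symp {ι : Type} [Fintype ι] [DecidableEq ι] (x y : ι ⊕ ι → ℝ) : ℝ :=
  (Matrix.J ι ℝ *ᵥ x) ⬝ᵥ y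

/-- The symplectic orthogonal complement of a set. -/
def sympOrth {ι : Type} [Fintype ι] [DecidableEq ι] (S : Set (ι ⊕ ι → ℝ)) : Set (ι ⊕ ι → ℝ) :=
  {x | ∀ y ∈ S, symp x y = 0}

/-- The symplectic sum `M₁ ⋄ M₂` of two matrices in square block form. -/
def diamond {α β : Type} (M₁ : Matrix (α ⊕ α) (α ⊕ α) ℝ) (M₂ : Matrix (β ⊕ β) (β ⊕ β) ℝ) :
    Matrix ((α ⊕ β) ⊕ (α ⊕ β)) ((α ⊕ β) ⊕ (α ⊕ β)) ℝ :=
  fromBlocks (fromBlocks M₁.toBlocks₁₁ 0 0 M₂.toBlocks₁₁) (fromBlocks M₁.toBlocks₁₂ 0 0 M₂.toBlocks₁₂)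
    (fromBlocks M₁.toBlocks₂₁ 0 0 M₂.toBlocks₂₁) (fromBlocks M₁.toBlocks₂₂ 0 0 M₂.toBlocks₂₂)

/-- The iterated symplectic sum `M 0 ⋄ M 1 ⋄ ⋯ ⋄ M (N-1)`: each of the four blocks is the block
diagonal matrix formed from the corresponding blocks of the summands. -/
def diamondSum {N : ℕ} {ι : Fin N → Type}
    (M : (l : Fin N) → Matrix (ι l ⊕ ι l) (ι l ⊕ ι l) ℝ) :
    Matrix ((Σ l, ι l) ⊕ (Σ l, ι l)) ((Σ l, ι l) ⊕ (Σ l, ι l)) ℝ :=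
  fromBlocks (blockDiagonal' fun l => (M l).toBlocks₁₁) (blockDiagonal' fun l => (M l).toBlocks₁₂)
    (blockDiagonal' fun l => (M l).toBlocks₂₁) (blockDiagonal' fun l => (M l).toBlocks₂₂)

/-- The vector of `α`- and `β`-coordinates, ordered in the way that matches `M₁ ⋄ M₂`. -/
def diamondVec {α β : Type} (z : α ⊕ α → ℝ) (w : β ⊕ β → ℝ) : (α ⊕ β) ⊕ (α ⊕ β) → ℝ :=
  Sum.elim (Sum.elim (fun i => z (Sum.inl i)) (fun i => w (Sum.inl i)))
    (Sum.elim (fun i => z (Sum.inr i)) (fun i => w (Sum.inr i)))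

/-! ## Planar vectors -/

/-- The matrix `J₂`. -/
def J2 : Matrix (Fin 2) (Fin 2) ℝ := !![0, -1; 1, 0]

/-- The matrix `𝕁 = diag(J₂, …, J₂)` on the coordinates of a family of planar vectors; the
coordinate `s` of the `i`-th vector has index `(i, s)`. -/
def JJ (κ : Type) [DecidableEq κ] : Matrix (κ × Fin 2) (κ × Fin 2) ℝ :=
  (1 : Matrix κ κ ℝ) ⊗ₖ J2

/-- The simultaneous rotation `cos φ I + sin φ 𝕁` by the angle `φ`. -/
def rot {ι : Type} [DecidableEq ι] (𝕁 : Matrix ι ι ℝ) (φ : ℝ) : Matrix ι ι ℝ :=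
  Real.cos φ • (1 : Matrix ι ι ℝ) + Real.sin φ • 𝕁

/-- The linear symplectic change to rotating and pulsating coordinates with angle `φ`, scale `s`
and scale velocity `s'`: positions are `x = s R(φ) x̄`, momenta are
`y = s⁻¹ R(φ) ȳ + s' R(φ) x̄`. -/
def pulse {ι : Type} [DecidableEq ι] (𝕁 : Matrix ι ι ℝ) (s s' φ : ℝ) : Matrix (ι ⊕ ι) (ι ⊕ ι) ℝ :=
  fromBlocks (s⁻¹ • rot 𝕁 φ) (s' • rot 𝕁 φ) 0 (s • rot 𝕁 φ)

/-- The Hamiltonian `∑ pᵢ² / (2 μᵢ) - V(q)` with masses `μ` (one for each coordinate). -/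
def ham {ι : Type} [Fintype ι] (μ : ι → ℝ) (V : (ι → ℝ) → ℝ) (x : ι ⊕ ι → ℝ) : ℝ :=
  (∑ i, x (Sum.inl i) ^ 2 / (2 * μ i)) - V (fun i => x (Sum.inr i))

/-- The phase space curve `(P, Q) = (μ Q', Q)` of a motion `Q`. -/
def phaseCurve {ι : Type} [Fintype ι] (μ : ι → ℝ) (Q : ℝ → ι → ℝ) (t : ℝ) : ι ⊕ ι → ℝ :=
  Sum.elim (fun i => μ i * deriv Q t i) (Q t)

/-! ## The `(1+n)`-body problem and the `(1+n)`-gon -/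

/-- Coordinates of `1 + n` bodies in the plane; body `0` is the central one. -/
abbrev Body (n : ℕ) : Type := Fin (n + 1) × Fin 2

/-- The masses: `m` for the central body, `1` for the others. -/
def mass (n : ℕ) (m : ℝ) (i : Fin (n + 1)) : ℝ := if i = 0 then m else 1

/-- The mass attached to each coordinate. -/
def cmass (n : ℕ) (m : ℝ) (q : Body n) : ℝ := mass n m q.1

/-- The mass matrix `M = diag(m, m, 1, 1, …, 1, 1)`. -/
def MM (n : ℕ) (m : ℝ) : Matrix (Body n) (Body n) ℝ := Matrix.diagonal (cmass n m)

/-- The Euclidean distance of the bodies `i` and `j`. -/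
def bodyDist (n : ℕ) (q : Body n → ℝ) (i j : Fin (n + 1)) : ℝ :=
  √(∑ s : Fin 2, (q (i, s) - q (j, s)) ^ 2)

/-- The negative potential `U(q) = ∑_{i<j} mᵢ mⱼ / ‖qᵢ - qⱼ‖`. -/
def pot (n : ℕ) (m : ℝ) (q : Body n → ℝ) : ℝ :=
  ∑ i, ∑ j ∈ Finset.Ioi i, mass n m i * mass n m j / bodyDist n q i j

/-- The moment of inertia `I(q) = ∑ mᵢ ‖qᵢ‖²`. -/
def inertia (n : ℕ) (m : ℝ) (q : Body n → ℝ) : ℝ := ∑ i, cmass n m i * q i ^ 2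

/-- The angle `θ_k = 2πk/n`. -/
def ang (n k : ℕ) : ℝ := 2 * π * k / n

/-- The vector with entries `0` at the centre and `c k • (cos θ_k, sin θ_k)` at the `k`-th vertex. -/
def ringVec (n : ℕ) (c : ℕ → ℝ) (q : Body n) : ℝ :=
  if q.1 = 0 then 0 else c q.1.val * ![Real.cos (ang n q.1.val), Real.sin (ang n q.1.val)] q.2

/-- The `(1+n)`-gon central configuration `a`. -/
def cfg (n : ℕ) : Body n → ℝ := ringVec n fun _ => 1

/-- `v(l)`: radial vectors with factors `cos θ_{kl}`. -/
def vVec (n l : ℕ) : Body n → ℝ := ringVec n fun k => Real.cos (ang n (k * l))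

/-- `w(l)`: radial vectors with factors `sin θ_{kl}`. -/
def wVec (n l : ℕ) : Body n → ℝ := ringVec n fun k => Real.sin (ang n (k * l))

/-- `ĉ = (1, 0, 1, 0, …, 1, 0)`. -/
def cHat (n : ℕ) (q : Body n) : ℝ := ![1, 0] q.2

/-- `v̂(1) = (-n/m, 0, 1, 0, …, 1, 0)`. -/
def vHat (n : ℕ) (m : ℝ) (q : Body n) : ℝ := if q.1 = 0 then ![-n / m, 0] q.2 else ![1, 0] q.2

/-- `ŵ(1) = (0, 0, cos 2θ₁, sin 2θ₁, …, cos 2θₙ, sin 2θₙ)`. -/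
def wHat (n : ℕ) (q : Body n) : ℝ :=
  if q.1 = 0 then 0 else ![Real.cos (2 * ang n q.1.val), Real.sin (2 * ang n q.1.val)] q.2

/-- The number `λ = U(a) / I(a)`. -/
def lam (n : ℕ) (m : ℝ) : ℝ := pot n m (cfg n) / inertia n m (cfg n)

/-! ## The linear transformation `A` -/

/-- Half the size of the `l`-th essential block: the block `l = n/2` (for even `n`) is `2 × 2`,
the others are `4 × 4`. -/
def half (n l : ℕ) : ℕ := if 2 * l = n then 1 else 2

theorem half_le (n l : ℕ) : half n l ≤ 2 := by
  unfold half; split <;> simp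

/-- Kepler coordinates (dilation and rotation). -/
abbrev Kep : Type := Fin 1 × Fin 2

/-- The coordinates of the `l`-th essential block. -/
abbrev Blk (n l : ℕ) : Type := Fin (half n l) × Fin 2

/-- The essential coordinates: the blocks `l = 1, …, [n/2]`, in this order. -/
abbrev Ess (n : ℕ) : Type := Σ l : Fin (n / 2), Blk n (l.val + 1)

/-- The coordinates `X = (z, w)` on the configurations with centre of mass at the origin. -/
abbrev Conf (n : ℕ) : Type := Kep ⊕ Ess n

/-- The matrix with columns `u₀, 𝕁u₀, u₁, 𝕁u₁, …`. -/
def pairCols {n k : ℕ} (u : Fin k → Body n → ℝ) : Matrix (Body n) (Fin k × Fin 2) ℝ :=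
  Matrix.of fun q p => ![u p.1 q, (JJ (Fin (n + 1)) *ᵥ u p.1) q] p.2

/-- `A_cen`. -/
def ACen (n : ℕ) (m : ℝ) : Matrix (Body n) (Fin 1 × Fin 2) ℝ :=
  pairCols fun _ => (1 / √(m + n)) • cHat n

/-- `A_kep`. -/
def AKep (n : ℕ) : Matrix (Body n) Kep ℝ :=
  pairCols fun _ => (1 / √(n : ℝ)) • cfg n

/-- The normalized vectors spanning, with their images under `𝕁`, the `l`-th essential subspace
(only the first one is used if `2l = n`). -/
def essVec (n : ℕ) (m : ℝ) (l : ℕ) : Fin 2 → Body n → ℝ :=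
  if 2 * l = n then fun _ => (1 / √(n : ℝ)) • vVec n l
  else if l = 1 then ![√(m / ((n : ℝ) ^ 2 + m * n)) • vHat n m, (1 / √(n : ℝ)) • wHat n]
  else ![√(2 / (n : ℝ)) • vVec n l, √(2 / (n : ℝ)) • wVec n l]

/-- `A(l)`. -/
def ABlk (n : ℕ) (m : ℝ) (l : ℕ) : Matrix (Body n) (Blk n l) ℝ :=
  pairCols fun i => essVec n m l (Fin.castLE (half_le n l) i)

/-- The matrix `(A_kep, A(1), …, A([n/2]))`. -/
def ARed (n : ℕ) (m : ℝ) : Matrix (Body n) (Conf n) ℝ :=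
  fromCols (AKep n) (Matrix.of fun q p => ABlk n m (p.1.val + 1) q p.2)

/-- The matrix `A = (A_cen, A_kep, A(1), …, A([n/2]))`. -/
def AFull (n : ℕ) (m : ℝ) : Matrix (Body n) ((Fin 1 × Fin 2) ⊕ Conf n) ℝ :=
  fromCols (ACen n m) (ARed n m)

/-- `𝕁 = diag(J₂, …, J₂)` in the coordinates `X = (z, w)`. -/
def JConf (n : ℕ) : Matrix (Conf n) (Conf n) ℝ :=
  fromBlocks (JJ (Fin 1)) 0 0 (blockDiagonal' fun l : Fin (n / 2) => JJ (Fin (half n (l.val + 1))))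

/-! ## The explicit blocks -/

/-- `σ_n = (1/2) ∑_{i=1}^{n-1} csc(πi/n)`. -/
def sigmaN (n : ℕ) : ℝ := (1 / 2) * ∑ i ∈ Finset.Icc 1 (n - 1), 1 / Real.sin (π * i / n)

/-- `d_{nj}`, the distance of the `n`-th and the `j`-th vertex of the regular `n`-gon. -/
def dd (n j : ℕ) : ℝ :=
  √((Real.cos (ang n n) - Real.cos (ang n j)) ^ 2 + (Real.sin (ang n n) - Real.sin (ang n j)) ^ 2)

/-- `P_l`. -/
def PP (n l : ℕ) : ℝ :=
  ∑ j ∈ Finset.Icc 1 (n - 1), (1 - Real.cos (ang n (j * l)) * Real.cos (ang n j)) / (2 * dd n j ^ 3)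

/-- `S_l`. -/
def SS (n l : ℕ) : ℝ :=
  ∑ j ∈ Finset.Icc 1 (n - 1), (Real.sin (ang n (j * l)) * Real.sin (ang n j)) / (2 * dd n j ^ 3)

/-- `Q_l`. -/
def QQ (n l : ℕ) : ℝ :=
  ∑ j ∈ Finset.Icc 1 (n - 1), (Real.cos (ang n j) - Real.cos (ang n (j * l))) / (2 * dd n j ^ 3)

/-- `a_l`. -/
def aa (n : ℕ) (m : ℝ) (l : ℕ) : ℝ := PP n l - 3 * QQ n l + 2 * m

/-- `b_l`. -/
def bb (n : ℕ) (m : ℝ) (l : ℕ) : ℝ := PP n l + 3 * QQ n l - m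

/-- `𝒰_kep = diag(a₀, b₀)`. -/
def UKep (n : ℕ) (m : ℝ) : Matrix Kep Kep ℝ :=
  Matrix.of fun p q => !![sigmaN n + 2 * m, 0; 0, -(1 / 2) * sigmaN n - m] p.2 q.2

/-- `𝒰(1)`. -/
def U1 (n : ℕ) (m : ℝ) : Matrix (Fin 4) (Fin 4) ℝ :=
  !![(n + m) / 2, 0, 3 / 2 * √(m * (m + n)), 0;
     0, (n + m) / 2, 0, -(3 / 2 * √(m * (m + n)));
     3 / 2 * √(m * (m + n)), 0, m / 2 + 2 * PP n 1, 0;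
     0, -(3 / 2 * √(m * (m + n))), 0, m / 2 + 2 * PP n 1]

/-- `𝒰(l)` for `2 ≤ l ≤ [(n-1)/2]`. -/
def UMid (n : ℕ) (m : ℝ) (l : ℕ) : Matrix (Fin 4) (Fin 4) ℝ :=
  !![aa n m l, 0, 0, SS n l;
     0, bb n m l, -SS n l, 0;
     0, -SS n l, aa n m l, 0;
     SS n l, 0, 0, bb n m l]

/-- `𝒰(n/2)` for even `n`. -/
def UHalf (n : ℕ) (m : ℝ) (l : ℕ) : Matrix (Fin 2) (Fin 2) ℝ :=
  !![aa n m l, 0; 0, bb n m l]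

/-- The position `2i + s` of the index `(i, s)` of a `4 × 4` block. -/
def pos4 {n l : ℕ} (p : Blk n l) : Fin 4 :=
  finProdFinEquiv (Fin.castLE (half_le n l) p.1, p.2)

/-- The block `𝒰(l)`, `1 ≤ l ≤ [n/2]`. -/
def UBlk (n : ℕ) (m : ℝ) (l : ℕ) : Matrix (Blk n l) (Blk n l) ℝ :=
  Matrix.of fun p q =>
    if 2 * l = n then UHalf n m l p.2 q.2
    else if l = 1 then U1 n m (pos4 p) (pos4 q)
    else UMid n m l (pos4 p) (pos4 q)

/-- `(I, -𝕁; 𝕁, I - r_e(ϑ) R)` with `R = I + λ⁻¹ 𝒰` and `r_e(ϑ) = (1 + e cos ϑ)⁻¹`. -/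
def sysMat {k : ℕ} (Λ e : ℝ) (𝒰 : Matrix (Fin k × Fin 2) (Fin k × Fin 2) ℝ) (ϑ : ℝ) :
    Matrix ((Fin k × Fin 2) ⊕ (Fin k × Fin 2)) ((Fin k × Fin 2) ⊕ (Fin k × Fin 2)) ℝ :=
  fromBlocks 1 (-JJ (Fin k)) (JJ (Fin k))
    (1 - (1 + e * Real.cos ϑ)⁻¹ • (1 + Λ⁻¹ • 𝒰))

/-- `B₂ = ℬ_Kep`. -/
def BKep (n : ℕ) (m e ϑ : ℝ) : Matrix (Kep ⊕ Kep) (Kep ⊕ Kep) ℝ :=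
  sysMat (lam n m) e (UKep n m) ϑ

/-- `ℬ_l`. -/
def BBlk (n : ℕ) (m e : ℝ) (l : ℕ) (ϑ : ℝ) : Matrix (Blk n l ⊕ Blk n l) (Blk n l ⊕ Blk n l) ℝ :=
  sysMat (lam n m) e (UBlk n m l) ϑ

/-! ## Kepler orbits, the homographic solution, and the coordinates -/

/-- `(r, θ)` are the radius and the true anomaly of a Kepler orbit with gravitational parameter `μ`,
semi-latus rectum `p` and eccentricity `e`: the conic section equation and the conservation of
the angular momentum `r² θ' = √(μp)`. -/
def IsKeplerOrbit (μ p e : ℝ) (r θ : ℝ → ℝ) : Prop :=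
  (∀ t, r t = p / (1 + e * Real.cos (θ t))) ∧ ∀ t, HasDerivAt θ (√(μ * p) / r t ^ 2) t

/-- The Hamiltonian `H(P, Q)` of the `(1+n)`-body problem. -/
def hamN (n : ℕ) (m : ℝ) : (Body n ⊕ Body n → ℝ) → ℝ := ham (cmass n m) (pot n m)

/-- The homographic motion `r(t) R(θ(t)) a`. -/
def homogr (n : ℕ) (r θ : ℝ → ℝ) (t : ℝ) : Body n → ℝ :=
  r t • (rot (JJ (Fin (n + 1))) (θ t) *ᵥ cfg n)

/-- The Hamiltonian `‖y‖²/2 - μ/‖x‖` of the planar Kepler problem. -/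
def hamKep (μ : ℝ) : (Kep ⊕ Kep → ℝ) → ℝ :=
  ham (fun _ => 1) fun x => μ / √(∑ s : Fin 2, x (0, s) ^ 2)

/-- The Kepler motion `r(t) (cos θ(t), sin θ(t))`. -/
def kepMotion (r θ : ℝ → ℝ) (t : ℝ) : Kep → ℝ :=
  fun i => ![r t * Real.cos (θ t), r t * Real.sin (θ t)] i.2

/-- The scale `s(t) = r(t) / (μp)^{1/4}` of the pulsating coordinates. -/
def scale (μ p : ℝ) (r : ℝ → ℝ) (t : ℝ) : ℝ := r t / √(√(μ * p))

/-- The change from the new coordinates `(Y, X)` to the original ones `(P, Q)` at the time `t`: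
the rotating and pulsating coordinates followed by `Q = A X`, `P = A^{-T} Y = M A Y`. -/
def TT (n : ℕ) (m p : ℝ) (r θ : ℝ → ℝ) (t : ℝ) :
    Matrix (Body n ⊕ Body n) (Conf n ⊕ Conf n) ℝ :=
  fromBlocks (MM n m * ARed n m) 0 0 (ARed n m) *
    pulse (JConf n) (scale (lam n m) p r t) (deriv (scale (lam n m) p r) t) (θ t)

/-- The change to rotating and pulsating coordinates for the Kepler problem. -/
def TKep (μ p : ℝ) (r θ : ℝ → ℝ) (t : ℝ) : Matrix (Kep ⊕ Kep) (Kep ⊕ Kep) ℝ :=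
  pulse (JJ (Fin 1)) (scale μ p r t) (deriv (scale μ p r) t) (θ t)

/-- The Kepler part `(0, σ, σ, 0)` of the equilibrium, momenta first. -/
def kepEq (σ : ℝ) : Kep ⊕ Kep → ℝ :=
  Sum.elim (fun i => (![0, σ] : Fin 2 → ℝ) i.2) (fun i => (![σ, 0] : Fin 2 → ℝ) i.2)

/-- The equilibrium `(0, σ, 0, …, 0, σ, 0, …, 0)`. -/
def xiZero (n : ℕ) (σ : ℝ) : (Conf n ⊕ Conf n) → ℝ := diamondVec (kepEq σ) 0

/-- The space `E₁` of the centre of mass. -/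
def E1 (n : ℕ) (m : ℝ) : Submodule ℝ (Body n ⊕ Body n → ℝ) :=
  Submodule.span ℝ {Sum.elim (0 : Body n → ℝ) (cHat n), Sum.elim (0 : Body n → ℝ) (JJ (Fin (n + 1)) *ᵥ cHat n),
    Sum.elim (MM n m *ᵥ cHat n) (0 : Body n → ℝ), Sum.elim (MM n m *ᵥ (JJ (Fin (n + 1)) *ᵥ cHat n)) (0 : Body n → ℝ)}

/-- The space `E₂` of dilations and rotations of the central configuration. -/
def E2 (n : ℕ) (m : ℝ) : Submodule ℝ (Body n ⊕ Body n → ℝ) :=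
  Submodule.span ℝ {Sum.elim (0 : Body n → ℝ) (cfg n), Sum.elim (0 : Body n → ℝ) (JJ (Fin (n + 1)) *ᵥ cfg n),
    Sum.elim (MM n m *ᵥ cfg n) (0 : Body n → ℝ), Sum.elim (JJ (Fin (n + 1)) *ᵥ (MM n m *ᵥ cfg n)) (0 : Body n → ℝ)}

/-- The essential space `E₃ = (E₁ ∪ E₂)^⊥`. -/
def E3 (n : ℕ) (m : ℝ) : Set (Body n ⊕ Body n → ℝ) :=
  sympOrth ((E1 n m : Set (Body n ⊕ Body n → ℝ)) ∪ E2 n m)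

end NGon

end

open NGon

/-! The theorem combines a Fourier analysis of the Hessian of `U` at the `(1+n)`-gon with a change
of variables that brings every elliptic homographic motion to rest.

Fourier part. In complex notation (`cx`), `𝕁` is multiplication by `i` and `R(φ)` is multiplication
by `e^{iφ}`, while the Hessian of `1/|x|` is `η ↦ (η/2 + (3/2)(x/|x|)² η̄)/|x|³`. For a chord `x =
ζ^K - ζ^(K+d)` of the ring, with `ζ = zet n`, one has `(x/|x|)² = -ζ^(2K+d)`. Hence the Hessian of
`U` sends `c • mode n a` to a real multiple of `c • mode n a`, plus a real multiple of `c̄ • mode n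
(2 - a)`, plus a vector at the central body (`hessC_mode`). The coefficients are real because `d ↦ n
- d` conjugates the terms (`sum_zet_div_dd`). The involution `a ↦ 2 - a` exchanges `1 + l` and `1 -
l`, so the span of `v(l)`, `w(l)` and their images under `𝕁` is invariant. Its fixed exponent `1`
gives the Kepler block; for `l = 1` the exponents `0` and `2` interact with the central body; for
`2l = n` the two exponents agree modulo `n`. Real and imaginary `c` account for the two columns of
each pair. The same modes are orthogonal for the Hermitian mass form `herm`, and a dimension count
makes `A` invertible.

Dynamical part. By symmetry the gradient of `U` at the polygon is `-λ M a`, so `r R(θ) a` moves by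
the Kepler law. By homogeneity and rotation invariance the Hessian along this motion is `r⁻³ R
U''(a) R⁻¹`. If `T` denotes the new coordinates, the asserted equivalence of linear systems amounts
to `T' + θ' T J B = J H'' T`. This is an identity of blocks (`pulseMap_deriv_eq`) which uses only
`θ' = s⁻²`, `s³ s'' = 1 - ρ` and `s⁴ r⁻³ = ρ/λ` with `ρ = 1/(1 + e cos θ)`; all three follow from
the conic equation and the area law (`scale_equations`). As `𝕁` and the transformed Hessian are
block diagonal, the new system is a symplectic sum. The same argument with `A = 1` treats the Kepler
problem, whose Hessian at the unit vector is `UKep`.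

The coordinates are symplectic because `AᵀMA = 1` and `R` is orthogonal. Their images follow from
the resolution of the identity given by the columns of `A` and from nondegeneracy of the symplectic
form. -/

noncomputable section

open Topology Filter

set_option linter.unusedSectionVars false

namespace NGon

/-! ## Functions with gradient and Hessian -/

variable {ι κ : Type} [Fintype ι] [DecidableEq ι] [Fintype κ] [DecidableEq κ]

/-- The linear functional `v ↦ g ⬝ᵥ v`. -/
def dotL (g : ι → ℝ) : (ι → ℝ) →L[ℝ] ℝ := ∑ i, g i • ContinuousLinearMap.proj i

/-- The linear map `v ↦ v ᵥ* H`. -/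
def vecL (H : Matrix ι κ ℝ) : (ι → ℝ) →L[ℝ] (κ → ℝ) :=
  LinearMap.toContinuousLinearMap (Matrix.vecMulLinear H)

@[simp] theorem dotL_apply (g v : ι → ℝ) : dotL g v = g ⬝ᵥ v := by
  simp [dotL, dotProduct]

@[simp] theorem vecL_apply (H : Matrix ι κ ℝ) (v : ι → ℝ) : vecL H v = v ᵥ* H := rfl

/-- `G` is the gradient of `f` near `x`, and `H` is the Hessian of `f` at `x`. -/
def HasGradHess (f : (ι → ℝ) → ℝ) (G : (ι → ℝ) → ι → ℝ) (H : Matrix ι ι ℝ) (x : ι → ℝ) : Prop :=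
  (∀ᶠ y in 𝓝 x, HasFDerivAt f (dotL (G y)) y) ∧ HasFDerivAt G (vecL H) x

namespace HasGradHess

theorem grad_eq {f : (ι → ℝ) → ℝ} {G : (ι → ℝ) → ι → ℝ} {H : Matrix ι ι ℝ} {x : ι → ℝ}
    (h : HasGradHess f G H x) : grad f x = G x := by
  funext i
  simp [grad, h.1.self_of_nhds.fderiv]

/-- The row index of `hess` is the direction in which a partial derivative is differentiated again.
The derivative of `G` is therefore taken to act on row vectors, and no symmetry of `H` is needed. -/
theorem hess_eq {f : (ι → ℝ) → ℝ} {G : (ι → ℝ) → ι → ℝ} {H : Matrix ι ι ℝ} {x : ι → ℝ}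
    (h : HasGradHess f G H x) : hess f x = H := by
  ext i j
  have e : (fun y => fderiv ℝ f y (Pi.single j 1)) =ᶠ[𝓝 x] fun y => G y j := by
    filter_upwards [h.1] with y hy
    simp [hy.fderiv]
  have hd : HasFDerivAt (fun y => G y j) ((ContinuousLinearMap.proj j).comp (vecL H)) x :=
    (hasFDerivAt_pi'.1 h.2) j
  simp [hess, e.fderiv_eq, hd.fderiv]

theorem sum {α : Type} (s : Finset α) {f : α → (ι → ℝ) → ℝ} {G : α → (ι → ℝ) → ι → ℝ}
    {H : α → Matrix ι ι ℝ} {x : ι → ℝ} (h : ∀ a ∈ s, HasGradHess (f a) (G a) (H a) x) :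
    HasGradHess (fun y => ∑ a ∈ s, f a y) (fun y => ∑ a ∈ s, G a y) (∑ a ∈ s, H a) x := by
  constructor
  · have : ∀ᶠ y in 𝓝 x, ∀ a ∈ s, HasFDerivAt (f a) (dotL (G a y)) y :=
      (Filter.eventually_all_finset s).2 fun a ha => (h a ha).1
    filter_upwards [this] with y hy
    refine (HasFDerivAt.fun_sum hy).congr_fderiv ?_
    ext v
    simp [sum_dotProduct]
  · refine (HasFDerivAt.fun_sum fun a ha => (h a ha).2).congr_fderiv ?_
    ext1 v
    simp [Matrix.vecMul_sum]

theorem const_mul (c : ℝ) {f : (ι → ℝ) → ℝ} {G : (ι → ℝ) → ι → ℝ} {H : Matrix ι ι ℝ} {x : ι → ℝ}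
    (h : HasGradHess f G H x) :
    HasGradHess (fun y => c * f y) (fun y => c • G y) (c • H) x := by
  constructor
  · filter_upwards [h.1] with y hy
    refine (hy.const_mul c).congr_fderiv ?_
    ext v
    simp
  · refine (h.2.const_smul c).congr_fderiv ?_
    ext1 v
    simp [Matrix.vecMul_smul]

theorem add {f g : (ι → ℝ) → ℝ} {G G' : (ι → ℝ) → ι → ℝ} {H H' : Matrix ι ι ℝ} {x : ι → ℝ}
    (h : HasGradHess f G H x) (h' : HasGradHess g G' H' x) :
    HasGradHess (fun y => f y + g y) (fun y => G y + G' y) (H + H') x := by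
  constructor
  · filter_upwards [h.1, h'.1] with y hy hy'
    refine (hy.add hy').congr_fderiv ?_
    ext v
    simp [add_dotProduct]
  · refine (h.2.add h'.2).congr_fderiv ?_
    ext1 v
    simp [Matrix.vecMul_add]

/-- Every pair potential is `1/‖·‖` composed with a difference of positions. The inner map is
linear, so its second derivative contributes nothing to the Hessian. -/
theorem comp {f : (κ → ℝ) → ℝ} {G : (κ → ℝ) → κ → ℝ} {H : Matrix κ κ ℝ} (L : Matrix κ ι ℝ)
    {x : ι → ℝ} (h : HasGradHess f G H (L *ᵥ x)) :
    HasGradHess (fun y => f (L *ᵥ y)) (fun y => G (L *ᵥ y) ᵥ* L) (Lᵀ * H * L) x := by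
  have hL : ∀ y, HasFDerivAt (fun y : ι → ℝ => L *ᵥ y)
      (LinearMap.toContinuousLinearMap L.mulVecLin) y := fun y =>
    (LinearMap.toContinuousLinearMap L.mulVecLin).hasFDerivAt
  constructor
  · have := (hL x).continuousAt.eventually h.1
    filter_upwards [this] with y hy
    refine (hy.comp y (hL y)).congr_fderiv ?_
    ext v
    simp [dotProduct_mulVec]
  · refine ((vecL L).hasFDerivAt.comp x (h.2.comp x (hL x))).congr_fderiv ?_
    ext1 v
    simp [Matrix.vecMul_vecMul, Matrix.mul_assoc]
    rw [← Matrix.vecMul_transpose, Matrix.vecMul_vecMul]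

end HasGradHess

/-- The Hessian of `1 / ‖x‖` in the plane. -/
def invNormHess (x : Fin 2 → ℝ) : Matrix (Fin 2) (Fin 2) ℝ :=
  Matrix.of fun s t => 3 * x s * x t / √(∑ s, x s ^ 2) ^ 5 -
    (if s = t then 1 else 0) / √(∑ s, x s ^ 2) ^ 3

/-! ### The function `1/‖x‖`, the kinetic energy and the Hamiltonian -/

theorem sum_sq_pos {x : ι → ℝ} (hx : x ≠ 0) : 0 < ∑ s, x s ^ 2 := by
  obtain ⟨i, hi⟩ := Function.ne_iff.1 hx
  exact Finset.sum_pos' (fun j _ => sq_nonneg _) ⟨i, Finset.mem_univ _, by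
    have : x i ≠ 0 := hi
    positivity⟩

theorem hasFDerivAt_norm_sq (x : ι → ℝ) :
    HasFDerivAt (fun y : ι → ℝ => ∑ s, y s ^ 2) (dotL ((2 : ℝ) • x)) x := by
  have : ∀ s ∈ (Finset.univ : Finset ι), HasFDerivAt (fun y : ι → ℝ => y s ^ 2)
      ((2 * x s) • (ContinuousLinearMap.proj s : (ι → ℝ) →L[ℝ] ℝ)) x := fun s _ => by
    have := (ContinuousLinearMap.proj (R := ℝ) (φ := fun _ : ι => ℝ) s).hasFDerivAt (x := x)
    simpa using this.pow 2
  refine (HasFDerivAt.fun_sum this).congr_fderiv ?_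
  ext v
  simp [dotProduct]

/-- Used at the squared norm, with `k = 1` for the potential and `k = 3` for its gradient. -/
theorem hasDerivAt_inv_sqrt_pow (k : ℕ) {u : ℝ} (hu : 0 < u) :
    HasDerivAt (fun u => 1 / √u ^ k) (-(k / 2) / √u ^ (k + 2)) u := by
  have h1 := Real.hasDerivAt_sqrt hu.ne'
  have hs : √u ≠ 0 := (Real.sqrt_pos.2 hu).ne'
  have h2 := (h1.pow k).inv (pow_ne_zero k hs)
  simp only [one_div]
  refine h2.congr_deriv ?_
  -- The power rule produces the truncated exponent `k - 1`, so `k = 0` is treated apart.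
  rcases k with _ | k
  · simp
  · simp only [Pi.pow_apply, Nat.add_sub_cancel]
    field_simp
    ring

theorem hasGradHess_invNorm {x : Fin 2 → ℝ} (hx : x ≠ 0) :
    HasGradHess (fun y => 1 / √(∑ s, y s ^ 2)) (fun y => (-(1 / √(∑ s, y s ^ 2) ^ 3)) • y)
      (invNormHess x) x := by
  constructor
  · filter_upwards [isOpen_ne.mem_nhds hx] with y hy
    have := (hasDerivAt_inv_sqrt_pow 1 (sum_sq_pos hy)).comp_hasFDerivAt y (hasFDerivAt_norm_sq y)
    simp only [pow_one] at this
    refine this.congr_fderiv ?_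
    ext v
    simp
    ring
  · have h1 := ((hasDerivAt_inv_sqrt_pow 3 (sum_sq_pos hx)).comp_hasFDerivAt x
      (hasFDerivAt_norm_sq x)).neg
    refine (h1.smul (hasFDerivAt_id x)).congr_fderiv ?_
    ext1 v
    funext t
    have hs : √(∑ s, x s ^ 2) ≠ 0 := (Real.sqrt_pos.2 (sum_sq_pos hx)).ne'
    set d := √(∑ s, x s ^ 2) with hd
    have hd' : √(x 0 ^ 2 + x 1 ^ 2) = d := by rw [hd, Fin.sum_univ_two]
    fin_cases t <;>
    · simp [invNormHess, vecMul, dotProduct, Fin.sum_univ_two, hd']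
      field_simp
      ring

theorem hasGradHess_quad (μ : ι → ℝ) (x : ι → ℝ) :
    HasGradHess (fun y => ∑ i, y i ^ 2 / (2 * μ i)) (fun y i => (μ i)⁻¹ * y i)
      (diagonal fun i => (μ i)⁻¹) x := by
  constructor
  · refine Eventually.of_forall fun y => ?_
    have : ∀ s ∈ (Finset.univ : Finset ι), HasFDerivAt (fun y : ι → ℝ => y s ^ 2 / (2 * μ s))
        (((μ s)⁻¹ * y s) • (ContinuousLinearMap.proj s : (ι → ℝ) →L[ℝ] ℝ)) y := fun s _ => by
      have := (ContinuousLinearMap.proj (R := ℝ) (φ := fun _ : ι => ℝ) s).hasFDerivAt (x := y)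
      have := (this.pow 2).const_mul ((2 * μ s)⁻¹)
      simp only [div_eq_inv_mul]
      refine this.congr_fderiv ?_
      ext v
      simp
      ring
    refine (HasFDerivAt.fun_sum this).congr_fderiv ?_
    ext v
    simp [dotProduct]
  · rw [hasFDerivAt_pi']
    intro i
    have := (ContinuousLinearMap.proj (R := ℝ) (φ := fun _ : ι => ℝ) i).hasFDerivAt (x := x)
    refine (this.const_mul ((μ i)⁻¹)).congr_fderiv ?_
    ext v
    simp [vecMul_diagonal, mul_comm]

theorem hasGradHess_ham (μ : ι → ℝ) {V : (ι → ℝ) → ℝ} {G : (ι → ℝ) → ι → ℝ} {H : Matrix ι ι ℝ}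
    {x : ι ⊕ ι → ℝ} (h : HasGradHess V G H (fun i => x (Sum.inr i))) :
    HasGradHess (ham μ V)
      (fun y => Sum.elim (fun i => (μ i)⁻¹ * y (Sum.inl i)) (-G fun i => y (Sum.inr i)))
      (fromBlocks (diagonal fun i => (μ i)⁻¹) 0 0 (-H)) x := by
  -- Momenta and positions are extracted by matrices, so that kinetic and potential energy are both
  -- compositions with linear maps.
  have hl : ∀ y : ι ⊕ ι → ℝ, (fromCols 1 0 : Matrix ι (ι ⊕ ι) ℝ) *ᵥ y = fun i => y (Sum.inl i) := by
    intro y; rw [fromCols_mulVec]; simp; rfl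
  have hr : ∀ y : ι ⊕ ι → ℝ, (fromCols 0 1 : Matrix ι (ι ⊕ ι) ℝ) *ᵥ y = fun i => y (Sum.inr i) := by
    intro y; rw [fromCols_mulVec]; simp; rfl
  have h1 := (hasGradHess_quad μ ((fromCols 1 0 : Matrix ι (ι ⊕ ι) ℝ) *ᵥ x)).comp
  have h2 := HasGradHess.comp (fromCols 0 1 : Matrix ι (ι ⊕ ι) ℝ) (x := x) (by rw [hr]; exact h)
  have h3 := h1.add (h2.const_mul (-1))
  simp only [hl, hr] at h3
  refine (?_ : HasGradHess _ _ _ x)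
  convert h3 using 1
  · funext y; simp [ham, sub_eq_add_neg]
  · funext y
    simp only [vecMul_fromCols, vecMul_one, vecMul_zero]
    funext i
    rcases i with i | i <;> simp
  · simp only [transpose_fromCols, fromRows_mul, transpose_one, transpose_zero, Matrix.one_mul,
      Matrix.zero_mul]
    ext i j
    rcases i with i | i <;> rcases j with j | j <;> simp [mul_fromCols]

/-! ## Complex notation for families of planar vectors -/

section Complex

variable {κ : Type} [Fintype κ] [DecidableEq κ]

/-- The complex numbers of a family of planar vectors. -/
def cx (ξ : κ × Fin 2 → ℝ) (i : κ) : ℂ := ⟨ξ (i, 0), ξ (i, 1)⟩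

theorem cx_injective : Function.Injective (cx : (κ × Fin 2 → ℝ) → κ → ℂ) := by
  intro ξ η h
  funext ⟨i, s⟩
  have := congrFun h i
  simp only [cx, Complex.mk.injEq] at this
  fin_cases s
  exacts [this.1, this.2]

theorem cx_add (ξ η : κ × Fin 2 → ℝ) : cx (ξ + η) = cx ξ + cx η := by
  funext i; apply Complex.ext <;> simp [cx]

theorem cx_smul (c : ℝ) (ξ : κ × Fin 2 → ℝ) : cx (c • ξ) = (c : ℂ) • cx ξ := by
  funext i; apply Complex.ext <;> simp [cx]

theorem cx_zero : cx (0 : κ × Fin 2 → ℝ) = 0 := by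
  funext i; apply Complex.ext <;> simp [cx]

theorem cx_sum {α : Type} (s : Finset α) (f : α → κ × Fin 2 → ℝ) :
    cx (∑ a ∈ s, f a) = ∑ a ∈ s, cx (f a) :=
  map_sum (⟨⟨cx, cx_zero⟩, cx_add⟩ : (κ × Fin 2 → ℝ) →+ (κ → ℂ)) f s

theorem JJ_mulVec (ξ : κ × Fin 2 → ℝ) (i : κ) (s : Fin 2) :
    (JJ κ *ᵥ ξ) (i, s) = ![-ξ (i, 1), ξ (i, 0)] s := by
  have : (JJ κ *ᵥ ξ) (i, s) = ∑ t, J2 s t * ξ (i, t) := by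
    simp [JJ, mulVec, dotProduct, Fintype.sum_prod_type, kroneckerMap_apply, Matrix.one_apply]
  rw [this]
  fin_cases s <;> simp [J2]

theorem cx_JJ (ξ : κ × Fin 2 → ℝ) : cx (JJ κ *ᵥ ξ) = Complex.I • cx ξ := by
  funext i
  apply Complex.ext <;> simp [cx, JJ_mulVec]

theorem cx_rot (φ : ℝ) (ξ : κ × Fin 2 → ℝ) :
    cx (rot (JJ κ) φ *ᵥ ξ) = Complex.exp (φ * Complex.I) • cx ξ := by
  rw [rot, add_mulVec, smul_mulVec, smul_mulVec, one_mulVec, cx_add, cx_smul, cx_smul, cx_JJ,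
    Complex.exp_mul_I]
  funext i
  simp
  ring

theorem JJ_mul_self : JJ κ * JJ κ = -1 := by
  have : J2 * J2 = -1 := by
    ext i j; fin_cases i <;> fin_cases j <;> simp [J2]
  rw [JJ, ← mul_kronecker_mul, this, Matrix.one_mul]
  ext ⟨i, s⟩ ⟨j, t⟩
  simp [kroneckerMap_apply, Matrix.one_apply, Prod.ext_iff]
  split_ifs <;> simp_all

theorem JJ_transpose : (JJ κ)ᵀ = -JJ κ := by
  have : ∀ s t, J2 t s = -J2 s t := by
    intro i j; fin_cases i <;> fin_cases j <;> simp [J2]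
  ext ⟨i, s⟩ ⟨j, t⟩
  simp [JJ, kroneckerMap_apply, this s t, Matrix.one_apply, eq_comm]

/-- The Hessian of `1 / ‖x‖` in complex notation. -/
def invNormHessC (x η : ℂ) : ℂ :=
  (η / 2 + 3 / 2 * (x ^ 2 / (‖x‖ : ℂ) ^ 2) * starRingEnd ℂ η) / (‖x‖ : ℂ) ^ 3

@[simp] theorem invNormHessC_zero (x : ℂ) : invNormHessC x 0 = 0 := by simp [invNormHessC]

theorem norm_mk (v : Fin 2 → ℝ) : ‖(⟨v 0, v 1⟩ : ℂ)‖ = √(∑ s, v s ^ 2) := by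
  rw [Fin.sum_univ_two, Complex.norm_def, Complex.normSq_mk, sq, sq]

theorem invNormHess_mulVec {x : Fin 2 → ℝ} (hx : x ≠ 0) (v : Fin 2 → ℝ) :
    (⟨(invNormHess x *ᵥ v) 0, (invNormHess x *ᵥ v) 1⟩ : ℂ) =
      invNormHessC ⟨x 0, x 1⟩ ⟨v 0, v 1⟩ := by
  rw [invNormHessC, norm_mk]
  have hs : 0 < √(∑ s, x s ^ 2) := (Real.sqrt_pos.2 (sum_sq_pos hx))
  have hsq : √(∑ s, x s ^ 2) ^ 2 = x 0 ^ 2 + x 1 ^ 2 := by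
    rw [Real.sq_sqrt (sum_sq_pos hx).le, Fin.sum_univ_two]
  simp only [mulVec, dotProduct, invNormHess, Fin.sum_univ_two, of_apply]
  rw [Fin.sum_univ_two] at hs hsq
  set d := √(x 0 ^ 2 + x 1 ^ 2) with hd
  obtain ⟨c, hc⟩ : ∃ c : ℝ, c = (d ^ 3)⁻¹ := ⟨_, rfl⟩
  obtain ⟨b, hb⟩ : ∃ b : ℝ, b = 3 / 2 * (d ^ 2)⁻¹ := ⟨_, rfl⟩
  have key : ∀ z w : ℂ, (w / 2 + 3 / 2 * (z ^ 2 / (d : ℂ) ^ 2) * starRingEnd ℂ w) / (d : ℂ) ^ 3 =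
      c * (w / 2 + b * (z ^ 2 * starRingEnd ℂ w)) := by
    intro z w; rw [hc, hb]; push_cast; ring
  rw [key]
  apply Complex.ext
  · simp [sq]
    rw [hc, hb]
    field_simp
    linear_combination (-3 * v 0) * hsq
  · simp [sq]
    rw [hc, hb]
    field_simp
    linear_combination (-3 * v 1) * hsq

end Complex

/-! ## Gradient and Hessian of the potential -/

/-- The difference of the positions of the bodies `i` and `j`. -/
def diffMat (n : ℕ) (i j : Fin (n + 1)) : Matrix (Fin 2) (Body n) ℝ :=
  Matrix.of fun s q => if q.2 = s then (if q.1 = i then 1 else 0) - (if q.1 = j then 1 else 0) else 0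

theorem diffMat_mulVec (n : ℕ) (i j : Fin (n + 1)) (q : Body n → ℝ) (s : Fin 2) :
    (diffMat n i j *ᵥ q) s = q (i, s) - q (j, s) := by
  simp [diffMat, mulVec, dotProduct, Fintype.sum_prod_type_right, sub_mul, Finset.sum_sub_distrib,
    Finset.sum_ite_eq', ite_mul]

theorem vecMul_diffMat (n : ℕ) (i j : Fin (n + 1)) (v : Fin 2 → ℝ) (k : Fin (n + 1)) (s : Fin 2) :
    (v ᵥ* diffMat n i j) (k, s) = (if k = i then v s else 0) - (if k = j then v s else 0) := by
  simp [diffMat, vecMul, dotProduct, mul_sub]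

theorem bodyDist_eq (n : ℕ) (q : Body n → ℝ) (i j : Fin (n + 1)) :
    bodyDist n q i j = √(∑ s, (diffMat n i j *ᵥ q) s ^ 2) := by
  simp only [bodyDist, diffMat_mulVec]

theorem bodyDist_eq_norm (n : ℕ) (q : Body n → ℝ) (i j : Fin (n + 1)) :
    bodyDist n q i j = ‖cx q i - cx q j‖ := by
  rw [bodyDist, ← norm_mk (fun s => q (i, s) - q (j, s))]
  congr 1

/-- Ordered pairs with a factor `1/2` treat all bodies alike: the force on one body is read off
without separating `i < j` from `j < i`. -/
theorem pot_eq (n : ℕ) (m : ℝ) (q : Body n → ℝ) :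
    pot n m q = ∑ i, ∑ j ∈ ({i}ᶜ : Finset (Fin (n + 1))),
      mass n m i * mass n m j / 2 * (1 / √(∑ s, (diffMat n i j *ᵥ q) s ^ 2)) := by
  simp only [← bodyDist_eq]
  have hs : ∀ i j, bodyDist n q i j = bodyDist n q j i := by
    intro i j; rw [bodyDist_eq_norm, bodyDist_eq_norm, norm_sub_rev]
  rw [← Finset.sum_sum_Ioi_add_eq_sum_sum_off_diag
    (f := fun j i => mass n m i * mass n m j / 2 * (1 / bodyDist n q i j)), pot]
  refine Finset.sum_congr rfl fun i _ => Finset.sum_congr rfl fun j _ => ?_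
  rw [hs j i]
  ring

theorem hasGradHess_pot (n : ℕ) (m : ℝ) {q : Body n → ℝ} (hq : Function.Injective (cx q)) :
    HasGradHess (pot n m)
      (fun q => ∑ i, ∑ j ∈ ({i}ᶜ : Finset (Fin (n + 1))), (mass n m i * mass n m j / 2) •
        ((-(1 / √(∑ s, (diffMat n i j *ᵥ q) s ^ 2) ^ 3)) • (diffMat n i j *ᵥ q)) ᵥ* diffMat n i j)
      (∑ i, ∑ j ∈ ({i}ᶜ : Finset (Fin (n + 1))), (mass n m i * mass n m j / 2) •
        ((diffMat n i j)ᵀ * invNormHess (diffMat n i j *ᵥ q) * diffMat n i j)) q := by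
  rw [show pot n m = _ from funext (pot_eq n m)]
  refine HasGradHess.sum _ fun i _ => HasGradHess.sum _ fun j hj => HasGradHess.const_mul _ ?_
  refine HasGradHess.comp (diffMat n i j) (hasGradHess_invNorm fun h => ?_)
  refine (by simpa [eq_comm] using hj : i ≠ j) (hq ?_)
  apply Complex.ext
  · simpa [diffMat_mulVec, sub_eq_zero, cx] using congrFun h 0
  · simpa [diffMat_mulVec, sub_eq_zero, cx] using congrFun h 1

/-- An ordered pair acts by `c i j` on body `i` and by the opposite on body `j`. By antisymmetry
both orders of a pair act equally on `k`; the resulting `2` cancels the `1/2` of `pot_eq`.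
Antisymmetry also kills the diagonal, so `j` may run over all bodies. -/
theorem sum_offDiag_antisymm {κ : Type} [Fintype κ] [DecidableEq κ] (c : κ → κ → ℂ)
    (hc : ∀ i j, c j i = -c i j) (k : κ) :
    ∑ i, ∑ j ∈ ({i}ᶜ : Finset κ), ((if k = i then c i j else 0) - (if k = j then c i j else 0)) =
      2 * ∑ j, c k j := by
  have h0 : ∀ i, c i i = 0 := fun i => by
    have := hc i i
    exact self_eq_neg.1 this
  have : ∀ i, ∑ j ∈ ({i}ᶜ : Finset κ),
      ((if k = i then c i j else 0) - (if k = j then c i j else 0)) =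
      ∑ j, ((if k = i then c i j else 0) - (if k = j then c i j else 0)) := fun i => by
    refine Finset.sum_subset (Finset.subset_univ _) fun j _ hj => ?_
    obtain rfl : j = i := by simpa using hj
    simp
  simp only [this, Finset.sum_sub_distrib]
  rw [Finset.sum_comm]
  simp only [Finset.sum_ite_eq, Finset.mem_univ, if_true]
  simp only [hc k, Finset.sum_neg_distrib]
  ring

theorem cx_vecMul_diffMat (n : ℕ) (i j : Fin (n + 1)) (v : Fin 2 → ℝ) (k : Fin (n + 1)) :
    cx (v ᵥ* diffMat n i j) k =
      (if k = i then (⟨v 0, v 1⟩ : ℂ) else 0) - (if k = j then (⟨v 0, v 1⟩ : ℂ) else 0) := by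
  apply Complex.ext <;> simp only [cx, vecMul_diffMat] <;> split_ifs <;> simp

theorem diffMat_mulVec_complex (n : ℕ) (i j : Fin (n + 1)) (q : Body n → ℝ) :
    (⟨(diffMat n i j *ᵥ q) 0, (diffMat n i j *ᵥ q) 1⟩ : ℂ) = cx q i - cx q j := by
  apply Complex.ext <;> simp [cx, diffMat_mulVec]

theorem cx_grad_pot (n : ℕ) (m : ℝ) {q : Body n → ℝ} (hq : Function.Injective (cx q))
    (k : Fin (n + 1)) :
    cx (grad (pot n m) q) k =
      -∑ j, (mass n m k * mass n m j : ℂ) * ((cx q k - cx q j) / (‖cx q k - cx q j‖ : ℂ) ^ 3) := by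
  rw [(hasGradHess_pot n m hq).grad_eq]
  simp only [cx_sum, Finset.sum_apply, cx_smul, Matrix.smul_vecMul, Pi.smul_apply,
    cx_vecMul_diffMat, diffMat_mulVec_complex, ← norm_mk]
  have := sum_offDiag_antisymm (fun i j => (mass n m i * mass n m j / 2 : ℂ) *
    (-(1 / (‖cx q i - cx q j‖ : ℂ) ^ 3) * (cx q i - cx q j))) (fun i j => by
      rw [norm_sub_rev]; ring) k
  rw [← Finset.sum_neg_distrib]
  rw [Finset.mul_sum] at this
  convert this using 3 with i _ j _
  · split_ifs <;> simp
    ring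
  · ring

theorem cx_hess_pot (n : ℕ) (m : ℝ) {q : Body n → ℝ} (hq : Function.Injective (cx q))
    (ξ : Body n → ℝ) (k : Fin (n + 1)) :
    cx (hess (pot n m) q *ᵥ ξ) k =
      ∑ j, (mass n m k * mass n m j : ℂ) * invNormHessC (cx q k - cx q j) (cx ξ k - cx ξ j) := by
  rw [(hasGradHess_pot n m hq).hess_eq]
  simp only [sum_mulVec, cx_sum, Finset.sum_apply, smul_mulVec, cx_smul, Pi.smul_apply,
    ← mulVec_mulVec, mulVec_transpose, cx_vecMul_diffMat]
  have := sum_offDiag_antisymm (fun i j => (mass n m i * mass n m j / 2 : ℂ) *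
    invNormHessC (cx q i - cx q j) (cx ξ i - cx ξ j)) (fun i j => by
      rw [invNormHessC, invNormHessC, norm_sub_rev, map_sub, map_sub]; ring) k
  refine Eq.trans ?_ (this.trans ?_)
  · refine Finset.sum_congr rfl fun i _ => Finset.sum_congr rfl fun j hj => ?_
    rw [invNormHess_mulVec, diffMat_mulVec_complex, diffMat_mulVec_complex]
    · push_cast
      split_ifs <;> simp
    · intro h
      refine (by simpa [eq_comm] using hj : i ≠ j) (hq ?_)
      apply Complex.ext
      · simpa [diffMat_mulVec, sub_eq_zero, cx] using congrFun h 0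
      · simpa [diffMat_mulVec, sub_eq_zero, cx] using congrFun h 1
  · rw [Finset.mul_sum]
    refine Finset.sum_congr rfl fun j _ => ?_
    ring

/-! ## The potential of the Kepler problem -/

/-- The potential `μ / ‖x‖` of the planar Kepler problem. -/
def potKep (μ : ℝ) (x : Kep → ℝ) : ℝ := μ / √(∑ s : Fin 2, x (0, s) ^ 2)

/-- The projection of `Kep → ℝ` to the plane. -/
def kepMat : Matrix (Fin 2) Kep ℝ := Matrix.of fun s q => if q.2 = s then 1 else 0

theorem kepMat_mulVec (x : Kep → ℝ) (s : Fin 2) : (kepMat *ᵥ x) s = x (0, s) := by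
  simp [kepMat, mulVec, dotProduct, Fintype.sum_prod_type_right]

theorem vecMul_kepMat (v : Fin 2 → ℝ) (q : Kep) : (v ᵥ* kepMat) q = v q.2 := by
  simp [kepMat, vecMul, dotProduct]

theorem hasGradHess_potKep (μ : ℝ) {x : Kep → ℝ} (hx : cx x 0 ≠ 0) :
    HasGradHess (potKep μ)
      (fun x => μ • ((-(1 / √(∑ s, (kepMat *ᵥ x) s ^ 2) ^ 3)) • (kepMat *ᵥ x)) ᵥ* kepMat)
      (μ • (kepMatᵀ * invNormHess (kepMat *ᵥ x) * kepMat)) x := by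
  have : potKep μ = fun x => μ * (1 / √(∑ s, (kepMat *ᵥ x) s ^ 2)) := by
    funext x
    simp only [potKep, kepMat_mulVec, mul_one_div]
  rw [this]
  refine HasGradHess.const_mul _ (HasGradHess.comp kepMat (hasGradHess_invNorm fun h => hx ?_))
  apply Complex.ext
  · simpa [kepMat_mulVec, cx] using congrFun h 0
  · simpa [kepMat_mulVec, cx] using congrFun h 1

theorem kepMat_mulVec_complex (x : Kep → ℝ) :
    (⟨(kepMat *ᵥ x) 0, (kepMat *ᵥ x) 1⟩ : ℂ) = cx x 0 := by
  apply Complex.ext <;> simp [cx, kepMat_mulVec]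

theorem cx_vecMul_kepMat (v : Fin 2 → ℝ) : cx (v ᵥ* kepMat) 0 = ⟨v 0, v 1⟩ := by
  apply Complex.ext <;> simp only [cx, vecMul_kepMat]

theorem cx_grad_potKep (μ : ℝ) {x : Kep → ℝ} (hx : cx x 0 ≠ 0) :
    cx (grad (potKep μ) x) 0 = -(μ * (cx x 0 / (‖cx x 0‖ : ℂ) ^ 3)) := by
  rw [(hasGradHess_potKep μ hx).grad_eq]
  simp only [cx_smul, Matrix.smul_vecMul, Pi.smul_apply, ← norm_mk, kepMat_mulVec_complex]
  rw [cx_vecMul_kepMat, kepMat_mulVec_complex]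
  push_cast
  simp only [smul_eq_mul]
  ring

theorem cx_hess_potKep (μ : ℝ) {x : Kep → ℝ} (hx : cx x 0 ≠ 0) (ξ : Kep → ℝ) :
    cx (hess (potKep μ) x *ᵥ ξ) 0 = μ * invNormHessC (cx x 0) (cx ξ 0) := by
  rw [(hasGradHess_potKep μ hx).hess_eq]
  simp only [smul_mulVec, cx_smul, Pi.smul_apply, ← mulVec_mulVec, mulVec_transpose]
  rw [cx_vecMul_kepMat, invNormHess_mulVec, kepMat_mulVec_complex, kepMat_mulVec_complex]
  · rfl
  · intro h
    refine hx ?_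
    apply Complex.ext
    · simpa [kepMat_mulVec, cx] using congrFun h 0
    · simpa [kepMat_mulVec, cx] using congrFun h 1

/-! ## Fourier modes on the ring -/

/-- The primitive `n`-th root of unity `exp(2πi/n)`. -/
def zet (n : ℕ) : ℂ := Complex.exp (2 * π * Complex.I / n)

/-- The vector with entries `0` at the centre and `x_k ^ a` at the `k`-th vertex. -/
def mode (n : ℕ) (a : ℤ) (i : Fin (n + 1)) : ℂ := if i = 0 then 0 else zet n ^ (a * i.val)

/-- The vector with entry `1` at the centre and `0` elsewhere. -/
def ctr (n : ℕ) (i : Fin (n + 1)) : ℂ := if i = 0 then 1 else 0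

theorem zet_prim {n : ℕ} (hn : n ≠ 0) : IsPrimitiveRoot (zet n) n :=
  Complex.isPrimitiveRoot_exp n hn

theorem zet_ne_zero (n : ℕ) : zet n ≠ 0 := Complex.exp_ne_zero _

theorem zet_pow (n k : ℕ) : zet n ^ k = Complex.exp (ang n k * Complex.I) := by
  rw [zet, ← Complex.exp_nat_mul, ang]
  congr 1
  push_cast
  ring

theorem zet_pow_eq (n k : ℕ) : zet n ^ k = ⟨Real.cos (ang n k), Real.sin (ang n k)⟩ := by
  rw [zet_pow]
  apply Complex.ext
  · simp [Complex.exp_ofReal_mul_I_re]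
  · simp [Complex.exp_ofReal_mul_I_im]

theorem zet_zpow (n : ℕ) (a : ℤ) (k : ℕ) :
    zet n ^ (a * k) = Complex.exp ((a * ang n k : ℝ) * Complex.I) := by
  rw [mul_comm, _root_.zpow_mul, zpow_natCast, zet_pow, ← Complex.exp_int_mul]
  congr 1
  push_cast
  ring

theorem conj_zet (n : ℕ) : starRingEnd ℂ (zet n) = (zet n)⁻¹ := by
  have : zet n = Complex.exp ((2 * π / n : ℝ) * Complex.I) := by
    rw [zet]; congr 1; push_cast; ring
  rw [this, ← Complex.exp_conj, ← Complex.exp_neg]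
  congr 1
  rw [map_mul, Complex.conj_ofReal, Complex.conj_I, mul_neg]

theorem conj_zet_zpow (n : ℕ) (a : ℤ) : starRingEnd ℂ (zet n ^ a) = zet n ^ (-a) := by
  rw [map_zpow₀, conj_zet, _root_.inv_zpow, _root_.zpow_neg]

theorem ang_mul (n k l : ℕ) : ang n (k * l) = l * ang n k := by
  simp only [ang]; push_cast; ring

theorem cx_ringVec (n : ℕ) (c : ℕ → ℝ) (i : Fin (n + 1)) :
    cx (ringVec n c) i = if i = 0 then 0 else (c i.val : ℂ) * zet n ^ i.val := by
  rw [zet_pow_eq]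
  apply Complex.ext <;> simp only [cx, ringVec] <;> split_ifs <;> simp

theorem cx_cfg (n : ℕ) : cx (cfg n) = mode n 1 := by
  funext i
  rw [cfg, cx_ringVec, mode]
  simp

theorem zet_zpow_one_add (n l k : ℕ) :
    zet n ^ ((1 + l : ℤ) * k) = zet n ^ k * Complex.exp ((l * ang n k : ℝ) * Complex.I) := by
  rw [add_mul, zpow_add₀ (zet_ne_zero n), zet_zpow n l, one_mul, zpow_natCast]
  simp

theorem zet_zpow_one_sub (n l k : ℕ) :
    zet n ^ ((1 - l : ℤ) * k) = zet n ^ k * Complex.exp (-(l * ang n k : ℝ) * Complex.I) := by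
  rw [sub_eq_add_neg, add_mul, zpow_add₀ (zet_ne_zero n), zet_zpow n (-l), one_mul, zpow_natCast]
  simp

/-- The radial direction at the `k`-th vertex is itself `ζ^k`, and Euler's formula shifts its
exponent by `±l`. -/
theorem cx_vVec (n l : ℕ) :
    cx (vVec n l) = (1 / 2 : ℂ) • (mode n (1 + l) + mode n (1 - l)) := by
  funext i
  rw [vVec, cx_ringVec, ang_mul]
  simp only [Pi.smul_apply, Pi.add_apply, mode, zet_zpow_one_add, zet_zpow_one_sub]
  split_ifs
  · simp
  · rw [Complex.ofReal_cos, Complex.cos, smul_eq_mul]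
    ring

theorem cx_wVec (n l : ℕ) :
    cx (wVec n l) = (-Complex.I / 2) • (mode n (1 + l) - mode n (1 - l)) := by
  funext i
  rw [wVec, cx_ringVec, ang_mul]
  simp only [Pi.smul_apply, Pi.sub_apply, mode, zet_zpow_one_add, zet_zpow_one_sub]
  split_ifs
  · simp
  · rw [Complex.ofReal_sin, Complex.sin, smul_eq_mul]
    ring

theorem cx_wHat (n : ℕ) : cx (wHat n) = mode n 2 := by
  funext i
  simp only [mode, zet_zpow]
  have : Complex.exp (((2 : ℤ) * ang n i.val : ℝ) * Complex.I) =
      ⟨Real.cos (2 * ang n i.val), Real.sin (2 * ang n i.val)⟩ := by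
    apply Complex.ext
    · rw [Complex.exp_ofReal_mul_I_re]; simp
    · rw [Complex.exp_ofReal_mul_I_im]; simp
  rw [this]
  apply Complex.ext <;> simp only [cx, wHat] <;> split_ifs <;> simp

theorem cx_cHat (n : ℕ) : cx (cHat n) = ctr n + mode n 0 := by
  funext i
  apply Complex.ext <;> simp only [cx, cHat, ctr, mode, Pi.add_apply] <;> split_ifs <;> simp

theorem cx_vHat (n : ℕ) (m : ℝ) : cx (vHat n m) = (-n / m : ℂ) • ctr n + mode n 0 := by
  funext i
  have : (-n / m : ℂ) = ((-n / m : ℝ) : ℂ) := by push_cast; rfl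
  rw [this]
  apply Complex.ext <;>
    simp only [cx, vHat, ctr, mode, Pi.add_apply, Pi.smul_apply] <;> split_ifs <;> simp

/-! ## The Hermitian form of the masses -/

/-- The Hermitian form `∑ mᵢ ūᵢ vᵢ`. -/
def herm (n : ℕ) (m : ℝ) (u v : Fin (n + 1) → ℂ) : ℂ :=
  ∑ i, (mass n m i : ℂ) * (starRingEnd ℂ (u i) * v i)

section Herm

variable (n : ℕ) (m : ℝ) (u u' v v' : Fin (n + 1) → ℂ) (c : ℂ)

theorem herm_add_left : herm n m (u + u') v = herm n m u v + herm n m u' v := by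
  simp only [herm, Pi.add_apply, map_add, ← Finset.sum_add_distrib]
  exact Finset.sum_congr rfl fun i _ => by ring

theorem herm_add_right : herm n m u (v + v') = herm n m u v + herm n m u v' := by
  simp only [herm, Pi.add_apply, ← Finset.sum_add_distrib]
  exact Finset.sum_congr rfl fun i _ => by ring

theorem herm_smul_left : herm n m (c • u) v = starRingEnd ℂ c * herm n m u v := by
  simp only [herm, Pi.smul_apply, smul_eq_mul, map_mul, Finset.mul_sum]
  exact Finset.sum_congr rfl fun i _ => by ring

theorem herm_smul_right : herm n m u (c • v) = c * herm n m u v := by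
  simp only [herm, Pi.smul_apply, smul_eq_mul, Finset.mul_sum]
  exact Finset.sum_congr rfl fun i _ => by ring

theorem herm_sub_left : herm n m (u - u') v = herm n m u v - herm n m u' v := by
  simp only [herm, Pi.sub_apply, map_sub, ← Finset.sum_sub_distrib]
  exact Finset.sum_congr rfl fun i _ => by ring

theorem herm_sub_right : herm n m u (v - v') = herm n m u v - herm n m u v' := by
  simp only [herm, Pi.sub_apply, ← Finset.sum_sub_distrib]
  exact Finset.sum_congr rfl fun i _ => by ring

theorem herm_conj : starRingEnd ℂ (herm n m u v) = herm n m v u := by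
  simp only [herm, map_sum, map_mul, Complex.conj_ofReal, Complex.conj_conj]
  exact Finset.sum_congr rfl fun i _ => by ring

end Herm

/-- A geometric sum whose ratio `ζ^a` is an `n`-th root of unity, equal to `1` exactly when `n`
divides `a`. The vertices are numbered from `1` to `n`. -/
theorem sum_zet_zpow {n : ℕ} (hn : n ≠ 0) (a : ℤ) :
    ∑ k : Fin n, zet n ^ (a * (k.val + 1 : ℕ)) = if (n : ℤ) ∣ a then (n : ℂ) else 0 := by
  have h1 : ∀ k : ℕ, zet n ^ (a * (k + 1 : ℕ)) = zet n ^ a * (zet n ^ a) ^ k := fun k => by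
    rw [_root_.zpow_mul, zpow_natCast, pow_succ']
  simp only [h1]
  rw [← Finset.mul_sum, Fin.sum_univ_eq_sum_range (fun k => (zet n ^ a) ^ k)]
  split_ifs with h
  · rw [((zet_prim hn).zpow_eq_one_iff_dvd a).2 h]
    simp
  · have h2 : zet n ^ a ≠ 1 := fun h' => h (((zet_prim hn).zpow_eq_one_iff_dvd a).1 h')
    have h3 : (zet n ^ a) ^ n = 1 := by
      rw [← zpow_natCast, ← _root_.zpow_mul, mul_comm, _root_.zpow_mul, zpow_natCast, (zet_prim hn).pow_eq_one,
        _root_.one_zpow]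
    rw [geom_sum_eq h2, h3]
    simp

theorem sum_body {n : ℕ} (f : Fin (n + 1) → ℂ) : ∑ i, f i = f 0 + ∑ k : Fin n, f k.succ :=
  Fin.sum_univ_succ f

theorem mode_zero_apply (n : ℕ) (a : ℤ) : mode n a 0 = 0 := by simp [mode]

theorem mode_succ (n : ℕ) (a : ℤ) (k : Fin n) :
    mode n a k.succ = zet n ^ (a * (k.val + 1 : ℕ)) := by
  simp [mode, Fin.succ_ne_zero]

theorem ctr_zero_apply (n : ℕ) : ctr n 0 = 1 := by simp [ctr]

theorem ctr_succ (n : ℕ) (k : Fin n) : ctr n k.succ = 0 := by simp [ctr, Fin.succ_ne_zero]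

theorem mass_zero (n : ℕ) (m : ℝ) : mass n m 0 = m := by simp [mass]

theorem mass_succ (n : ℕ) (m : ℝ) (k : Fin n) : mass n m k.succ = 1 := by
  simp [mass, Fin.succ_ne_zero]

theorem herm_mode_mode {n : ℕ} (hn : n ≠ 0) (m : ℝ) (a b : ℤ) :
    herm n m (mode n a) (mode n b) = if (n : ℤ) ∣ b - a then (n : ℂ) else 0 := by
  rw [herm, sum_body, ← sum_zet_zpow hn]
  simp only [mode_zero_apply, mode_succ, mass_succ, conj_zet_zpow, ← zpow_add₀ (zet_ne_zero n)]
  simp only [mul_zero, zero_add, Complex.ofReal_one, one_mul]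
  exact Finset.sum_congr rfl fun k _ => by congr 1; ring

theorem herm_mode_self {n : ℕ} (hn : n ≠ 0) (m : ℝ) (a : ℤ) :
    herm n m (mode n a) (mode n a) = n := by
  rw [herm_mode_mode hn, sub_self, if_pos (dvd_zero _)]

theorem herm_mode_ne {n : ℕ} (hn : n ≠ 0) (m : ℝ) {a b : ℤ} (h : b ≠ a) (h1 : b - a < n)
    (h2 : a - b < n) : herm n m (mode n a) (mode n b) = 0 := by
  rw [herm_mode_mode hn, if_neg]
  intro hd
  exact h (sub_eq_zero.1 (Int.eq_zero_of_abs_lt_dvd hd (abs_lt.2 ⟨by omega, h1⟩)))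

theorem herm_ctr_ctr (n : ℕ) (m : ℝ) : herm n m (ctr n) (ctr n) = m := by
  rw [herm, sum_body]
  simp [ctr_zero_apply, ctr_succ, mass_zero]

theorem herm_ctr_mode (n : ℕ) (m : ℝ) (a : ℤ) : herm n m (ctr n) (mode n a) = 0 := by
  rw [herm, sum_body]
  simp [ctr_succ, mode_zero_apply]

theorem herm_mode_ctr (n : ℕ) (m : ℝ) (a : ℤ) : herm n m (mode n a) (ctr n) = 0 := by
  rw [herm, sum_body]
  simp [ctr_succ, mode_zero_apply]

theorem mode_congr {n : ℕ} (hn : n ≠ 0) {a b : ℤ} (h : (n : ℤ) ∣ b - a) :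
    mode n a = mode n b := by
  funext i
  simp only [mode]
  split_ifs
  · rfl
  · have : b = a + (b - a) := by ring
    rw [_root_.zpow_mul, _root_.zpow_mul, this, zpow_add₀ (zet_ne_zero n),
      ((zet_prim hn).zpow_eq_one_iff_dvd _).2 h, mul_one]

/-! ## The matrix `A` -/

/-- When `2l = n`, the exponents `1 + l` and `1 - l` agree modulo `n`. So `v(n/2)` is a single mode
and `w(n/2)` would vanish, which is why this block has half the size. -/
theorem essVec_half {n l : ℕ} (m : ℝ) (hn : n ≠ 0) (h : 2 * l = n) (i : Fin 2) :
    cx (essVec n m l i) = ((1 / √(n : ℝ) : ℝ) : ℂ) • mode n (1 + l) := by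
  have e : mode n (1 - l) = mode n (1 + l) := mode_congr hn ⟨1, by rw [← h]; push_cast; ring⟩
  rw [essVec, if_pos h, cx_smul, cx_vVec, e]
  congr 1
  rw [← two_smul ℂ (mode n (1 + l)), smul_smul]
  norm_num

theorem essVec_one_zero {n : ℕ} (m : ℝ) (hn : 3 ≤ n) :
    cx (essVec n m 1 0) = ((√(m / ((n : ℝ) ^ 2 + m * n)) : ℝ) : ℂ) •
      ((-n / m : ℂ) • ctr n + mode n 0) := by
  rw [essVec, if_neg (by omega), if_pos rfl, ← cx_vHat, ← cx_smul]
  rfl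

theorem essVec_one_one {n : ℕ} (m : ℝ) (hn : 3 ≤ n) :
    cx (essVec n m 1 1) = ((1 / √(n : ℝ) : ℝ) : ℂ) • mode n 2 := by
  rw [essVec, if_neg (by omega), if_pos rfl, ← cx_wHat, ← cx_smul]
  rfl

theorem essVec_mid_zero {n l : ℕ} (m : ℝ) (h : 2 * l ≠ n) (h1 : l ≠ 1) :
    cx (essVec n m l 0) = ((√(2 / (n : ℝ)) : ℝ) : ℂ) •
      ((1 / 2 : ℂ) • (mode n (1 + l) + mode n (1 - l))) := by
  rw [essVec, if_neg h, if_neg h1, ← cx_vVec, ← cx_smul]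
  rfl

theorem essVec_mid_one {n l : ℕ} (m : ℝ) (h : 2 * l ≠ n) (h1 : l ≠ 1) :
    cx (essVec n m l 1) = ((√(2 / (n : ℝ)) : ℝ) : ℂ) •
      ((-Complex.I / 2) • (mode n (1 + l) - mode n (1 - l))) := by
  rw [essVec, if_neg h, if_neg h1, ← cx_wVec, ← cx_smul]
  rfl

/-- A common shape for all essential vectors, sufficient for orthogonality between different blocks.
The relation for `l = 1`, where `mode n (1 - l)` is `mode n 0`, places the centre of mass at the
origin. -/
theorem essVec_span {n l : ℕ} {m : ℝ} (hm : 0 < m) (hn : 3 ≤ n) (i : Fin 2) :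
    ∃ c₀ c₁ c₂ : ℂ, cx (essVec n m l i) =
      c₀ • ctr n + c₁ • mode n (1 + l) + c₂ • mode n (1 - l) ∧
      (l ≠ 1 → c₀ = 0) ∧ (l = 1 → c₀ * m + n * c₂ = 0) := by
  have hm' : (m : ℂ) ≠ 0 := by exact_mod_cast hm.ne'
  by_cases h : 2 * l = n
  · refine ⟨0, ((1 / √(n : ℝ) : ℝ) : ℂ), 0, ?_, fun _ => rfl, fun h1 => by omega⟩
    rw [essVec_half m (by omega) h]
    simp
  · by_cases h1 : l = 1
    · subst h1
      fin_cases i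
      · refine ⟨((√(m / ((n : ℝ) ^ 2 + m * n)) : ℝ) : ℂ) * (-n / m), 0,
          ((√(m / ((n : ℝ) ^ 2 + m * n)) : ℝ) : ℂ), ?_, fun h => absurd rfl h, fun _ => ?_⟩
        · refine (essVec_one_zero m hn).trans ?_
          simp [smul_smul]
        · field_simp
          ring
      · refine ⟨0, ((1 / √(n : ℝ) : ℝ) : ℂ), 0, ?_, fun h => absurd rfl h, fun _ => by simp⟩
        refine (essVec_one_one m hn).trans ?_
        simp
    · fin_cases i
      · refine ⟨0, ((√(2 / (n : ℝ)) : ℝ) : ℂ) / 2, ((√(2 / (n : ℝ)) : ℝ) : ℂ) / 2, ?_,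
          fun _ => rfl, fun h => absurd h h1⟩
        refine (essVec_mid_zero m h h1).trans ?_
        module
      · refine ⟨0, -((√(2 / (n : ℝ)) : ℝ) : ℂ) * Complex.I / 2,
          ((√(2 / (n : ℝ)) : ℝ) : ℂ) * Complex.I / 2, ?_, fun _ => rfl, fun h => absurd h h1⟩
        refine (essVec_mid_one m h h1).trans ?_
        module

/-- For distinct `l, l' ≤ n/2` both `|l - l'|` and `l + l'` lie strictly between `0` and `n`, so no
exponent `1 ± l` is congruent to an exponent `1 ± l'`. The central vector occurs only for `l = 1`,
hence in at most one of the two factors. -/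
theorem herm_essVec_of_ne {n l l' : ℕ} {m : ℝ} (hm : 0 < m) (hn : 3 ≤ n) (hl : 1 ≤ l)
    (hl2 : l ≤ n / 2) (hl' : 1 ≤ l') (hl2' : l' ≤ n / 2) (h : l ≠ l') (i j : Fin 2) :
    herm n m (cx (essVec n m l i)) (cx (essVec n m l' j)) = 0 := by
  obtain ⟨c₀, c₁, c₂, e, h0, -⟩ := essVec_span (l := l) hm hn i
  obtain ⟨d₀, d₁, d₂, e', h0', -⟩ := essVec_span (l := l') hm hn j
  have hn0 : n ≠ 0 := by omega
  have hz : c₀ = 0 ∨ d₀ = 0 := by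
    by_cases h1 : l = 1
    · exact Or.inr (h0' (by omega))
    · exact Or.inl (h0 h1)
  rw [e, e']
  simp only [herm_add_left, herm_add_right, herm_smul_left, herm_smul_right, herm_ctr_ctr,
    herm_ctr_mode, herm_mode_ctr]
  rw [herm_mode_ne hn0 m (a := 1 + l) (b := 1 + l') (by omega) (by omega) (by omega),
    herm_mode_ne hn0 m (a := 1 + l) (b := 1 - l') (by omega) (by omega) (by omega),
    herm_mode_ne hn0 m (a := 1 - l) (b := 1 + l') (by omega) (by omega) (by omega),
    herm_mode_ne hn0 m (a := 1 - l) (b := 1 - l') (by omega) (by omega) (by omega)]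
  rcases hz with hz | hz <;> simp [hz]

theorem herm_cfg_essVec {n l : ℕ} {m : ℝ} (hm : 0 < m) (hn : 3 ≤ n) (hl : 1 ≤ l)
    (hl2 : l ≤ n / 2) (i : Fin 2) :
    herm n m (mode n 1) (cx (essVec n m l i)) = 0 := by
  obtain ⟨c₀, c₁, c₂, e, -⟩ := essVec_span (l := l) hm hn i
  have hn0 : n ≠ 0 := by omega
  rw [e]
  simp only [herm_add_right, herm_smul_right, herm_mode_ctr]
  rw [herm_mode_ne hn0 m (a := 1) (b := 1 + l) (by omega) (by omega) (by omega),
    herm_mode_ne hn0 m (a := 1) (b := 1 - l) (by omega) (by omega) (by omega)]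
  simp

theorem herm_cHat_essVec {n l : ℕ} {m : ℝ} (hm : 0 < m) (hn : 3 ≤ n) (hl : 1 ≤ l)
    (hl2 : l ≤ n / 2) (i : Fin 2) :
    herm n m (ctr n + mode n 0) (cx (essVec n m l i)) = 0 := by
  obtain ⟨c₀, c₁, c₂, e, h0, h1⟩ := essVec_span (l := l) hm hn i
  have hn0 : n ≠ 0 := by omega
  rw [e]
  simp only [herm_add_right, herm_smul_right, herm_add_left, herm_mode_ctr, herm_ctr_ctr,
    herm_ctr_mode]
  rw [herm_mode_ne hn0 m (a := 0) (b := 1 + l) (by omega) (by omega) (by omega)]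
  by_cases hl1 : l = 1
  · subst hl1
    rw [show (1 - ((1 : ℕ) : ℤ)) = 0 by norm_num, herm_mode_self hn0]
    linear_combination h1 rfl
  · rw [herm_mode_ne hn0 m (a := 0) (b := 1 - l) (by omega) (by omega) (by omega), h0 hl1]
    simp

theorem herm_essVec_self {n l : ℕ} {m : ℝ} (hm : 0 < m) (hn : 3 ≤ n) (hl : 1 ≤ l)
    (hl2 : l ≤ n / 2) (i j : Fin (half n l)) :
    herm n m (cx (essVec n m l (Fin.castLE (half_le n l) i)))
      (cx (essVec n m l (Fin.castLE (half_le n l) j))) = if i = j then 1 else 0 := by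
  have hn0 : n ≠ 0 := by omega
  have hnp : (0 : ℝ) < n := by exact_mod_cast (by omega : 0 < n)
  have hs : ((1 / √(n : ℝ) : ℝ) : ℂ) * ((1 / √(n : ℝ) : ℝ) : ℂ) * n = 1 := by
    rw [← Complex.ofReal_mul, ← Complex.ofReal_natCast, ← Complex.ofReal_mul,
      Complex.ofReal_eq_one, div_mul_div_comm, Real.mul_self_sqrt hnp.le]
    field_simp
  by_cases h : 2 * l = n
  · have : half n l = 1 := by simp [half, h]
    rw [if_pos (by ext; omega), essVec_half m hn0 h, essVec_half m hn0 h, herm_smul_left,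
      herm_smul_right, herm_mode_self hn0, Complex.conj_ofReal, ← mul_assoc, hs]
  · have key : ∀ i j : Fin 2, herm n m (cx (essVec n m l i)) (cx (essVec n m l j)) =
        if i = j then 1 else 0 := by
      have h10 : herm n m (cx (essVec n m l 0)) (cx (essVec n m l 1)) = 0 := by
        by_cases h1 : l = 1
        · subst h1
          rw [essVec_one_zero m hn, essVec_one_one m hn]
          simp only [herm_smul_left, herm_smul_right, herm_add_left, herm_ctr_mode]
          rw [herm_mode_ne hn0 m (a := 0) (b := 2) (by omega) (by omega) (by omega)]
          simp
        · rw [essVec_mid_zero m h h1, essVec_mid_one m h h1]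
          simp only [herm_smul_left, herm_smul_right, herm_add_left, herm_sub_right]
          rw [herm_mode_ne hn0 m (a := 1 + l) (b := 1 - l) (by omega) (by omega) (by omega),
            herm_mode_ne hn0 m (a := 1 - l) (b := 1 + l) (by omega) (by omega) (by omega),
            herm_mode_self hn0, herm_mode_self hn0]
          simp
      have h00 : herm n m (cx (essVec n m l 0)) (cx (essVec n m l 0)) = 1 := by
        by_cases h1 : l = 1
        · subst h1
          rw [essVec_one_zero m hn]
          simp only [herm_smul_left, herm_smul_right, herm_add_left, herm_add_right, herm_ctr_mode,
            herm_mode_ctr, herm_ctr_ctr, herm_mode_self hn0]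
          have h3 : (0 : ℝ) ≤ m / ((n : ℝ) ^ 2 + m * n) := by positivity
          -- The central body contributes `m (n/m)² = n²/m` and the ring contributes `n`; their sum
          -- `(n² + mn)/m` is the inverse square of the scaling factor.
          have h2 : (√(m / ((n : ℝ) ^ 2 + m * n)) * √(m / ((n : ℝ) ^ 2 + m * n))) *
              ((-n / m) * ((-n / m) * m) + n) = 1 := by
            rw [Real.mul_self_sqrt h3]
            field_simp
          have h4 := congrArg (fun x : ℝ => (x : ℂ)) h2
          push_cast at h4
          simp only [map_div₀, map_neg, Complex.conj_ofReal, Complex.conj_natCast]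
          linear_combination h4
        · rw [essVec_mid_zero m h h1]
          simp only [herm_smul_left, herm_smul_right, herm_add_left, herm_add_right]
          rw [herm_mode_ne hn0 m (a := 1 + l) (b := 1 - l) (by omega) (by omega) (by omega),
            herm_mode_ne hn0 m (a := 1 - l) (b := 1 + l) (by omega) (by omega) (by omega),
            herm_mode_self hn0, herm_mode_self hn0]
          have h3 : √(2 / (n : ℝ)) * √(2 / (n : ℝ)) * (n / 2) = 1 := by
            rw [Real.mul_self_sqrt (by positivity)]
            field_simp
          have h4 := congrArg (fun x : ℝ => (x : ℂ)) h3
          push_cast at h4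
          simp only [map_div₀, map_one, map_ofNat, Complex.conj_ofReal]
          linear_combination h4
      have h11 : herm n m (cx (essVec n m l 1)) (cx (essVec n m l 1)) = 1 := by
        by_cases h1 : l = 1
        · subst h1
          rw [essVec_one_one m hn]
          simp only [herm_smul_left, herm_smul_right, herm_mode_self hn0]
          rw [Complex.conj_ofReal, ← mul_assoc, hs]
        · rw [essVec_mid_one m h h1]
          simp only [herm_smul_left, herm_smul_right, herm_sub_left, herm_sub_right]
          rw [herm_mode_ne hn0 m (a := 1 + l) (b := 1 - l) (by omega) (by omega) (by omega),
            herm_mode_ne hn0 m (a := 1 - l) (b := 1 + l) (by omega) (by omega) (by omega),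
            herm_mode_self hn0, herm_mode_self hn0]
          have h3 : √(2 / (n : ℝ)) * √(2 / (n : ℝ)) * (n / 2) = 1 := by
            rw [Real.mul_self_sqrt (by positivity)]
            field_simp
          have h4 := congrArg (fun x : ℝ => (x : ℂ)) h3
          push_cast at h4
          simp only [map_div₀, map_neg, map_ofNat, Complex.conj_ofReal, Complex.conj_I]
          linear_combination h4 - (√(2 / n : ℝ) : ℂ) ^ 2 * n / 2 * Complex.I_sq
      have h01 : herm n m (cx (essVec n m l 1)) (cx (essVec n m l 0)) = 0 := by
        rw [← herm_conj, h10, map_zero]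
      intro i j
      fin_cases i <;> fin_cases j
      exacts [h00, h10, h01, h11]
    rw [key]
    simp [Fin.ext_iff]

theorem dotProduct_mass (n : ℕ) (m : ℝ) (u v : Body n → ℝ) :
    u ⬝ᵥ (MM n m *ᵥ v) = (herm n m (cx u) (cx v)).re := by
  simp only [MM, herm, dotProduct, mulVec_diagonal, Complex.re_sum, Fintype.sum_prod_type,
    Fin.sum_univ_two, cmass]
  refine Finset.sum_congr rfl fun i _ => ?_
  simp [cx]
  ring

/-- The column of `pairCols u` with index `(i, s)`. -/
theorem cx_pairCols {n k : ℕ} (u : Fin k → Body n → ℝ) (p : Fin k × Fin 2) :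
    cx (fun q => pairCols u q p) = ![1, Complex.I] p.2 • cx (u p.1) := by
  obtain ⟨i, s⟩ := p
  fin_cases s
  · simp [pairCols]
  · simpa [pairCols] using cx_JJ (u i)

theorem gram_apply {α β : Type} (n : ℕ) (m : ℝ) (X : Matrix (Body n) α ℝ) (Y : Matrix (Body n) β ℝ)
    (a : α) (b : β) : (Xᵀ * MM n m * Y) a b =
      (herm n m (cx fun q => X q a) (cx fun q => Y q b)).re := by
  rw [← dotProduct_mass, Matrix.mul_assoc, Matrix.mul_apply_eq_vecMul, ← Matrix.mul_apply_eq_vecMul]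
  simp only [Matrix.mul_apply, transpose_apply, dotProduct, mulVec]

/-- Passing from `u` to `𝕁u` multiplies by `i`. Since `herm n m u v` is real, the mixed products are
purely imaginary, so complex orthonormality of the `u` gives real orthonormality of the `u` together
with the `𝕁u`. -/
theorem re_herm_pair {n : ℕ} {m : ℝ} {u v : Fin (n + 1) → ℂ} {c : ℝ} (h : herm n m u v = c)
    (s t : Fin 2) :
    (herm n m (![1, Complex.I] s • u) (![1, Complex.I] t • v)).re = if s = t then c else 0 := by
  rw [herm_smul_left, herm_smul_right, h]
  fin_cases s <;> fin_cases t <;> simp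

theorem cx_cen_vec (n : ℕ) (m : ℝ) :
    cx ((1 / √(m + n)) • cHat n) = ((1 / √(m + n) : ℝ) : ℂ) • (ctr n + mode n 0) := by
  rw [cx_smul, cx_cHat]

theorem cx_kep_vec (n : ℕ) :
    cx ((1 / √(n : ℝ)) • cfg n) = ((1 / √(n : ℝ) : ℝ) : ℂ) • mode n 1 := by
  rw [cx_smul, cx_cfg]

theorem cx_AFull_cen (n : ℕ) (m : ℝ) (p : Fin 1 × Fin 2) :
    cx (fun q => AFull n m q (Sum.inl p)) =
      ![1, Complex.I] p.2 • cx ((1 / √(m + n)) • cHat n) :=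
  cx_pairCols (fun _ : Fin 1 => (1 / √(m + n)) • cHat n) p

theorem cx_AFull_kep (n : ℕ) (m : ℝ) (p : Kep) :
    cx (fun q => AFull n m q (Sum.inr (Sum.inl p))) =
      ![1, Complex.I] p.2 • cx ((1 / √(n : ℝ)) • cfg n) :=
  cx_pairCols (fun _ : Fin 1 => (1 / √(n : ℝ)) • cfg n) p

theorem cx_AFull_ess (n : ℕ) (m : ℝ) (l : Fin (n / 2)) (p : Blk n (l.val + 1)) :
    cx (fun q => AFull n m q (Sum.inr (Sum.inr ⟨l, p⟩))) =
      ![1, Complex.I] p.2 • cx (essVec n m (l.val + 1) (Fin.castLE (half_le n (l.val + 1)) p.1)) :=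
  cx_pairCols (fun i => essVec n m (l.val + 1) (Fin.castLE (half_le n (l.val + 1)) i)) p

theorem transpose_AFull_mul {n : ℕ} (hn : 3 ≤ n) {m : ℝ} (hm : 0 < m) :
    (AFull n m)ᵀ * MM n m * AFull n m = 1 := by
  have hn0 : n ≠ 0 := by omega
  have hnp : (0 : ℝ) < n := by exact_mod_cast (by omega : 0 < n)
  have hcc : herm n m (cx ((1 / √(m + n)) • cHat n)) (cx ((1 / √(m + n)) • cHat n)) = (1 : ℝ) := by
    rw [cx_cen_vec]
    simp only [herm_smul_left, herm_smul_right, herm_add_left, herm_add_right, herm_ctr_mode,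
            herm_mode_ctr, herm_ctr_ctr, herm_mode_self hn0, Complex.conj_ofReal]
    have h2 : 1 / √(m + n) * (1 / √(m + n) * (m + n)) = 1 := by
      rw [← mul_assoc, div_mul_div_comm, Real.mul_self_sqrt (by positivity)]
      field_simp
    refine Eq.trans ?_ (congrArg (fun x : ℝ => (x : ℂ)) h2)
    push_cast
    ring
  have hkk : herm n m (cx ((1 / √(n : ℝ)) • cfg n)) (cx ((1 / √(n : ℝ)) • cfg n)) = (1 : ℝ) := by
    rw [cx_kep_vec]
    simp only [herm_smul_left, herm_smul_right, herm_mode_self hn0, Complex.conj_ofReal]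
    have h2 : 1 / √(n : ℝ) * (1 / √(n : ℝ) * n) = 1 := by
      rw [← mul_assoc, div_mul_div_comm, Real.mul_self_sqrt (by positivity)]
      field_simp
    refine Eq.trans ?_ (congrArg (fun x : ℝ => (x : ℂ)) h2)
    push_cast
    ring
  have hck : herm n m (cx ((1 / √(m + n)) • cHat n)) (cx ((1 / √(n : ℝ)) • cfg n)) = (0 : ℝ) := by
    rw [cx_cen_vec, cx_kep_vec]
    simp only [herm_smul_left, herm_smul_right, herm_add_left, herm_ctr_mode]
    rw [herm_mode_ne hn0 m (a := 0) (b := 1) (by omega) (by omega) (by omega)]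
    simp
  have hkc : herm n m (cx ((1 / √(n : ℝ)) • cfg n)) (cx ((1 / √(m + n)) • cHat n)) = (0 : ℝ) := by
    rw [← herm_conj, hck]
    simp
  have hce : ∀ l i, 1 ≤ l → l ≤ n / 2 →
      herm n m (cx ((1 / √(m + n)) • cHat n)) (cx (essVec n m l i)) = (0 : ℝ) := by
    intro l i h1 h2
    rw [cx_cen_vec, herm_smul_left, herm_cHat_essVec hm hn h1 h2]
    simp
  have hke : ∀ l i, 1 ≤ l → l ≤ n / 2 →
      herm n m (cx ((1 / √(n : ℝ)) • cfg n)) (cx (essVec n m l i)) = (0 : ℝ) := by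
    intro l i h1 h2
    rw [cx_kep_vec, herm_smul_left, herm_cfg_essVec hm hn h1 h2]
    simp
  have hec : ∀ l i, 1 ≤ l → l ≤ n / 2 →
      herm n m (cx (essVec n m l i)) (cx ((1 / √(m + n)) • cHat n)) = (0 : ℝ) := by
    intro l i h1 h2
    rw [← herm_conj, hce l i h1 h2]
    simp
  have hek : ∀ l i, 1 ≤ l → l ≤ n / 2 →
      herm n m (cx (essVec n m l i)) (cx ((1 / √(n : ℝ)) • cfg n)) = (0 : ℝ) := by
    intro l i h1 h2
    rw [← herm_conj, hke l i h1 h2]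
    simp
  ext p p'
  rw [gram_apply]
  rcases p with p | p | ⟨l, p⟩ <;> rcases p' with p' | p' | ⟨l', p'⟩ <;>
    simp only [cx_AFull_cen, cx_AFull_kep, cx_AFull_ess]
  · rw [re_herm_pair hcc]
    simp [Matrix.one_apply, Prod.ext_iff, Subsingleton.elim p.1 p'.1]
  · rw [re_herm_pair hck]
    simp
  · rw [re_herm_pair (hce _ _ (by omega) (by omega))]
    simp
  · rw [re_herm_pair hkc]
    simp
  · rw [re_herm_pair hkk]
    simp [Matrix.one_apply, Prod.ext_iff, Subsingleton.elim p.1 p'.1]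
  · rw [re_herm_pair (hke _ _ (by omega) (by omega))]
    simp
  · rw [re_herm_pair (hec _ _ (by omega) (by omega))]
    simp
  · rw [re_herm_pair (hek _ _ (by omega) (by omega))]
    simp
  · by_cases h : l = l'
    · subst h
      rw [re_herm_pair (c := if p.1 = p'.1 then 1 else 0)]
      · simp [Matrix.one_apply, Prod.ext_iff]
        grind
      · rw [herm_essVec_self hm hn (by omega) (by omega)]
        split_ifs <;> simp
    · rw [re_herm_pair (c := 0)]
      · simp [h]
      · rw [herm_essVec_of_ne hm hn (by omega) (by omega) (by omega) (by omega)
          (fun h' => h (by ext; omega))]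
        simp

/-- Each pair of columns `u, 𝕁u` is closed under `𝕁` because `𝕁(𝕁u) = -u`, and on it `𝕁` has the
matrix `J₂`. -/
theorem JJ_mul_pairCols {n k : ℕ} (u : Fin k → Body n → ℝ) :
    JJ (Fin (n + 1)) * pairCols u = pairCols u * JJ (Fin k) := by
  ext q ⟨i, s⟩
  have h1 : (JJ (Fin (n + 1)) * pairCols u) q (i, s) =
      (JJ (Fin (n + 1)) *ᵥ fun q => pairCols u q (i, s)) q := rfl
  have h2 : (pairCols u * JJ (Fin k)) q (i, s) = ∑ t, pairCols u q (i, t) * J2 t s := by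
    simp [JJ, Matrix.mul_apply, Fintype.sum_prod_type, kroneckerMap_apply, Matrix.one_apply]
  rw [h1, h2]
  fin_cases s
  · simp [J2, pairCols]
  · simp only [J2, pairCols, Fin.mk_one, of_apply]
    rw [show (fun q => ![u i q, (JJ (Fin (n + 1)) *ᵥ u i) q] 1) = JJ (Fin (n + 1)) *ᵥ u i from rfl,
      mulVec_mulVec, JJ_mul_self]
    simp [neg_mulVec]

/-- The essential part of `A`. -/
def AEss (n : ℕ) (m : ℝ) : Matrix (Body n) (Ess n) ℝ :=
  Matrix.of fun q p => ABlk n m (p.1.val + 1) q p.2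

theorem ARed_eq (n : ℕ) (m : ℝ) : ARed n m = fromCols (AKep n) (AEss n m) := rfl

theorem mul_AEss {n : ℕ} {m : ℝ} {X : Matrix (Body n) (Body n) ℝ}
    {D : (l : Fin (n / 2)) → Matrix (Blk n (l.val + 1)) (Blk n (l.val + 1)) ℝ}
    (h : ∀ l : Fin (n / 2), X * ABlk n m (l.val + 1) = ABlk n m (l.val + 1) * D l) :
    X * AEss n m = AEss n m * blockDiagonal' D := by
  ext q ⟨l, p⟩
  have h1 : (X * AEss n m) q ⟨l, p⟩ = (X * ABlk n m (l.val + 1)) q p := rfl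
  rw [h1, h]
  simp only [Matrix.mul_apply, Fintype.sum_sigma]
  rw [Finset.sum_eq_single l]
  · simp [AEss, blockDiagonal'_apply]
  · intro l' _ hl
    refine Finset.sum_eq_zero fun p' _ => ?_
    rw [blockDiagonal'_apply_ne _ _ _ hl, mul_zero]
  · simp

theorem JJ_mul_ARed (n : ℕ) (m : ℝ) :
    JJ (Fin (n + 1)) * ARed n m = ARed n m * JConf n := by
  rw [ARed_eq, JConf, mul_fromCols, fromCols_mul_fromBlocks, mul_AEss (fun l => JJ_mul_pairCols _),
    AKep, JJ_mul_pairCols]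
  simp

theorem JJ_mul_AFull (n : ℕ) (m : ℝ) :
    JJ (Fin (n + 1)) * AFull n m = AFull n m * fromBlocks (JJ (Fin 1)) 0 0 (JConf n) := by
  rw [AFull, mul_fromCols, fromCols_mul_fromBlocks, JJ_mul_ARed, ACen, JJ_mul_pairCols]
  simp

/-- For odd `n` there are `(n-1)/2` full blocks; for even `n` there are `n/2 - 1` full blocks and
one of half size. With the centre of mass and the Kepler coordinates this makes `n + 1` pairs of
columns. -/
theorem sum_half (n : ℕ) (hn : 3 ≤ n) : ∑ l : Fin (n / 2), half n (l.val + 1) = n - 1 := by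
  rw [Fin.sum_univ_eq_sum_range (fun l => half n (l + 1))]
  rcases Nat.even_or_odd' n with ⟨k, rfl | rfl⟩
  · obtain ⟨k, rfl⟩ : ∃ j, k = j + 1 := ⟨k - 1, by omega⟩
    rw [show 2 * (k + 1) / 2 = k + 1 by omega, Finset.sum_range_succ]
    have : ∀ l ∈ Finset.range k, half (2 * (k + 1)) (l + 1) = 2 := fun l hl => by
      rw [half, if_neg]
      have := Finset.mem_range.1 hl
      omega
    rw [Finset.sum_congr rfl this]
    simp [half]
    omega
  · rw [show (2 * k + 1) / 2 = k by omega]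
    have : ∀ l ∈ Finset.range k, half (2 * k + 1) (l + 1) = 2 := fun l hl => by
      rw [half, if_neg]
      omega
    rw [Finset.sum_congr rfl this]
    simp
    omega

theorem card_conf (n : ℕ) (hn : 3 ≤ n) :
    Fintype.card (Body n) = Fintype.card ((Fin 1 × Fin 2) ⊕ Conf n) := by
  simp only [Fintype.card_sum, Fintype.card_prod, Fintype.card_fin, Fintype.card_sigma,
    ← Finset.sum_mul, sum_half n hn]
  omega

/-- The Gram identity gives a left inverse of `A`; it is also a right inverse because `card_conf`
makes `A` square. -/
theorem AFull_mul_transpose {n : ℕ} (hn : 3 ≤ n) {m : ℝ} (hm : 0 < m) :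
    AFull n m * ((AFull n m)ᵀ * MM n m) = 1 :=
  (Matrix.mul_eq_one_comm_of_card_eq _ _ ℝ (card_conf n hn).symm).1 (transpose_AFull_mul hn hm)

theorem isUnit_MM {m : ℝ} (hm : 0 < m) (n : ℕ) : IsUnit (MM n m).det := by
  rw [MM, det_diagonal, isUnit_iff_ne_zero, Finset.prod_ne_zero_iff]
  intro q _
  rw [cmass, mass]
  split_ifs
  exacts [hm.ne', one_ne_zero]

/-! ## Sums over the ring -/

theorem sum_range_add_of_periodic {E : Type} [AddCommGroup E] {n : ℕ} {F : ℕ → E}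
    (hF : ∀ j, F (j + n) = F j) (K : ℕ) :
    ∑ j ∈ Finset.range n, F (K + j) = ∑ j ∈ Finset.range n, F j := by
  induction K with
  | zero => simp
  | succ K ih =>
    rw [← ih]
    have h1 := Finset.sum_range_succ (fun j => F (K + j)) n
    have h2 := Finset.sum_range_succ' (fun j => F (K + j)) n
    rw [h1] at h2
    simp only [add_zero, hF] at h2
    rw [add_left_inj] at h2
    rw [h2]
    exact Finset.sum_congr rfl fun j _ => by congr 1; ring

/-- Recentres a sum over the ring at the vertex `K`: periodicity replaces the vertices by offsets
`d`, and the offset `0` drops out because `F K = 0`. -/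
theorem sum_ring {E : Type} [AddCommGroup E] {n : ℕ} {F : ℕ → E}
    (hF : ∀ j, F (j + n) = F j) {K : ℕ} (h0 : F K = 0) :
    ∑ j : Fin n, F (j.val + 1) = ∑ d ∈ Finset.Icc 1 (n - 1), F (K + d) := by
  rw [Fin.sum_univ_eq_sum_range (fun j => F (j + 1))]
  have h1 := sum_range_add_of_periodic hF 1
  have h2 := sum_range_add_of_periodic hF K
  simp only [add_comm 1] at h1
  rw [h1, ← h2]
  symm
  refine Finset.sum_subset_zero_on_sdiff (fun d hd => ?_) (fun d hd => ?_) fun _ _ => rfl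
  · rw [Finset.mem_Icc] at hd
    rw [Finset.mem_range]
    omega
  · rw [Finset.mem_sdiff, Finset.mem_range, Finset.mem_Icc] at hd
    obtain rfl : d = 0 := by omega
    simpa using h0

theorem zet_pow_add_self {n : ℕ} (hn : n ≠ 0) (j : ℕ) : zet n ^ (j + n) = zet n ^ j := by
  rw [pow_add, (zet_prim hn).pow_eq_one, mul_one]

theorem norm_zet (n : ℕ) : ‖zet n‖ = 1 := by
  have : zet n = Complex.exp ((2 * π / n : ℝ) * Complex.I) := by
    rw [zet]; congr 1; push_cast; ring
  rw [this, Complex.norm_exp_ofReal_mul_I]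

theorem dd_eq_norm {n : ℕ} (hn : n ≠ 0) (d : ℕ) : dd n d = ‖1 - zet n ^ d‖ := by
  conv_rhs => rw [← (zet_prim hn).pow_eq_one]
  rw [zet_pow_eq, zet_pow_eq, Complex.norm_def, Complex.normSq_apply, dd]
  simp [sq]

theorem zet_pow_ne_one {n d : ℕ} (hd : d ∈ Finset.Icc 1 (n - 1)) : zet n ^ d ≠ 1 := by
  rw [Finset.mem_Icc] at hd
  exact (zet_prim (by omega)).pow_ne_one_of_pos_of_lt (by omega) (by omega)

theorem dd_pos {n d : ℕ} (hd : d ∈ Finset.Icc 1 (n - 1)) : 0 < dd n d := by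
  have := Finset.mem_Icc.1 hd
  rw [dd_eq_norm (by omega), norm_pos_iff, sub_ne_zero]
  exact (zet_pow_ne_one hd).symm

theorem dd_sq {n : ℕ} (hn : n ≠ 0) (d : ℕ) : dd n d ^ 2 = 2 - 2 * Real.cos (ang n d) := by
  rw [dd_eq_norm hn, zet_pow_eq, Complex.sq_norm, Complex.normSq_apply]
  simp
  nlinarith [Real.sin_sq_add_cos_sq (ang n d)]

theorem dd_eq_sin {n d : ℕ} (hd : d ∈ Finset.Icc 1 (n - 1)) :
    dd n d = 2 * Real.sin (π * d / n) := by
  have h := Finset.mem_Icc.1 hd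
  have hnp : (0 : ℝ) < n := by exact_mod_cast (by omega : 0 < n)
  have hs : 0 ≤ Real.sin (π * d / n) := by
    refine Real.sin_nonneg_of_nonneg_of_le_pi (by positivity) ?_
    rw [div_le_iff₀ hnp]
    have : (d : ℝ) ≤ n := by exact_mod_cast (by omega : d ≤ n)
    gcongr
  have h2 : dd n d ^ 2 = (2 * Real.sin (π * d / n)) ^ 2 := by
    rw [dd_sq (by omega), show ang n d = 2 * (π * d / n) by rw [ang]; ring, Real.cos_two_mul']
    nlinarith [Real.sin_sq_add_cos_sq (π * d / n)]
  exact (sq_eq_sq₀ (dd_pos hd).le (by positivity)).1 h2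

theorem sum_inv_dd (n : ℕ) : ∑ d ∈ Finset.Icc 1 (n - 1), 1 / dd n d = sigmaN n := by
  rw [sigmaN, Finset.mul_sum]
  refine Finset.sum_congr rfl fun d hd => ?_
  rw [dd_eq_sin hd]
  ring

/-- The weighted cosine sums `∑ cos(bθ_d) / (2 d_{nd}³)`. -/
def cosSum (n : ℕ) (b : ℤ) : ℝ :=
  ∑ d ∈ Finset.Icc 1 (n - 1), Real.cos (b * ang n d) / (2 * dd n d ^ 3)

theorem cosSum_neg (n : ℕ) (b : ℤ) : cosSum n (-b) = cosSum n b := by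
  simp [cosSum]

/-- The reflection `d ↦ n - d` preserves chord lengths and conjugates `ζ^(bd)`. So the sum is real
and equals its cosine part. -/
theorem sum_zet_div_dd {n : ℕ} (hn : n ≠ 0) (b : ℤ) :
    ∑ d ∈ Finset.Icc 1 (n - 1), zet n ^ (b * d) / (2 * (dd n d : ℂ) ^ 3) = (cosSum n b : ℂ) := by
  set S := ∑ d ∈ Finset.Icc 1 (n - 1), zet n ^ (b * d) / (2 * (dd n d : ℂ) ^ 3) with hS
  have hc : starRingEnd ℂ S = S := by
    rw [hS, map_sum]
    refine Finset.sum_bij' (fun d _ => n - d) (fun d _ => n - d) ?_ ?_ ?_ ?_ ?_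
    · intro d hd; rw [Finset.mem_Icc] at hd ⊢; omega
    · intro d hd; rw [Finset.mem_Icc] at hd ⊢; omega
    · intro d hd; rw [Finset.mem_Icc] at hd; omega
    · intro d hd; rw [Finset.mem_Icc] at hd; omega
    · intro d hd
      have hd' := Finset.mem_Icc.1 hd
      have e : dd n (n - d) = dd n d := by
        have h2 : dd n (n - d) ^ 2 = dd n d ^ 2 := by
          rw [dd_sq hn, dd_sq hn, show ang n (n - d) = 2 * π - ang n d by
            rw [ang, ang, Nat.cast_sub (by omega)]
            field_simp, Real.cos_two_pi_sub]
        refine (sq_eq_sq₀ (dd_pos ?_).le (dd_pos hd).le).1 h2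
        rw [Finset.mem_Icc]; omega
      have e2 : zet n ^ (b * ((n - d : ℕ) : ℤ)) = zet n ^ (-(b * d)) := by
        rw [Nat.cast_sub (by omega), mul_sub, sub_eq_add_neg, zpow_add₀ (zet_ne_zero n),
          ((zet_prim hn).zpow_eq_one_iff_dvd _).2 (dvd_mul_left _ _), one_mul]
      rw [e, e2, map_div₀, conj_zet_zpow, map_mul, map_pow, Complex.conj_ofReal, map_ofNat]
  rw [← Complex.conj_eq_iff_re.1 hc, hS, Complex.re_sum, cosSum]
  push_cast
  refine Finset.sum_congr rfl fun d _ => ?_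
  rw [show (2 * (dd n d : ℂ) ^ 3) = ((2 * dd n d ^ 3 : ℝ) : ℂ) by push_cast; rfl,
    Complex.div_ofReal_re, zet_zpow, Complex.exp_ofReal_mul_I_re]
  push_cast
  rfl

theorem PP_eq (n l : ℕ) : PP n l = cosSum n 0 - (cosSum n (1 + l) + cosSum n (1 - l)) / 2 := by
  simp only [PP, cosSum, Finset.sum_div, ← Finset.sum_add_distrib, ← Finset.sum_sub_distrib]
  refine Finset.sum_congr rfl fun d _ => ?_
  push_cast
  rw [ang_mul, add_mul, sub_mul, Real.cos_add, Real.cos_sub, one_mul, zero_mul, Real.cos_zero]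
  ring

theorem SS_eq (n l : ℕ) : SS n l = (cosSum n (1 - l) - cosSum n (1 + l)) / 2 := by
  simp only [SS, cosSum, Finset.sum_div, ← Finset.sum_sub_distrib]
  refine Finset.sum_congr rfl fun d _ => ?_
  push_cast
  rw [ang_mul, add_mul, sub_mul, Real.cos_add, Real.cos_sub, one_mul]
  ring

theorem QQ_eq (n l : ℕ) : QQ n l = cosSum n 1 - cosSum n l := by
  simp only [QQ, cosSum, ← Finset.sum_sub_distrib]
  refine Finset.sum_congr rfl fun d _ => ?_
  push_cast
  rw [ang_mul, one_mul]
  ring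

/-- Since `1 - cos θ_d` is half the squared chord, each term of the difference is `1/(4 d_{nd})`. -/
theorem cosSum_zero_sub_one (n : ℕ) : cosSum n 0 - cosSum n 1 = sigmaN n / 4 := by
  rw [← sum_inv_dd]
  simp only [cosSum, Finset.sum_div, ← Finset.sum_sub_distrib]
  refine Finset.sum_congr rfl fun d hd => ?_
  have h := Finset.mem_Icc.1 hd
  have h1 := dd_pos hd
  have h2 := dd_sq (n := n) (by omega) d
  have h3 : Real.cos (ang n d) = 1 - dd n d ^ 2 / 2 := by linarith
  push_cast
  rw [one_mul, zero_mul, Real.cos_zero, h3]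
  field_simp
  ring

/-! ## The gradient and the Hessian at the `(1+n)`-gon, in complex notation -/

theorem mode_one_injective {n : ℕ} (hn : n ≠ 0) : Function.Injective (mode n 1) := by
  intro i j h
  by_cases hi : i = 0 <;> by_cases hj : j = 0
  · rw [hi, hj]
  · simp only [mode, hi, hj, if_true, if_false, one_mul, zpow_natCast] at h
    exact absurd h.symm (pow_ne_zero _ (zet_ne_zero n))
  · simp only [mode, hi, hj, if_true, if_false, one_mul, zpow_natCast] at h
    exact absurd h (pow_ne_zero _ (zet_ne_zero n))
  · simp only [mode, hi, hj, if_false, one_mul, zpow_natCast] at h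
    have hi' : i.val ≠ 0 := fun h => hi (Fin.ext h)
    have hj' : j.val ≠ 0 := fun h => hj (Fin.ext h)
    -- The vertices carry the exponents `1, …, n`, whereas primitivity separates `0, …, n - 1`; one
    -- factor `ζ` is removed.
    have key : ∀ k : ℕ, k ≠ 0 → zet n ^ k = zet n * zet n ^ (k - 1) := fun k hk => by
      rw [← pow_succ', Nat.sub_add_cancel (by omega)]
    rw [key _ hi', key _ hj', mul_right_inj' (zet_ne_zero n)] at h
    have := (zet_prim hn).pow_inj (by omega) (by omega) h
    exact Fin.ext (by omega)

/-- The Hessian of `1/|x|` is homogeneous of degree `-3` and commutes with rotations. The case `x =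
0`, needed for the diagonal terms of sums, holds because division by zero gives zero on both sides.
-/
theorem invNormHessC_mul (r : ℝ) (hr : 0 < r) (u : ℂ) (hu : ‖u‖ = 1) (x η : ℂ) :
    invNormHessC (r * u * x) (u * η) = ((r ^ 3)⁻¹ : ℝ) * (u * invNormHessC x η) := by
  have hr' : (r : ℂ) ≠ 0 := by exact_mod_cast hr.ne'
  have hu2 : u * starRingEnd ℂ u = 1 := by
    rw [Complex.mul_conj, Complex.normSq_eq_norm_sq, hu]; simp
  simp only [invNormHessC, norm_mul, hu, Complex.norm_real, Real.norm_of_nonneg hr.le, map_mul,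
    mul_one]
  by_cases hx : x = 0
  · subst hx; simp
  have hx' : (‖x‖ : ℂ) ≠ 0 := by simpa using hx
  push_cast
  field_simp
  linear_combination (3 * x ^ 2 * starRingEnd ℂ η) * u * hu2

theorem invNormHessC_add (x η η' : ℂ) :
    invNormHessC x (η + η') = invNormHessC x η + invNormHessC x η' := by
  simp only [invNormHessC, map_add]
  ring

/-- The Hessian of the potential at the `(1+n)`-gon in complex notation. -/
def hessC (n : ℕ) (m : ℝ) (η : Fin (n + 1) → ℂ) (k : Fin (n + 1)) : ℂ :=
  ∑ j, (mass n m k * mass n m j : ℂ) * invNormHessC (mode n 1 k - mode n 1 j) (η k - η j)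

theorem cx_hess_cfg {n : ℕ} (hn : n ≠ 0) (m : ℝ) (ξ : Body n → ℝ) :
    cx (hess (pot n m) (cfg n) *ᵥ ξ) = hessC n m (cx ξ) := by
  funext k
  rw [cx_hess_pot n m (by rw [cx_cfg]; exact mode_one_injective hn), cx_cfg, hessC]

theorem hessC_add (n : ℕ) (m : ℝ) (η η' : Fin (n + 1) → ℂ) :
    hessC n m (η + η') = hessC n m η + hessC n m η' := by
  funext k
  simp only [hessC, Pi.add_apply, ← Finset.sum_add_distrib]
  refine Finset.sum_congr rfl fun j _ => ?_
  rw [add_sub_add_comm, invNormHessC_add, mul_add]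

/-- Multiplication by the masses. -/
def massC (n : ℕ) (m : ℝ) (η : Fin (n + 1) → ℂ) (k : Fin (n + 1)) : ℂ := mass n m k * η k

theorem cx_MM (n : ℕ) (m : ℝ) (ξ : Body n → ℝ) : cx (MM n m *ᵥ ξ) = massC n m (cx ξ) := by
  funext k
  apply Complex.ext <;> simp [cx, MM, massC, mulVec_diagonal, cmass]

theorem invNormHessC_zet_pow (n K : ℕ) (η : ℂ) :
    invNormHessC (zet n ^ K) η = (η + 3 * zet n ^ (2 * K) * starRingEnd ℂ η) / 2 := by
  simp only [invNormHessC, norm_pow, norm_zet, one_pow]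
  push_cast
  ring

/-- From `|1 - z|² = (1 - z)(1 - z⁻¹)` with `z = ζ^d`, the squared direction of the chord is
`-ζ^(2K+d)`. It is again a power of `ζ`, which is what makes the Hessian send modes to modes. -/
theorem invNormHessC_one_sub {n d : ℕ} (hd : d ∈ Finset.Icc 1 (n - 1)) (K : ℕ) (η : ℂ) :
    invNormHessC (zet n ^ K - zet n ^ (K + d)) η =
      (η - 3 * zet n ^ (2 * K + d) * starRingEnd ℂ η) / (2 * (dd n d : ℂ) ^ 3) := by
  have h := Finset.mem_Icc.1 hd
  have hn : n ≠ 0 := by omega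
  have hd0 := dd_pos hd
  have hd0' : (dd n d : ℂ) ≠ 0 := by exact_mod_cast hd0.ne'
  have e : zet n ^ K - zet n ^ (K + d) = zet n ^ K * (1 - zet n ^ d) := by rw [pow_add]; ring
  have hnorm : ‖zet n ^ K - zet n ^ (K + d)‖ = dd n d := by
    rw [e, norm_mul, norm_pow, norm_zet, one_pow, one_mul, dd_eq_norm hn]
  have hsq : (dd n d : ℂ) ^ 2 * zet n ^ d = -(1 - zet n ^ d) ^ 2 := by
    have : (dd n d : ℂ) ^ 2 = (1 - zet n ^ d) * (1 - (zet n ^ d)⁻¹) := by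
      rw [dd_eq_norm hn, ← Complex.ofReal_pow, ← Complex.normSq_eq_norm_sq, ← Complex.mul_conj,
        map_sub, map_one, map_pow, conj_zet, inv_pow]
    rw [this]
    have := pow_ne_zero d (zet_ne_zero n)
    field_simp
    ring
  rw [invNormHessC, hnorm, e]
  have : (zet n ^ K * (1 - zet n ^ d)) ^ 2 / (dd n d : ℂ) ^ 2 = -zet n ^ (2 * K + d) := by
    rw [div_eq_iff (pow_ne_zero 2 hd0')]
    rw [pow_add, two_mul K, pow_add]
    linear_combination (zet n ^ K * zet n ^ K) * hsq
  rw [this]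
  field_simp
  ring

theorem mode_succ_nat (n : ℕ) (k : Fin n) : mode n 1 k.succ = zet n ^ (k.val + 1) := by
  rw [mode_succ, one_mul, zpow_natCast]

theorem zet_zpow_periodic {n : ℕ} (hn : n ≠ 0) (a : ℤ) (j : ℕ) :
    zet n ^ (a * (j + n : ℕ)) = zet n ^ (a * j) := by
  push_cast
  rw [mul_add, zpow_add₀ (zet_ne_zero n),
    ((zet_prim hn).zpow_eq_one_iff_dvd _).2 (dvd_mul_left _ _), mul_one]

/-- The factor of `mode a` in the Hessian of `c • mode a`. -/
def alphaC (n : ℕ) (m : ℝ) (a : ℤ) : ℝ := cosSum n 0 - cosSum n a + m / 2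

/-- The factor of `mode (2 - a)` in the Hessian of `c • mode a`. -/
def betaC (n : ℕ) (m : ℝ) (a : ℤ) : ℝ := -3 * (cosSum n 1 - cosSum n (1 - a)) + 3 * m / 2

/-- Seen from the vertex `K`, the part linear in `c` carries the factor `ζ^(aK)`. In the conjugate
part `ζ^(2K)` meets `ζ^(-aK)` and gives `ζ^((2-a)K)`. What remains depends on the offset `d` only
and sums to the constants `cosSum`; the central body adds `m/2` and `3m/2`. The entry at the centre
is a full sum over the ring, so it survives only when `n` divides `a` or `2 - a`. -/
theorem hessC_mode {n : ℕ} (hn : n ≠ 0) (m : ℝ) (a : ℤ) (c : ℂ) :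
    hessC n m (c • mode n a) = (alphaC n m a * c) • mode n a +
      (betaC n m a * starRingEnd ℂ c) • mode n (2 - a) -
      (m / 2 * (c * (if (n : ℤ) ∣ a then (n : ℂ) else 0) +
        3 * starRingEnd ℂ c * (if (n : ℤ) ∣ 2 - a then (n : ℂ) else 0))) • ctr n := by
  funext k
  rw [hessC, sum_body]
  refine Fin.cases ?_ (fun k => ?_) k
  · simp only [Pi.smul_apply, Pi.add_apply, Pi.sub_apply, mode_zero_apply, ctr_zero_apply,
      mass_zero, mass_succ, sub_self, smul_eq_mul, mul_zero, zero_sub, invNormHessC_zero, zero_add,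
      mul_one, ← sum_zet_zpow hn, mode_succ, one_mul, zpow_natCast]
    simp only [Finset.mul_sum, ← Finset.sum_add_distrib, ← Finset.sum_neg_distrib]
    refine Finset.sum_congr rfl fun j _ => ?_
    have e : invNormHessC (-zet n ^ (j.val + 1)) (-(c * zet n ^ (a * (j.val + 1 : ℕ)))) =
        -invNormHessC (zet n ^ (j.val + 1)) (c * zet n ^ (a * (j.val + 1 : ℕ))) := by
      simp only [invNormHessC, norm_neg, map_neg]
      ring
    rw [e, invNormHessC_zet_pow, map_mul, conj_zet_zpow, sub_mul, sub_eq_add_neg,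
      zpow_add₀ (zet_ne_zero n), ← zpow_natCast (zet n) (2 * (j.val + 1))]
    push_cast
    ring
  · simp only [Pi.smul_apply, Pi.add_apply, Pi.sub_apply, mode_zero_apply, ctr_succ,
      mass_zero, mass_succ, smul_eq_mul, mul_zero, sub_zero, mode_succ, one_mul, zpow_natCast]
    set K := k.val + 1 with hK
    have hsum := sum_ring (n := n) (K := K) (F := fun j => invNormHessC (zet n ^ K - zet n ^ j)
      (c * zet n ^ (a * K) - c * zet n ^ (a * j))) (fun j => by
        simp only [zet_pow_add_self hn, zet_zpow_periodic hn]) (by simp)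
    have hterm : ∀ d ∈ Finset.Icc 1 (n - 1), invNormHessC (zet n ^ K - zet n ^ (K + d))
        (c * zet n ^ (a * K) - c * zet n ^ (a * (K + d : ℕ))) =
        c * zet n ^ (a * K) * (zet n ^ (0 * d : ℤ) / (2 * (dd n d : ℂ) ^ 3) -
          zet n ^ (a * d) / (2 * (dd n d : ℂ) ^ 3)) -
        3 * starRingEnd ℂ c * zet n ^ ((2 - a) * K) * (zet n ^ (1 * d : ℤ) / (2 * (dd n d : ℂ) ^ 3) -
          zet n ^ ((1 - a) * d) / (2 * (dd n d : ℂ) ^ 3)) := by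
      intro d hd
      rw [invNormHessC_one_sub hd, map_sub, map_mul, map_mul, conj_zet_zpow, conj_zet_zpow]
      have e1 : zet n ^ (a * (K + d : ℕ)) = zet n ^ (a * K) * zet n ^ (a * d) := by
        rw [← zpow_add₀ (zet_ne_zero n)]; congr 1; push_cast; ring
      have e2 : zet n ^ (2 * K + d) * zet n ^ (-(a * (K : ℤ))) =
          zet n ^ ((2 - a) * K) * zet n ^ (1 * d : ℤ) := by
        rw [← zpow_natCast, ← zpow_add₀ (zet_ne_zero n), ← zpow_add₀ (zet_ne_zero n)]
        congr 1; push_cast; ring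
      have e3 : zet n ^ (2 * K + d) * zet n ^ (-(a * ((K + d : ℕ) : ℤ))) =
          zet n ^ ((2 - a) * K) * zet n ^ ((1 - a) * d : ℤ) := by
        rw [← zpow_natCast, ← zpow_add₀ (zet_ne_zero n), ← zpow_add₀ (zet_ne_zero n)]
        congr 1; push_cast; ring
      rw [zero_mul, zpow_zero, e1]
      rw [show 3 * zet n ^ (2 * K + d) * (starRingEnd ℂ c * zet n ^ (-(a * (K : ℤ))) -
          starRingEnd ℂ c * zet n ^ (-(a * ((K + d : ℕ) : ℤ)))) =
          3 * starRingEnd ℂ c * (zet n ^ (2 * K + d) * zet n ^ (-(a * (K : ℤ))) -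
          zet n ^ (2 * K + d) * zet n ^ (-(a * ((K + d : ℕ) : ℤ)))) by ring, e2, e3]
      ring
    have hsum2 : ∑ j : Fin n, invNormHessC (zet n ^ K - zet n ^ (j.val + 1))
        (c * zet n ^ (a * K) - c * zet n ^ (a * (j.val + 1 : ℕ))) =
        c * zet n ^ (a * K) * (cosSum n 0 - cosSum n a) -
        3 * starRingEnd ℂ c * zet n ^ ((2 - a) * K) * (cosSum n 1 - cosSum n (1 - a)) := by
      refine hsum.trans ?_
      rw [Finset.sum_congr rfl hterm]
      simp only [Finset.sum_sub_distrib, ← Finset.mul_sum, sum_zet_div_dd hn]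
    simp only [Complex.ofReal_one, one_mul]
    rw [hsum2, invNormHessC_zet_pow, map_mul, conj_zet_zpow]
    have e2 : zet n ^ (2 * K) * zet n ^ (-(a * (K : ℤ))) = zet n ^ ((2 - a) * K) := by
      rw [← zpow_natCast, ← zpow_add₀ (zet_ne_zero n)]
      congr 1; push_cast; ring
    rw [show 3 * zet n ^ (2 * K) * (starRingEnd ℂ c * zet n ^ (-(a * (K : ℤ)))) =
      3 * starRingEnd ℂ c * (zet n ^ (2 * K) * zet n ^ (-(a * (K : ℤ)))) by ring, e2, alphaC, betaC]
    push_cast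
    ring

/-- The conjugate part of the entry at the centre is a multiple of `∑ ζ^(2k)`, which vanishes
because `n ≥ 3` does not divide `2`. -/
theorem hessC_ctr {n : ℕ} (hn : 3 ≤ n) (m : ℝ) (c : ℂ) :
    hessC n m (c • ctr n) = (-(m / 2) * c) • mode n 0 + (-(3 * m / 2) * starRingEnd ℂ c) • mode n 2 +
      (m * n / 2 * c) • ctr n := by
  have hn0 : n ≠ 0 := by omega
  funext k
  rw [hessC, sum_body]
  refine Fin.cases ?_ (fun k => ?_) k
  · simp only [Pi.smul_apply, Pi.add_apply, mode_zero_apply, ctr_zero_apply, ctr_succ,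
      mass_zero, mass_succ, sub_self, smul_eq_mul, mul_zero, zero_sub, invNormHessC_zero, zero_add,
      mul_one, mode_succ_nat, sub_zero, add_zero]
    have e : ∀ j : Fin n, (m * (1 : ℝ) : ℂ) * invNormHessC (-zet n ^ (j.val + 1)) c =
        m / 2 * c + 3 * m / 2 * starRingEnd ℂ c * zet n ^ ((2 : ℤ) * (j.val + 1 : ℕ)) := by
      intro j
      have : invNormHessC (-zet n ^ (j.val + 1)) c = invNormHessC (zet n ^ (j.val + 1)) c := by
        simp only [invNormHessC, norm_neg, neg_sq]
      rw [this, invNormHessC_zet_pow, ← zpow_natCast (zet n) (2 * (j.val + 1))]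
      push_cast
      ring
    rw [Finset.sum_congr rfl fun j _ => e j, Finset.sum_add_distrib, ← Finset.mul_sum,
      ← Finset.mul_sum, sum_zet_zpow hn0, if_neg]
    · simp
      ring
    · intro h
      have := Int.le_of_dvd (by norm_num) h
      omega
  · simp only [Pi.smul_apply, Pi.add_apply, mode_zero_apply, ctr_succ, ctr_zero_apply,
      mass_zero, mass_succ, smul_eq_mul, mul_zero, sub_zero, mul_one, mode_succ, one_mul, zpow_natCast,
      sub_self, invNormHessC_zero, Finset.sum_const_zero, zero_sub, add_zero, zero_mul, zpow_zero]
    rw [invNormHessC_zet_pow, ← zpow_natCast (zet n) (2 * (k.val + 1)), map_neg]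
    push_cast
    ring

theorem massC_mode (n : ℕ) (m : ℝ) (a : ℤ) : massC n m (mode n a) = mode n a := by
  funext k
  refine Fin.cases ?_ (fun k => ?_) k
  · simp [massC, mode_zero_apply]
  · simp [massC, mass_succ]

theorem massC_ctr (n : ℕ) (m : ℝ) : massC n m (ctr n) = (m : ℂ) • ctr n := by
  funext k
  refine Fin.cases ?_ (fun k => ?_) k
  · simp [massC, mass_zero]
  · simp [massC, ctr_succ]

theorem massC_add (n : ℕ) (m : ℝ) (η η' : Fin (n + 1) → ℂ) :
    massC n m (η + η') = massC n m η + massC n m η' := by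
  funext k; simp [massC, mul_add]

theorem massC_sub (n : ℕ) (m : ℝ) (η η' : Fin (n + 1) → ℂ) :
    massC n m (η - η') = massC n m η - massC n m η' := by
  funext k; simp [massC, mul_sub]

theorem massC_smul (n : ℕ) (m : ℝ) (c : ℂ) (η : Fin (n + 1) → ℂ) :
    massC n m (c • η) = c • massC n m η := by
  funext k; simp [massC]; ring

/-! ## Central configuration and homothety -/

/-- The equation of a central configuration. At the centre the forces cancel since `∑ ζ^k = 0`. At a
vertex the chords contribute twice `cosSum n 0 - cosSum n 1`, that is `σ_n/2`, and the central body
contributes `m`. -/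
theorem cx_grad_cfg {n : ℕ} (hn : 3 ≤ n) (m : ℝ) :
    cx (grad (pot n m) (cfg n)) = (-(sigmaN n / 2 + m : ℝ) : ℂ) • mode n 1 := by
  have hn0 : n ≠ 0 := by omega
  funext k
  rw [cx_grad_pot n m (by rw [cx_cfg]; exact mode_one_injective hn0), cx_cfg, sum_body]
  refine Fin.cases ?_ (fun k => ?_) k
  · simp only [mode_zero_apply, mode_succ_nat, mass_zero, mass_succ, sub_self, zero_sub,
      norm_neg, norm_pow, norm_zet, Pi.smul_apply]
    have e := sum_zet_zpow hn0 1
    rw [if_neg (by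
      intro h
      have := Int.le_of_dvd (by norm_num) h
      omega)] at e
    simp only [one_mul, zpow_natCast] at e
    simp only [one_pow, Complex.ofReal_one, div_one, mul_neg, Finset.sum_neg_distrib,
      ← Finset.mul_sum, e]
    simp
  · simp only [mode_zero_apply, mode_succ_nat, mass_zero, mass_succ, sub_zero,
      norm_pow, norm_zet, Pi.smul_apply]
    set K := k.val + 1 with hK
    have hsum := sum_ring (n := n) (K := K) (F := fun j => (zet n ^ K - zet n ^ j) /
      (‖zet n ^ K - zet n ^ j‖ : ℂ) ^ 3) (fun j => by
        simp only [zet_pow_add_self hn0]) (by simp)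
    have hterm : ∀ d ∈ Finset.Icc 1 (n - 1), (zet n ^ K - zet n ^ (K + d)) /
        (‖zet n ^ K - zet n ^ (K + d)‖ : ℂ) ^ 3 =
        2 * zet n ^ K * (zet n ^ (0 * d : ℤ) / (2 * (dd n d : ℂ) ^ 3) -
          zet n ^ (1 * d : ℤ) / (2 * (dd n d : ℂ) ^ 3)) := by
      intro d hd
      have e : zet n ^ K - zet n ^ (K + d) = zet n ^ K * (1 - zet n ^ d) := by rw [pow_add]; ring
      rw [e, norm_mul, norm_pow, norm_zet, one_pow, one_mul, ← dd_eq_norm hn0, zero_mul, zpow_zero,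
        one_mul, zpow_natCast]
      have hd0' : (dd n d : ℂ) ≠ 0 := by exact_mod_cast (dd_pos hd).ne'
      field_simp
    rw [Finset.sum_congr rfl hterm, ← Finset.mul_sum, Finset.sum_sub_distrib, sum_zet_div_dd hn0,
      sum_zet_div_dd hn0, ← Complex.ofReal_sub, cosSum_zero_sub_one] at hsum
    simp only [Complex.ofReal_one, one_mul, hsum]
    push_cast
    simp
    ring

theorem cx_smul_rot_cfg (n : ℕ) (r φ : ℝ) :
    cx (r • (rot (JJ (Fin (n + 1))) φ *ᵥ cfg n)) =
      ((r : ℂ) * Complex.exp (φ * Complex.I)) • mode n 1 := by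
  rw [cx_smul, cx_rot, cx_cfg, smul_smul]

theorem cx_smul_rot_cfg_injective {n : ℕ} (hn : n ≠ 0) {r : ℝ} (hr : 0 < r) (φ : ℝ) :
    Function.Injective (cx (r • (rot (JJ (Fin (n + 1))) φ *ᵥ cfg n))) := by
  rw [cx_smul_rot_cfg]
  intro i j h
  have hr' : (r : ℂ) ≠ 0 := by exact_mod_cast hr.ne'
  exact mode_one_injective hn
    (mul_left_cancel₀ (mul_ne_zero hr' (Complex.exp_ne_zero _)) h)

/-- Along the homographic motion the Hessian is conjugate by the rotation to the constant one at the
polygon, up to the factor `r⁻³`. This makes the linearized system reducible to fixed blocks. -/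
theorem hess_pot_smul_rot {n : ℕ} (hn : n ≠ 0) (m : ℝ) {r : ℝ} (hr : 0 < r) (φ : ℝ) :
    hess (pot n m) (r • (rot (JJ (Fin (n + 1))) φ *ᵥ cfg n)) * rot (JJ (Fin (n + 1))) φ =
      (r ^ 3)⁻¹ • (rot (JJ (Fin (n + 1))) φ * hess (pot n m) (cfg n)) := by
  rw [← Matrix.toLin'.injective.eq_iff]
  refine LinearMap.ext fun ξ => cx_injective ?_
  simp only [toLin'_apply, ← mulVec_mulVec, smul_mulVec]
  funext k
  rw [cx_hess_pot n m (cx_smul_rot_cfg_injective hn hr φ), cx_smul_rot_cfg, cx_rot, cx_smul,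
    cx_rot, cx_hess_cfg hn]
  simp only [Pi.smul_apply, smul_eq_mul, hessC, Finset.mul_sum, ← mul_sub]
  refine Finset.sum_congr rfl fun j _ => ?_
  rw [invNormHessC_mul r hr _ (Complex.norm_exp_ofReal_mul_I φ)]
  ring

theorem grad_pot_smul_rot {n : ℕ} (hn : 3 ≤ n) (m : ℝ) {r : ℝ} (hr : 0 < r) (φ : ℝ) :
    grad (pot n m) (r • (rot (JJ (Fin (n + 1))) φ *ᵥ cfg n)) =
      (-((sigmaN n / 2 + m) / r ^ 2)) • (rot (JJ (Fin (n + 1))) φ *ᵥ cfg n) := by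
  have hn0 : n ≠ 0 := by omega
  refine cx_injective ?_
  funext k
  have h1 := congrFun (cx_grad_cfg hn m) k
  rw [cx_grad_pot n m (by rw [cx_cfg]; exact mode_one_injective hn0), cx_cfg] at h1
  rw [cx_grad_pot n m (cx_smul_rot_cfg_injective hn0 hr φ), cx_smul_rot_cfg, cx_smul, cx_rot,
    cx_cfg]
  have hr' : (r : ℂ) ≠ 0 := by exact_mod_cast hr.ne'
  have e : ∀ j, ((r * Complex.exp (φ * Complex.I)) * (mode n 1 k - mode n 1 j)) /
      (‖(r * Complex.exp (φ * Complex.I)) * (mode n 1 k - mode n 1 j)‖ : ℂ) ^ 3 =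
      Complex.exp (φ * Complex.I) / r ^ 2 *
        ((mode n 1 k - mode n 1 j) / (‖mode n 1 k - mode n 1 j‖ : ℂ) ^ 3) := by
    intro j
    rw [norm_mul, norm_mul, Complex.norm_exp_ofReal_mul_I, Complex.norm_real,
      Real.norm_of_nonneg hr.le]
    push_cast
    field_simp
  simp only [Pi.smul_apply, smul_eq_mul, ← mul_sub, e]
  have e2 : ∀ j, (mass n m k * mass n m j : ℂ) * (Complex.exp (φ * Complex.I) / r ^ 2 *
        ((mode n 1 k - mode n 1 j) / (‖mode n 1 k - mode n 1 j‖ : ℂ) ^ 3)) =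
      Complex.exp (φ * Complex.I) / r ^ 2 * ((mass n m k * mass n m j : ℂ) *
        ((mode n 1 k - mode n 1 j) / (‖mode n 1 k - mode n 1 j‖ : ℂ) ^ 3)) := fun j => by ring
  rw [Finset.sum_congr rfl fun j _ => e2 j, ← Finset.mul_sum, ← mul_neg, h1]
  simp only [Pi.smul_apply, smul_eq_mul]
  push_cast
  ring

theorem inertia_cfg (n : ℕ) (m : ℝ) : inertia n m (cfg n) = n := by
  have : inertia n m (cfg n) = (herm n m (cx (cfg n)) (cx (cfg n))).re := by
    rw [← dotProduct_mass, inertia, MM]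
    simp only [dotProduct, mulVec_diagonal]
    exact Finset.sum_congr rfl fun i _ => by ring
  rw [this, cx_cfg]
  rcases eq_or_ne n 0 with rfl | hn
  · simp [herm, mode]
  · rw [herm_mode_self hn, Complex.natCast_re]

theorem pot_cfg {n : ℕ} (hn : n ≠ 0) (m : ℝ) : pot n m (cfg n) = n * (sigmaN n / 2 + m) := by
  -- The diagonal terms may be added because `1/0 = 0`.
  have hd : ∀ i : Fin (n + 1), ∑ j ∈ ({i}ᶜ : Finset (Fin (n + 1))),
      mass n m i * mass n m j / 2 * (1 / bodyDist n (cfg n) i j) =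
      ∑ j, mass n m i * mass n m j / 2 * (1 / ‖mode n 1 i - mode n 1 j‖) := fun i => by
    simp only [bodyDist_eq_norm, cx_cfg]
    refine Finset.sum_subset (Finset.subset_univ _) fun j _ hj => ?_
    obtain rfl : j = i := by simpa using hj
    simp
  have hk : ∀ k : Fin n, ∑ j : Fin n, (1 : ℝ) * 1 / 2 *
      (1 / ‖zet n ^ (k.val + 1) - zet n ^ (j.val + 1)‖) = sigmaN n / 2 := by
    intro k
    set K := k.val + 1
    rw [sum_ring (n := n) (K := K) (F := fun j => (1 : ℝ) * 1 / 2 * (1 / ‖zet n ^ K - zet n ^ j‖))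
      (fun j => by simp only [zet_pow_add_self hn]) (by simp), ← sum_inv_dd, Finset.sum_div]
    refine Finset.sum_congr rfl fun d _ => ?_
    have e : zet n ^ K - zet n ^ (K + d) = zet n ^ K * (1 - zet n ^ d) := by rw [pow_add]; ring
    rw [e, norm_mul, norm_pow, norm_zet, one_pow, one_mul, ← dd_eq_norm hn]
    ring
  have h0 : ∑ j, mass n m 0 * mass n m j / 2 * (1 / ‖mode n 1 0 - mode n 1 j‖) = n * m / 2 := by
    rw [Fin.sum_univ_succ]
    simp only [mode_zero_apply, mode_succ_nat, mass_zero, mass_succ, zero_sub, norm_neg, norm_pow,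
      norm_zet, norm_zero]
    simp
    ring
  have h1 : ∀ k : Fin n, ∑ j, mass n m k.succ * mass n m j / 2 *
      (1 / ‖mode n 1 k.succ - mode n 1 j‖) = m / 2 + sigmaN n / 2 := fun k => by
    rw [Fin.sum_univ_succ, ← hk k]
    simp only [mode_zero_apply, mode_succ_nat, mass_zero, mass_succ, sub_zero, norm_pow, norm_zet]
    simp
  rw [pot_eq]
  simp only [← bodyDist_eq, hd]
  rw [Fin.sum_univ_succ, h0, Finset.sum_congr rfl fun k _ => h1 k]
  simp
  ring

theorem lam_eq {n : ℕ} (hn : n ≠ 0) (m : ℝ) : lam n m = sigmaN n / 2 + m := by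
  have : (n : ℝ) ≠ 0 := by exact_mod_cast hn
  rw [lam, pot_cfg hn, inertia_cfg]
  field_simp

theorem sigmaN_nonneg (n : ℕ) : 0 ≤ sigmaN n := by
  rw [← sum_inv_dd]
  exact Finset.sum_nonneg fun d hd => by have := dd_pos hd; positivity

theorem lam_pos {n : ℕ} (hn : n ≠ 0) {m : ℝ} (hm : 0 < m) : 0 < lam n m := by
  rw [lam_eq hn]
  have := sigmaN_nonneg n
  positivity

/-! ## The blocks of the Hessian -/

/-- The Hessian is only real linear, so a block is checked column by column: the columns of a pair
are `1 • u` and `i • u`, and the entries of `U` are the real coefficients of their images. -/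
theorem hess_mul_pairCols {n k : ℕ} (hn : n ≠ 0) {m : ℝ} (hm : 0 < m) (u : Fin k → Body n → ℝ)
    (U : Matrix (Fin k × Fin 2) (Fin k × Fin 2) ℝ)
    (h : ∀ p', hessC n m (![1, Complex.I] p'.2 • cx (u p'.1)) =
      massC n m (∑ p, (U p p' : ℂ) • ![1, Complex.I] p.2 • cx (u p.1))) :
    (MM n m)⁻¹ * hess (pot n m) (cfg n) * pairCols u = pairCols u * U := by
  have hcol : hess (pot n m) (cfg n) * pairCols u = MM n m * (pairCols u * U) := by
    ext q p'
    have h1 : cx (hess (pot n m) (cfg n) *ᵥ fun q => pairCols u q p') =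
        cx (MM n m *ᵥ fun q => (pairCols u * U) q p') := by
      have h2 : (fun q => (pairCols u * U) q p') = ∑ p, U p p' • fun q => pairCols u q p := by
        funext q
        simp [Matrix.mul_apply, Finset.sum_apply, mul_comm]
      rw [cx_hess_cfg hn, cx_pairCols, h, cx_MM, h2, cx_sum]
      simp only [cx_smul, cx_pairCols]
    exact congrFun (cx_injective h1) q
  rw [Matrix.mul_assoc, hcol, ← Matrix.mul_assoc, Matrix.nonsing_inv_mul _ (isUnit_MM hm n),
    Matrix.one_mul]

theorem not_dvd_of_lt {n : ℕ} {a : ℤ} (h0 : a ≠ 0) (h1 : a < n) (h2 : -a < n) : ¬(n : ℤ) ∣ a := by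
  intro hd
  exact h0 (Int.eq_zero_of_abs_lt_dvd hd (abs_lt.2 ⟨by omega, h1⟩))

theorem alphaC_add (n : ℕ) (m : ℝ) (l : ℕ) : alphaC n m (1 + l) = PP n l + SS n l + m / 2 := by
  rw [alphaC, PP_eq, SS_eq]; ring

theorem alphaC_sub (n : ℕ) (m : ℝ) (l : ℕ) : alphaC n m (1 - l) = PP n l - SS n l + m / 2 := by
  rw [alphaC, PP_eq, SS_eq]; ring

theorem betaC_add (n : ℕ) (m : ℝ) (l : ℕ) : betaC n m (1 + l) = -3 * QQ n l + 3 * m / 2 := by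
  rw [betaC, QQ_eq, ← cosSum_neg n l]; congr 3; congr 1; ring

theorem betaC_sub (n : ℕ) (m : ℝ) (l : ℕ) : betaC n m (1 - l) = -3 * QQ n l + 3 * m / 2 := by
  rw [betaC, QQ_eq]; congr 3; congr 1; ring

theorem hessC_mode_of_not_dvd {n : ℕ} (hn : n ≠ 0) (m : ℝ) {a : ℤ} (h1 : ¬(n : ℤ) ∣ a)
    (h2 : ¬(n : ℤ) ∣ 2 - a) (c : ℂ) :
    hessC n m (c • mode n a) = (alphaC n m a * c) • mode n a +
      (betaC n m a * starRingEnd ℂ c) • mode n (2 - a) := by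
  rw [hessC_mode hn, if_neg h1, if_neg h2]
  simp

/-- The exponent `1` is fixed by `a ↦ 2 - a`, so one complex line is invariant. Real `c` (dilation)
sees the sum of the two coefficients, `σ_n + 2m`; imaginary `c` (rotation) sees their difference,
`-σ_n/2 - m`. -/
theorem hessC_kep {n : ℕ} (hn : 3 ≤ n) (m : ℝ) (c : ℂ) :
    hessC n m (c • mode n 1) = massC n m ((((sigmaN n / 4 + m / 2 : ℝ) : ℂ) * c +
      ((3 * sigmaN n / 4 + 3 * m / 2 : ℝ) : ℂ) * starRingEnd ℂ c) • mode n 1) := by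
  have e : (2 : ℤ) - 1 = 1 := by norm_num
  have h1 : ¬(n : ℤ) ∣ 1 := not_dvd_of_lt (by omega) (by omega) (by omega)
  rw [hessC_mode_of_not_dvd (by omega) m h1 (by rwa [e]), e, massC_smul, massC_mode, ← add_smul,
    alphaC, betaC, sub_self]
  have := cosSum_zero_sub_one n
  rw [this, show cosSum n 1 - cosSum n 0 = -(sigmaN n / 4) by linarith]
  congr 3
  push_cast
  ring

/-- The involution exchanges the exponents `0` and `2`, and the motion of the central body acts on
both. The weight `-n/m` at the centre is the one that makes the `ctr` and `mode n 0` parts recombine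
into a multiple of the same vector. -/
theorem hessC_vHat {n : ℕ} (hn : 3 ≤ n) {m : ℝ} (hm : 0 < m) (c : ℂ) :
    hessC n m (c • ((-n / m : ℂ) • ctr n + mode n 0)) =
      massC n m ((((n + m) / 2 : ℝ) * c) • ((-n / m : ℂ) • ctr n + mode n 0) +
        ((3 / 2 * (n + m) : ℝ) * starRingEnd ℂ c) • mode n 2) := by
  have hm' : (m : ℂ) ≠ 0 := by exact_mod_cast hm.ne'
  have hconj : starRingEnd ℂ (c * (-n / m)) = starRingEnd ℂ c * (-n / m) := by
    simp [map_div₀]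
  rw [smul_add, smul_smul, hessC_add, hessC_ctr hn, hessC_mode (by omega), if_pos (dvd_zero _),
    if_neg (not_dvd_of_lt (by omega) (by omega) (by omega)), alphaC, betaC, hconj]
  simp only [massC_add, massC_smul, massC_mode, massC_ctr, sub_self, sub_zero]
  funext k
  simp only [Pi.add_apply, Pi.sub_apply, Pi.smul_apply, smul_eq_mul]
  push_cast
  field_simp
  ring

theorem hessC_wHat {n : ℕ} (hn : 3 ≤ n) {m : ℝ} (hm : 0 < m) (c : ℂ) :
    hessC n m (c • mode n 2) =
      massC n m ((((m / 2 + 2 * PP n 1 : ℝ) : ℂ) * c) • mode n 2 +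
        ((3 / 2 * m : ℝ) * starRingEnd ℂ c) • ((-n / m : ℂ) • ctr n + mode n 0)) := by
  have hm' : (m : ℂ) ≠ 0 := by exact_mod_cast hm.ne'
  have hP := PP_eq n 1
  have e : (1 : ℤ) - 2 = -1 := by norm_num
  rw [hessC_mode (by omega), if_neg (not_dvd_of_lt (by omega) (by omega) (by omega)), sub_self,
    if_pos (dvd_zero _), alphaC, betaC, e, cosSum_neg, hP]
  simp only [massC_add, massC_smul, massC_mode, massC_ctr, sub_self, Nat.cast_one]
  funext k
  simp only [Pi.add_apply, Pi.sub_apply, Pi.smul_apply, smul_eq_mul]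
  rw [show (1 : ℤ) + 1 = 2 by norm_num]
  push_cast
  field_simp
  ring

/-- The modes `1 ± l` have direct coefficients `P_l ± S_l + m/2` and a common conjugate coefficient
`-3Q_l + 3m/2`. The common parts preserve `v(l)`, whereas `±S_l` turns the sum of the two modes into
their difference and so couples `v(l)` with `w(l)`. -/
theorem hessC_vVec {n l : ℕ} (h2 : 2 ≤ l) (hl : l ≤ n / 2) (m : ℝ) (c : ℂ) :
    hessC n m (c • ((1 / 2 : ℂ) • (mode n (1 + l) + mode n (1 - l)))) =
      massC n m ((((PP n l + m / 2 : ℝ) : ℂ) * c +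
          ((-3 * QQ n l + 3 * m / 2 : ℝ) : ℂ) * starRingEnd ℂ c) •
            ((1 / 2 : ℂ) • (mode n (1 + l) + mode n (1 - l))) +
        ((SS n l : ℂ) * Complex.I * c) •
          ((-Complex.I / 2) • (mode n (1 + l) - mode n (1 - l)))) := by
  have hn : n ≠ 0 := by omega
  have e : ∀ a b : Fin (n + 1) → ℂ, c • ((1 / 2 : ℂ) • (a + b)) = (c / 2) • a + (c / 2) • b := by
    intro a b; module
  have e1 : (2 : ℤ) - (1 + l) = 1 - l := by ring
  have e2 : (2 : ℤ) - (1 - l) = 1 + l := by ring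
  have d1 : ¬(n : ℤ) ∣ 1 + l := not_dvd_of_lt (by omega) (by omega) (by omega)
  have d2 : ¬(n : ℤ) ∣ 1 - l := not_dvd_of_lt (by omega) (by omega) (by omega)
  rw [e, hessC_add, hessC_mode_of_not_dvd hn m d1 (by rwa [e1]),
    hessC_mode_of_not_dvd hn m d2 (by rwa [e2]), e1, e2, alphaC_add, alphaC_sub, betaC_add,
    betaC_sub]
  simp only [massC_add, massC_sub, massC_smul, massC_mode, map_div₀, map_ofNat]
  funext k
  simp only [Pi.add_apply, Pi.sub_apply, Pi.smul_apply, smul_eq_mul]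
  push_cast
  linear_combination ((SS n l : ℂ) * c * (mode n (1 + l) k - mode n (1 - l) k) / 2) * Complex.I_sq

theorem hessC_wVec {n l : ℕ} (h2 : 2 ≤ l) (hl : l ≤ n / 2) (m : ℝ) (c : ℂ) :
    hessC n m (c • ((-Complex.I / 2) • (mode n (1 + l) - mode n (1 - l)))) =
      massC n m ((((PP n l + m / 2 : ℝ) : ℂ) * c +
          ((-3 * QQ n l + 3 * m / 2 : ℝ) : ℂ) * starRingEnd ℂ c) •
            ((-Complex.I / 2) • (mode n (1 + l) - mode n (1 - l))) +
        (-(SS n l : ℂ) * Complex.I * c) •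
          ((1 / 2 : ℂ) • (mode n (1 + l) + mode n (1 - l)))) := by
  have hn : n ≠ 0 := by omega
  have e : ∀ a b : Fin (n + 1) → ℂ, c • ((-Complex.I / 2 : ℂ) • (a - b)) =
      (-c * Complex.I / 2) • a + (c * Complex.I / 2) • b := by
    intro a b; module
  have e1 : (2 : ℤ) - (1 + l) = 1 - l := by ring
  have e2 : (2 : ℤ) - (1 - l) = 1 + l := by ring
  have d1 : ¬(n : ℤ) ∣ 1 + l := not_dvd_of_lt (by omega) (by omega) (by omega)
  have d2 : ¬(n : ℤ) ∣ 1 - l := not_dvd_of_lt (by omega) (by omega) (by omega)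
  rw [e, hessC_add, hessC_mode_of_not_dvd hn m d1 (by rwa [e1]),
    hessC_mode_of_not_dvd hn m d2 (by rwa [e2]), e1, e2, alphaC_add, alphaC_sub, betaC_add,
    betaC_sub]
  simp only [massC_add, massC_sub, massC_smul, massC_mode, map_div₀, map_ofNat, map_mul, map_neg,
    Complex.conj_I]
  funext k
  simp only [Pi.add_apply, Pi.sub_apply, Pi.smul_apply, smul_eq_mul]
  push_cast
  ring

theorem SS_half {n l : ℕ} (h : 2 * l = n) : SS n l = 0 := by
  refine Finset.sum_eq_zero fun d hd => ?_
  have hd' := Finset.mem_Icc.1 hd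
  have hl : (l : ℝ) ≠ 0 := by
    have : l ≠ 0 := by omega
    exact_mod_cast this
  have : ang n (d * l) = d * π := by
    rw [ang, ← h]; push_cast; field_simp
  rw [this, Real.sin_nat_mul_pi]
  simp

theorem hessC_half {n l : ℕ} (hn : 3 ≤ n) (h : 2 * l = n) (m : ℝ) (c : ℂ) :
    hessC n m (c • mode n (1 + l)) =
      massC n m ((((PP n l + m / 2 : ℝ) : ℂ) * c +
          ((-3 * QQ n l + 3 * m / 2 : ℝ) : ℂ) * starRingEnd ℂ c) • mode n (1 + l)) := by
  have e1 : (2 : ℤ) - (1 + l) = 1 - l := by ring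
  have d1 : ¬(n : ℤ) ∣ 1 + l := not_dvd_of_lt (by omega) (by omega) (by omega)
  have d2 : ¬(n : ℤ) ∣ 1 - l := not_dvd_of_lt (by omega) (by omega) (by omega)
  have e : mode n (1 - l) = mode n (1 + l) :=
    mode_congr (by omega) ⟨1, by rw [← h]; push_cast; ring⟩
  rw [hessC_mode_of_not_dvd (by omega) m d1 (by rwa [e1]), e1, e, alphaC_add, betaC_add, SS_half h,
    massC_smul, massC_mode, ← add_smul, add_zero]

theorem hess_mul_AKep {n : ℕ} (hn : 3 ≤ n) {m : ℝ} (hm : 0 < m) :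
    (MM n m)⁻¹ * hess (pot n m) (cfg n) * AKep n = AKep n * UKep n m := by
  refine hess_mul_pairCols (by omega) hm _ _ fun ⟨i, s⟩ => ?_
  simp only [cx_kep_vec, smul_smul, Fintype.sum_prod_type, Fin.sum_univ_two,
    Finset.univ_unique, Finset.sum_singleton, UKep, of_apply, ← add_smul]
  rw [hessC_kep hn]
  congr 2
  fin_cases s
  · simp
    ring
  · simp
    ring

/-- The size `half n l` is `1` or `2` only after a case distinction; a sum over the index type is
rewritten through its embedding into `Fin 2`. -/
theorem sum_castLE {E : Type} [AddCommMonoid E] {k : ℕ} (h : k ≤ 2) (f : Fin 2 → E) :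
    (k = 1 → ∑ i : Fin k, f (Fin.castLE h i) = f 0) ∧
      (k = 2 → ∑ i : Fin k, f (Fin.castLE h i) = f 0 + f 1) := by
  constructor
  · rintro rfl
    simp
  · rintro rfl
    simp [Fin.sum_univ_two]

theorem hess_mul_ABlk {n l : ℕ} (hn : 3 ≤ n) {m : ℝ} (hm : 0 < m) (h1 : 1 ≤ l) (hl : l ≤ n / 2) :
    (MM n m)⁻¹ * hess (pot n m) (cfg n) * ABlk n m l = ABlk n m l * UBlk n m l := by
  have hnp : (0 : ℝ) < n := by exact_mod_cast (by omega : 0 < n)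
  refine hess_mul_pairCols (by omega) hm _ _ fun ⟨i, s⟩ => ?_
  by_cases h : 2 * l = n
  · have hk : half n l = 1 := by simp [half, h]
    simp only [UBlk, of_apply, h, if_true, Fintype.sum_prod_type]
    rw [(sum_castLE (half_le n l) fun i => ∑ t : Fin 2, ((UHalf n m l t s : ℝ) : ℂ) •
      ![1, Complex.I] t • cx (essVec n m l i)).1 hk]
    rw [essVec_half m (by omega) h, essVec_half m (by omega) h]
    simp only [Fin.sum_univ_two, smul_smul, ← add_smul]
    rw [hessC_half hn h]
    congr 2
    fin_cases s
    · simp [UHalf, aa]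
      ring
    · simp [UHalf, bb]
      ring
  · have hk : half n l = 2 := by simp [half, h]
    by_cases hl1 : l = 1
    · subst hl1
      simp only [UBlk, of_apply, h, if_false, if_true, Fintype.sum_prod_type, pos4]
      rw [(sum_castLE (half_le n 1) fun j => ∑ t : Fin 2,
        ((U1 n m (finProdFinEquiv (j, t))
          (finProdFinEquiv (Fin.castLE (half_le n 1) i, s)) : ℝ) : ℂ) •
        ![1, Complex.I] t • cx (essVec n m 1 j)).2 hk]
      generalize Fin.castLE (half_le n 1) i = j
      -- In terms of the roots of `m`, `n` and `m + n`, the scaling factor of the first vector is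
      -- `a/(bc)` and `√(m(m+n))` is `ac`. Rescaling to unit vectors turns the unequal couplings
      -- `3(n+m)/2` and `3m/2` into the same `κ`.
      obtain ⟨a, ha⟩ : ∃ a : ℝ, a = √m := ⟨_, rfl⟩
      obtain ⟨b, hb⟩ : ∃ b : ℝ, b = √(n : ℝ) := ⟨_, rfl⟩
      obtain ⟨c, hc⟩ : ∃ c : ℝ, c = √(m + n) := ⟨_, rfl⟩
      have ha0 : a ≠ 0 := by rw [ha]; positivity
      have hb0 : b ≠ 0 := by rw [hb]; positivity
      have hc0 : c ≠ 0 := by rw [hc]; positivity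
      have ha2 : a ^ 2 = m := by rw [ha, Real.sq_sqrt hm.le]
      have hc2 : c ^ 2 = n + m := by rw [hc, Real.sq_sqrt (by positivity), add_comm]
      have hT : √(m / ((n : ℝ) ^ 2 + m * n)) = a / (b * c) := by
        rw [ha, hb, hc, Real.sqrt_div hm.le, ← Real.sqrt_mul hnp.le]
        congr 2
        ring
      have hκ : √(m * (m + n)) = a * c := by rw [ha, hc, Real.sqrt_mul hm.le]
      have hsq : (3 / 2 * (n + m)) * √(m / ((n : ℝ) ^ 2 + m * n)) =
          3 / 2 * √(m * (m + n)) * (1 / √n) := by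
        rw [hT, hκ, ← hc2, ← hb]
        field_simp
      have hsq2 : 3 / 2 * m * (1 / √(n : ℝ)) =
          3 / 2 * √(m * (m + n)) * √(m / ((n : ℝ) ^ 2 + m * n)) := by
        rw [hT, hκ, ← ha2, ← hb]
        field_simp
      have p00 : (finProdFinEquiv ((0 : Fin 2), (0 : Fin 2)) : Fin 4) = 0 := rfl
      have p01 : (finProdFinEquiv ((0 : Fin 2), (1 : Fin 2)) : Fin 4) = 1 := rfl
      have p10 : (finProdFinEquiv ((1 : Fin 2), (0 : Fin 2)) : Fin 4) = 2 := rfl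
      have p11 : (finProdFinEquiv ((1 : Fin 2), (1 : Fin 2)) : Fin 4) = 3 := rfl
      have e0 := essVec_one_zero m hn
      have e1 := essVec_one_one m hn
      have v := hessC_vHat hn hm
      have w := hessC_wHat hn hm
      have hs1 := congrArg (fun x : ℝ => (x : ℂ)) hsq
      have hs2 := congrArg (fun x : ℝ => (x : ℂ)) hsq2
      rw [e0, e1]
      simp only [Fin.sum_univ_two]
      clear hT hκ hsq hsq2
      simp only [U1]
      generalize √(m / ((n : ℝ) ^ 2 + m * n)) = T₀ at *
      generalize 1 / √(n : ℝ) = T₁ at *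
      generalize √(m * (m + n)) = κ at *
      generalize (-n / m : ℂ) • ctr n + mode n 0 = V at *
      generalize mode n 2 = W at *
      push_cast at hs1 hs2
      fin_cases j <;> fin_cases s <;>
        simp only [Fin.zero_eta, Fin.mk_one, e0, e1, p00, p01, p10, p11, smul_smul, v, w] <;>
        congr 1 <;> funext k <;>
        simp
      · exact Or.inl hs1
      · left
        linear_combination Complex.I * hs1
      · linear_combination V k * hs2
      · linear_combination (-Complex.I * V k) * hs2
    · simp only [UBlk, of_apply, h, if_false, hl1, Fintype.sum_prod_type, pos4]
      rw [(sum_castLE (half_le n l) fun j => ∑ t : Fin 2,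
        ((UMid n m l (finProdFinEquiv (j, t))
          (finProdFinEquiv (Fin.castLE (half_le n l) i, s)) : ℝ) : ℂ) •
        ![1, Complex.I] t • cx (essVec n m l j)).2 hk]
      generalize Fin.castLE (half_le n l) i = j
      rw [essVec_mid_zero m h hl1, essVec_mid_one m h hl1]
      have p00 : (finProdFinEquiv ((0 : Fin 2), (0 : Fin 2)) : Fin 4) = 0 := rfl
      have p01 : (finProdFinEquiv ((0 : Fin 2), (1 : Fin 2)) : Fin 4) = 1 := rfl
      have p10 : (finProdFinEquiv ((1 : Fin 2), (0 : Fin 2)) : Fin 4) = 2 := rfl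
      have p11 : (finProdFinEquiv ((1 : Fin 2), (1 : Fin 2)) : Fin 4) = 3 := rfl
      simp only [Fin.sum_univ_two]
      have v := hessC_vVec (by omega : 2 ≤ l) hl m
      have w := hessC_wVec (by omega : 2 ≤ l) hl m
      have e0 := essVec_mid_zero m h hl1
      have e1 := essVec_mid_one m h hl1
      generalize √(2 / (n : ℝ)) = T at *
      generalize (1 / 2 : ℂ) • (mode n (1 + l) + mode n (1 - l)) = V at *
      generalize (-Complex.I / 2) • (mode n (1 + l) - mode n (1 - l)) = W at *
      fin_cases j <;> fin_cases s <;>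
        simp only [Fin.zero_eta, Fin.mk_one, e0, e1, p00, p01, p10, p11, smul_smul, v, w] <;>
        congr 1 <;> funext k <;>
        simp [UMid, aa, bb]
      · ring
      · linear_combination ((SS n l : ℂ) * T * W k) * Complex.I_sq
      · ring
      · linear_combination (-(SS n l : ℂ) * T * V k) * Complex.I_sq

/-! ## Kepler orbits -/

namespace IsKeplerOrbit

variable {μ p e : ℝ} {r θ : ℝ → ℝ}

theorem one_add_pos (he : 0 ≤ e) (he1 : e < 1) (φ : ℝ) : 0 < 1 + e * Real.cos φ := by
  nlinarith [Real.neg_one_le_cos φ]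

theorem radius_pos (h : IsKeplerOrbit μ p e r θ) (hp : 0 < p) (he : 0 ≤ e) (he1 : e < 1) (t : ℝ) :
    0 < r t := by
  rw [h.1]
  exact div_pos hp (one_add_pos he he1 _)

theorem radius_mul (h : IsKeplerOrbit μ p e r θ) (he : 0 ≤ e) (he1 : e < 1) (t : ℝ) :
    r t * (1 + e * Real.cos (θ t)) = p := by
  rw [h.1, div_mul_cancel₀ _ (one_add_pos he he1 _).ne']

theorem inv_one_add (h : IsKeplerOrbit μ p e r θ) (hp : 0 < p) (t : ℝ) :
    (1 + e * Real.cos (θ t))⁻¹ = r t / p := by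
  rw [h.1]
  field_simp

theorem radius_le (h : IsKeplerOrbit μ p e r θ) (hp : 0 < p) (he : 0 ≤ e) (he1 : e < 1) (t : ℝ) :
    r t ≤ p / (1 - e) := by
  rw [h.1]
  have := Real.neg_one_le_cos (θ t)
  have h1 : 0 < 1 - e := by linarith
  gcongr
  nlinarith

theorem strictMono (h : IsKeplerOrbit μ p e r θ) (hμ : 0 < μ) (hp : 0 < p) (he : 0 ≤ e)
    (he1 : e < 1) : StrictMono θ :=
  strictMono_of_deriv_pos fun t => by
    rw [(h.2 t).deriv]
    have := h.radius_pos hp he he1 t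
    have : 0 < μ * p := mul_pos hμ hp
    positivity

/-- Since `r ≤ p/(1-e)`, the derivative of `θ` is bounded below by a positive constant, so `θ` is
unbounded in both directions. -/
theorem bijective (h : IsKeplerOrbit μ p e r θ) (hμ : 0 < μ) (hp : 0 < p) (he : 0 ≤ e)
    (he1 : e < 1) : Function.Bijective θ := by
  refine ⟨(h.strictMono hμ hp he he1).injective, ?_⟩
  have hd : Differentiable ℝ θ := fun t => (h.2 t).differentiableAt
  have h1 : 0 < 1 - e := by linarith
  set C := √(μ * p) / (p / (1 - e)) ^ 2 with hC
  have hC0 : 0 < C := by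
    have : 0 < μ * p := mul_pos hμ hp
    positivity
  have hder : ∀ t, C ≤ deriv θ t := fun t => by
    rw [(h.2 t).deriv, hC]
    have := h.radius_pos hp he he1 t
    have := h.radius_le hp he he1 t
    gcongr
  have key : ∀ x y, x ≤ y → C * (y - x) ≤ θ y - θ x := fun x y hxy =>
    mul_sub_le_image_sub_of_le_deriv hd hder hxy
  refine hd.continuous.surjective ?_ ?_
  · refine tendsto_atTop_mono' _ (f₁ := fun t => C * t + θ 0) ?_
      (tendsto_atTop_add_const_right _ _ (tendsto_id.const_mul_atTop hC0))
    filter_upwards [eventually_ge_atTop 0] with t ht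
    have := key 0 t ht
    linarith
  · refine tendsto_atBot_mono' _ (f₁ := fun t => C * t + θ 0) ?_
      (tendsto_atBot_add_const_right _ _ (tendsto_id.const_mul_atBot hC0))
    filter_upwards [eventually_le_atBot 0] with t ht
    have := key t 0 ht
    linarith

theorem hasDerivAt_radius (h : IsKeplerOrbit μ p e r θ) (hp : 0 < p) (he : 0 ≤ e) (he1 : e < 1)
    (t : ℝ) : HasDerivAt r (√(μ * p) / p * e * Real.sin (θ t)) t := by
  have h0 := (one_add_pos he he1 (θ t)).ne'
  have hr : r = fun t => p / (1 + e * Real.cos (θ t)) := funext h.1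
  have h1 := (((h.2 t).cos.const_mul e).const_add 1).inv h0
  have h2 := h1.const_mul p
  have hrt := (h.radius_pos hp he he1 t).ne'
  have hm := h.radius_mul he he1 t
  rw [hr]
  simp only [div_eq_mul_inv]
  refine h2.congr_deriv ?_
  have h3 : 1 + e * Real.cos (θ t) = p / r t := by rw [← hm]; field_simp
  rw [h3]
  field_simp

/-- With the next lemma this says that the velocity is `√(μp)/p` times `(-sin θ, cos θ + e)`, a
point of a circle. In this form the second derivative needs only `θ'`. -/
theorem hasDerivAt_cos (h : IsKeplerOrbit μ p e r θ) (hp : 0 < p) (he : 0 ≤ e) (he1 : e < 1)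
    (t : ℝ) : HasDerivAt (fun t => r t * Real.cos (θ t)) (-(√(μ * p) / p) * Real.sin (θ t)) t := by
  refine ((h.hasDerivAt_radius hp he he1 t).mul (h.2 t).cos).congr_deriv ?_
  have hrt := (h.radius_pos hp he he1 t).ne'
  have hm := h.radius_mul he he1 t
  have h3 : √(μ * p) = √(μ * p) / p * (r t * (1 + e * Real.cos (θ t))) := by
    rw [hm]; field_simp
  have h4 : r t * (-Real.sin (θ t) * (√(μ * p) / r t ^ 2)) =
      -Real.sin (θ t) * (√(μ * p) / p * (1 + e * Real.cos (θ t))) := by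
    rw [show r t * (-Real.sin (θ t) * (√(μ * p) / r t ^ 2)) = -Real.sin (θ t) * (√(μ * p) / r t) by
      field_simp]
    congr 1
    nth_rw 1 [h3]
    field_simp
  rw [h4]
  ring

theorem hasDerivAt_sin (h : IsKeplerOrbit μ p e r θ) (hp : 0 < p) (he : 0 ≤ e) (he1 : e < 1)
    (t : ℝ) : HasDerivAt (fun t => r t * Real.sin (θ t))
      (√(μ * p) / p * (Real.cos (θ t) + e)) t := by
  refine ((h.hasDerivAt_radius hp he he1 t).mul (h.2 t).sin).congr_deriv ?_
  have hrt := (h.radius_pos hp he he1 t).ne'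
  have hm := h.radius_mul he he1 t
  have h3 : √(μ * p) = √(μ * p) / p * (r t * (1 + e * Real.cos (θ t))) := by
    rw [hm]; field_simp
  have h4 : r t * (Real.cos (θ t) * (√(μ * p) / r t ^ 2)) =
      Real.cos (θ t) * (√(μ * p) / p * (1 + e * Real.cos (θ t))) := by
    rw [show r t * (Real.cos (θ t) * (√(μ * p) / r t ^ 2)) = Real.cos (θ t) * (√(μ * p) / r t) by
      field_simp]
    congr 1
    nth_rw 1 [h3]
    field_simp
  rw [h4]
  linear_combination (√(μ * p) / p * e) * Real.sin_sq_add_cos_sq (θ t)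

theorem hasDerivAt_scale (h : IsKeplerOrbit μ p e r θ) (hp : 0 < p) (he : 0 ≤ e)
    (he1 : e < 1) (t : ℝ) :
    HasDerivAt (scale μ p r) (√(μ * p) / p * e * Real.sin (θ t) / √(√(μ * p))) t :=
  (h.hasDerivAt_radius hp he he1 t).div_const _

theorem deriv_scale (h : IsKeplerOrbit μ p e r θ) (hp : 0 < p) (he : 0 ≤ e) (he1 : e < 1) :
    deriv (scale μ p r) = fun t => √(μ * p) / p * e * Real.sin (θ t) / √(√(μ * p)) :=
  funext fun t => (h.hasDerivAt_scale hp he he1 t).deriv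

end IsKeplerOrbit

/-! ## Matrix-valued curves -/

section Curves

variable {α β γ : Type}

/-- Entrywise differentiability of a curve of matrices. -/
def EntryDeriv (T : ℝ → Matrix α β ℝ) (T' : Matrix α β ℝ) (t : ℝ) : Prop :=
  ∀ i j, HasDerivAt (fun t => T t i j) (T' i j) t

theorem EntryDeriv.mulVec [Fintype α] [Fintype β] {T : ℝ → Matrix α β ℝ} {T' : Matrix α β ℝ} {t : ℝ}
    (hT : EntryDeriv T T' t) {ζ : ℝ → β → ℝ} {z : β → ℝ} (hζ : HasDerivAt ζ z t) :
    HasDerivAt (fun t => T t *ᵥ ζ t) (T' *ᵥ ζ t + T t *ᵥ z) t := by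
  rw [hasDerivAt_pi] at hζ ⊢
  intro i
  have := HasDerivAt.fun_sum (u := Finset.univ) fun j _ => (hT i j).mul (hζ j)
  simpa [Matrix.mulVec, dotProduct, Finset.sum_add_distrib] using this

theorem entryDeriv_const (C : Matrix α β ℝ) (t : ℝ) : EntryDeriv (fun _ => C) 0 t := fun i j =>
  hasDerivAt_const t (C i j)

theorem EntryDeriv.smul_const {c : ℝ → ℝ} {c' t : ℝ} (hc : HasDerivAt c c' t) (C : Matrix α β ℝ) :
    EntryDeriv (fun t => c t • C) (c' • C) t := fun i j => hc.mul_const (C i j)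

theorem EntryDeriv.smul {c : ℝ → ℝ} {c' t : ℝ} (hc : HasDerivAt c c' t) {T : ℝ → Matrix α β ℝ}
    {T' : Matrix α β ℝ} (hT : EntryDeriv T T' t) :
    EntryDeriv (fun t => c t • T t) (c' • T t + c t • T') t := fun i j => hc.mul (hT i j)

theorem EntryDeriv.add {T S : ℝ → Matrix α β ℝ} {T' S' : Matrix α β ℝ} {t : ℝ}
    (hT : EntryDeriv T T' t) (hS : EntryDeriv S S' t) :
    EntryDeriv (fun t => T t + S t) (T' + S') t := fun i j => (hT i j).add (hS i j)

theorem EntryDeriv.const_mul [Fintype β] {T : ℝ → Matrix β γ ℝ} {T' : Matrix β γ ℝ} {t : ℝ}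
    (C : Matrix α β ℝ) (hT : EntryDeriv T T' t) : EntryDeriv (fun t => C * T t) (C * T') t :=
  fun i j => by
    have := HasDerivAt.fun_sum (u := Finset.univ) fun k _ => (hT k j).const_mul (C i k)
    simpa [Matrix.mul_apply] using this

theorem EntryDeriv.mul_const [Fintype β] {T : ℝ → Matrix α β ℝ} {T' : Matrix α β ℝ} {t : ℝ}
    (hT : EntryDeriv T T' t) (C : Matrix β γ ℝ) : EntryDeriv (fun t => T t * C) (T' * C) t :=
  fun i j => by
    have := HasDerivAt.fun_sum (u := Finset.univ) fun k _ => (hT i k).mul_const (C k j)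
    simpa [Matrix.mul_apply] using this

theorem EntryDeriv.transpose {T : ℝ → Matrix α β ℝ} {T' : Matrix α β ℝ} {t : ℝ}
    (hT : EntryDeriv T T' t) : EntryDeriv (fun t => (T t)ᵀ) T'ᵀ t := fun i j => hT j i

theorem EntryDeriv.fromBlocks {δ : Type} {A : ℝ → Matrix α γ ℝ} {B : ℝ → Matrix α δ ℝ}
    {C : ℝ → Matrix β γ ℝ} {D : ℝ → Matrix β δ ℝ} {A' : Matrix α γ ℝ} {B' : Matrix α δ ℝ}
    {C' : Matrix β γ ℝ} {D' : Matrix β δ ℝ} {t : ℝ} (hA : EntryDeriv A A' t)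
    (hB : EntryDeriv B B' t) (hC : EntryDeriv C C' t) (hD : EntryDeriv D D' t) :
    EntryDeriv (fun t => Matrix.fromBlocks (A t) (B t) (C t) (D t))
      (Matrix.fromBlocks A' B' C' D') t := by
  rintro (i | i) (j | j)
  exacts [hA i j, hB i j, hC i j, hD i j]

theorem entryDeriv_rot [DecidableEq α] (𝕁 : Matrix α α ℝ) {θ : ℝ → ℝ} {θ' t : ℝ}
    (h : HasDerivAt θ θ' t) :
    EntryDeriv (fun t => rot 𝕁 (θ t))
      (θ' • ((-Real.sin (θ t)) • (1 : Matrix α α ℝ) + Real.cos (θ t) • 𝕁)) t := by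
  have h1 := (EntryDeriv.smul_const h.cos (1 : Matrix α α ℝ)).add (EntryDeriv.smul_const h.sin 𝕁)
  have h2 : θ' • ((-Real.sin (θ t)) • (1 : Matrix α α ℝ) + Real.cos (θ t) • 𝕁) =
      (-Real.sin (θ t) * θ') • (1 : Matrix α α ℝ) + (Real.cos (θ t) * θ') • 𝕁 := by module
  rw [h2]
  exact h1

end Curves

/-! ## Pulsating coordinates -/

section Pulse

variable {ι κ : Type} [Fintype ι] [DecidableEq ι] [Fintype κ] [DecidableEq κ]

theorem rot_comm {𝕁 : Matrix ι ι ℝ} {𝕁' : Matrix κ κ ℝ} {A : Matrix ι κ ℝ} (h : 𝕁 * A = A * 𝕁')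
    (φ : ℝ) : rot 𝕁 φ * A = A * rot 𝕁' φ := by
  simp [rot, Matrix.mul_add, Matrix.add_mul, h]

theorem rot_transpose_mul {𝕁 : Matrix κ κ ℝ} (h𝕁 : 𝕁 * 𝕁 = -1) (h𝕁' : 𝕁ᵀ = -𝕁) (φ : ℝ) :
    (rot 𝕁 φ)ᵀ * rot 𝕁 φ = 1 := by
  have h := Real.sin_sq_add_cos_sq φ
  simp only [rot, transpose_add, transpose_smul, transpose_one, h𝕁', Matrix.mul_add, Matrix.add_mul,
    Matrix.smul_mul, Matrix.mul_smul, Matrix.one_mul, Matrix.mul_one, Matrix.neg_mul, h𝕁, smul_neg,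
    neg_neg]
  have : (1 : Matrix κ κ ℝ) = (Real.sin φ ^ 2 + Real.cos φ ^ 2) • (1 : Matrix κ κ ℝ) := by
    rw [h, one_smul]
  conv_rhs => rw [this]
  module

theorem rot_deriv_eq {𝕁 : Matrix κ κ ℝ} (h𝕁 : 𝕁 * 𝕁 = -1) (φ : ℝ) :
    (-Real.sin φ) • (1 : Matrix κ κ ℝ) + Real.cos φ • 𝕁 = rot 𝕁 φ * 𝕁 := by
  simp only [rot, Matrix.add_mul, Matrix.smul_mul, Matrix.one_mul, h𝕁]
  module

/-- The coordinates `Q = A s R x̄`, `P = M A (s⁻¹ R ȳ + s' R x̄)`. -/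
def pulseMap (μ : ι → ℝ) (A : Matrix ι κ ℝ) (𝕁 : Matrix κ κ ℝ) (s s' φ : ℝ) :
    Matrix (ι ⊕ ι) (κ ⊕ κ) ℝ :=
  fromBlocks (diagonal μ * A) 0 0 A * pulse 𝕁 s s' φ

theorem pulseMap_eq (μ : ι → ℝ) (A : Matrix ι κ ℝ) (𝕁 : Matrix κ κ ℝ) (s s' φ : ℝ) :
    pulseMap μ A 𝕁 s s' φ = fromBlocks (s⁻¹ • (diagonal μ * A * rot 𝕁 φ))
      (s' • (diagonal μ * A * rot 𝕁 φ)) 0 (s • (A * rot 𝕁 φ)) := by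
  simp [pulseMap, pulse, fromBlocks_multiply]

/-- The conditions `AᵀMA = 1` and `RᵀR = 1` reduce every block to a scalar: the diagonal scales
`s⁻¹` and `s` cancel each other, and the two terms with `s s'` have opposite signs. -/
theorem pulseMap_symplectic {μ : ι → ℝ} {A : Matrix ι κ ℝ} {𝕁 : Matrix κ κ ℝ} (h𝕁 : 𝕁 * 𝕁 = -1)
    (h𝕁' : 𝕁ᵀ = -𝕁) (hA : Aᵀ * diagonal μ * A = 1) {s : ℝ} (hs : s ≠ 0) (s' φ : ℝ) :
    (pulseMap μ A 𝕁 s s' φ)ᵀ * Matrix.J ι ℝ * pulseMap μ A 𝕁 s s' φ = Matrix.J κ ℝ := by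
  have key : (rot 𝕁 φ)ᵀ * Aᵀ * (diagonal μ * A * rot 𝕁 φ) = 1 := by
    rw [Matrix.mul_assoc, ← Matrix.mul_assoc Aᵀ, ← Matrix.mul_assoc Aᵀ, hA, Matrix.one_mul,
      rot_transpose_mul h𝕁 h𝕁']
  have key2 : (rot 𝕁 φ)ᵀ * (Aᵀ * diagonal μ) * (A * rot 𝕁 φ) = 1 := by
    rw [← key]; simp only [Matrix.mul_assoc]
  rw [pulseMap_eq, Matrix.J, fromBlocks_transpose, fromBlocks_multiply, fromBlocks_multiply,
    Matrix.J]
  simp only [transpose_smul, transpose_mul, transpose_zero, diagonal_transpose, Matrix.mul_zero,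
    Matrix.zero_mul, add_zero, zero_add, Matrix.mul_neg, Matrix.mul_one, Matrix.neg_mul,
    Matrix.smul_mul, Matrix.mul_smul, key, key2, smul_zero]
  congr 1
  · rw [smul_neg, smul_smul, mul_inv_cancel₀ hs, one_smul]
  · rw [smul_smul, inv_mul_cancel₀ hs, one_smul]
  · module

theorem symp_mulVec {T : Matrix (ι ⊕ ι) (κ ⊕ κ) ℝ} (hT : Tᵀ * Matrix.J ι ℝ * T = Matrix.J κ ℝ)
    (x y : κ ⊕ κ → ℝ) : symp (T *ᵥ x) (T *ᵥ y) = symp x y := by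
  rw [symp, symp, ← hT, dotProduct_mulVec, ← mulVec_transpose, mulVec_mulVec, mulVec_mulVec]

theorem left_inverse_of_symplectic {T : Matrix (ι ⊕ ι) (κ ⊕ κ) ℝ}
    (hT : Tᵀ * Matrix.J ι ℝ * T = Matrix.J κ ℝ) :
    (-Matrix.J κ ℝ * Tᵀ * Matrix.J ι ℝ) * T = 1 := by
  rw [Matrix.mul_assoc, Matrix.mul_assoc, ← Matrix.mul_assoc Tᵀ, hT, Matrix.neg_mul,
    Matrix.J_squared, neg_neg]

theorem pulseMap_entryDeriv (μ : ι → ℝ) (A : Matrix ι κ ℝ) {𝕁 : Matrix κ κ ℝ} (h𝕁 : 𝕁 * 𝕁 = -1)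
    {s s' θ : ℝ → ℝ} {s'' θ' t : ℝ} (hs0 : s t ≠ 0) (hs : HasDerivAt s (s' t) t)
    (hs' : HasDerivAt s' s'' t) (hθ : HasDerivAt θ θ' t) :
    EntryDeriv (fun t => pulseMap μ A 𝕁 (s t) (s' t) (θ t))
      (fromBlocks
        (((-s' t) / s t ^ 2) • (diagonal μ * A * rot 𝕁 (θ t)) +
          (s t)⁻¹ • (θ' • (diagonal μ * A * rot 𝕁 (θ t) * 𝕁)))
        (s'' • (diagonal μ * A * rot 𝕁 (θ t)) +
          s' t • (θ' • (diagonal μ * A * rot 𝕁 (θ t) * 𝕁))) 0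
        (s' t • (A * rot 𝕁 (θ t)) + s t • (θ' • (A * rot 𝕁 (θ t) * 𝕁)))) t := by
  simp only [pulseMap_eq]
  have hR := entryDeriv_rot 𝕁 hθ
  rw [rot_deriv_eq h𝕁] at hR
  have h1 := hR.const_mul (diagonal μ * A)
  have h2 := hR.const_mul A
  rw [Matrix.mul_smul, ← Matrix.mul_assoc] at h1 h2
  exact EntryDeriv.fromBlocks (.smul (hs.inv hs0) h1) (.smul hs' h1) (entryDeriv_const _ _)
    (.smul hs h2)

/-- The identity `T' + θ' T J B = J H'' T` with `θ' = s⁻²`. The lower blocks express `P = M Q'`; in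
the upper left block all terms cancel. Only the upper right block involves the force: its identity
part requires `s³ s'' = 1 - ρ`, its `𝒰` part requires `s⁴ w = ρ/Λ`. -/
theorem pulseMap_deriv_eq {μ : ι → ℝ} (hμ : ∀ i, μ i ≠ 0) {A : Matrix ι κ ℝ} {𝕁 : Matrix κ κ ℝ}
    {𝒰 : Matrix κ κ ℝ} {W : Matrix ι ι ℝ} {s s' s'' φ ρ Λ w : ℝ} (hs0 : s ≠ 0)
    (hW : W * (A * rot 𝕁 φ) = w • (diagonal μ * A * rot 𝕁 φ * 𝒰))
    (hs'' : s ^ 3 * s'' = 1 - ρ) (hw : s ^ 4 * w = ρ * Λ⁻¹) :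
    fromBlocks
        (((-s') / s ^ 2) • (diagonal μ * A * rot 𝕁 φ) +
          s⁻¹ • ((s ^ 2)⁻¹ • (diagonal μ * A * rot 𝕁 φ * 𝕁)))
        (s'' • (diagonal μ * A * rot 𝕁 φ) +
          s' • ((s ^ 2)⁻¹ • (diagonal μ * A * rot 𝕁 φ * 𝕁))) 0
        (s' • (A * rot 𝕁 φ) + s • ((s ^ 2)⁻¹ • (A * rot 𝕁 φ * 𝕁))) +
      (s ^ 2)⁻¹ • (pulseMap μ A 𝕁 s s' φ *
        (Matrix.J κ ℝ * fromBlocks 1 (-𝕁) 𝕁 (1 - ρ • (1 + Λ⁻¹ • 𝒰)))) =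
      Matrix.J ι ℝ * fromBlocks (diagonal fun i => (μ i)⁻¹) 0 0 (-W) * pulseMap μ A 𝕁 s s' φ := by
  have hM : (diagonal fun i => (μ i)⁻¹) * diagonal μ = 1 := by
    rw [diagonal_mul_diagonal, ← diagonal_one]
    congr 1
    funext i
    exact inv_mul_cancel₀ (hμ i)
  have hA : (diagonal fun i => (μ i)⁻¹) * (diagonal μ * A * rot 𝕁 φ) = A * rot 𝕁 φ := by
    rw [Matrix.mul_assoc, ← Matrix.mul_assoc, hM, Matrix.one_mul]
  have hs2 : s'' = (s ^ 3)⁻¹ * (1 - ρ) := by rw [← hs'']; field_simp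
  have hw2 : w = (s ^ 4)⁻¹ * (ρ * Λ⁻¹) := by rw [← hw]; field_simp
  rw [pulseMap_eq, Matrix.J, Matrix.J]
  simp only [fromBlocks_multiply, fromBlocks_smul, fromBlocks_add, Matrix.mul_zero,
    Matrix.zero_mul, add_zero, zero_add, Matrix.mul_neg, Matrix.neg_mul, Matrix.mul_one,
    Matrix.one_mul, Matrix.smul_mul, Matrix.mul_smul, Matrix.mul_sub, Matrix.mul_add, neg_zero,
    smul_zero, neg_neg, hA, hW]
  generalize diagonal μ * A * rot 𝕁 φ = X
  generalize A * rot 𝕁 φ = Y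
  generalize X * 𝕁 = X₁
  generalize Y * 𝕁 = Y₁
  generalize X * 𝒰 = X₂
  rw [hs2, hw2]
  congr 1
  · match_scalars <;> field_simp <;> ring
  · match_scalars <;> field_simp <;> ring
  · match_scalars; field_simp
  · match_scalars <;> field_simp <;> ring

/-- In pulsating coordinates and with the new time `θ`, a linear Hamiltonian system along a
homographic motion takes the reduced form. -/
theorem isLinSol_pulseMap_iff {μ : ι → ℝ} (hμ : ∀ i, μ i ≠ 0) {A : Matrix ι κ ℝ}
    {𝕁 : Matrix κ κ ℝ} (h𝕁 : 𝕁 * 𝕁 = -1) (h𝕁' : 𝕁ᵀ = -𝕁) (hA : Aᵀ * diagonal μ * A = 1)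
    {𝒰 : Matrix κ κ ℝ} {W : ℝ → Matrix ι ι ℝ} {s s' s'' θ w ρ : ℝ → ℝ} {Λ : ℝ}
    (hs0 : ∀ t, s t ≠ 0) (hs : ∀ t, HasDerivAt s (s' t) t) (hs' : ∀ t, HasDerivAt s' (s'' t) t)
    (hθ : ∀ t, HasDerivAt θ ((s t ^ 2)⁻¹) t) (hbij : Function.Bijective θ)
    (hW : ∀ t, W t * (A * rot 𝕁 (θ t)) = w t • (diagonal μ * A * rot 𝕁 (θ t) * 𝒰))
    (hs'' : ∀ t, s t ^ 3 * s'' t = 1 - ρ (θ t)) (hw : ∀ t, s t ^ 4 * w t = ρ (θ t) * Λ⁻¹)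
    (ζ : ℝ → κ ⊕ κ → ℝ) :
    IsLinSol (fun t => fromBlocks (diagonal fun i => (μ i)⁻¹) 0 0 (-W t))
        (fun t => pulseMap μ A 𝕁 (s t) (s' t) (θ t) *ᵥ ζ (θ t)) ↔
      IsLinSol (fun ϑ => fromBlocks 1 (-𝕁) 𝕁 (1 - ρ ϑ • (1 + Λ⁻¹ • 𝒰))) ζ := by
  have hθpos : ∀ t, 0 < (s t ^ 2)⁻¹ := fun t => by
    have := hs0 t
    positivity
  set T := fun t => pulseMap μ A 𝕁 (s t) (s' t) (θ t) with hT
  set B := fun ϑ => fromBlocks 1 (-𝕁) 𝕁 (1 - ρ ϑ • (1 + Λ⁻¹ • 𝒰)) with hB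
  obtain ⟨T', hT', hTB⟩ : ∃ T' : ℝ → Matrix (ι ⊕ ι) (κ ⊕ κ) ℝ, (∀ t, EntryDeriv T (T' t) t) ∧
      ∀ t, T' t + (s t ^ 2)⁻¹ • (T t * (Matrix.J κ ℝ * B (θ t))) =
        Matrix.J ι ℝ * fromBlocks (diagonal fun i => (μ i)⁻¹) 0 0 (-W t) * T t :=
    ⟨_, fun t => pulseMap_entryDeriv μ A h𝕁 (hs0 t) (hs t) (hs' t) (hθ t), fun t =>
      pulseMap_deriv_eq hμ (hs0 t) (hW t) (hs'' t) (hw t)⟩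
  have hTB' : ∀ t v, (Matrix.J ι ℝ * fromBlocks (diagonal fun i => (μ i)⁻¹) 0 0 (-W t)) *ᵥ
      (T t *ᵥ v) = T' t *ᵥ v + T t *ᵥ ((s t ^ 2)⁻¹ • ((Matrix.J κ ℝ * B (θ t)) *ᵥ v)) :=
    fun t v => by
      rw [mulVec_mulVec, ← hTB, add_mulVec, smul_mulVec, ← mulVec_mulVec, mulVec_smul]
  have hsymp : ∀ t, (T t)ᵀ * Matrix.J ι ℝ * T t = Matrix.J κ ℝ := fun t =>
    pulseMap_symplectic h𝕁 h𝕁' hA (hs0 t) _ _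
  constructor
  · intro h
    set S := fun t => -Matrix.J κ ℝ * (T t)ᵀ * Matrix.J ι ℝ with hS
    have hST : ∀ t, S t * T t = 1 := fun t => left_inverse_of_symplectic (hsymp t)
    -- Nothing is assumed about `ζ`. Its differentiability along `θ` is recovered by applying the
    -- differentiable left inverse `S` to the given solution.
    have hζ : ∀ t, ∃ z, HasDerivAt (fun t => ζ (θ t)) z t := fun t => by
      have h1 := (((hT' t).transpose.const_mul (-Matrix.J κ ℝ)).mul_const
        (Matrix.J ι ℝ)).mulVec (h t)
      have h2 : (fun t => S t *ᵥ (T t *ᵥ ζ (θ t))) = fun t => ζ (θ t) := by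
        funext t
        rw [mulVec_mulVec, hST, one_mulVec]
      exact ⟨_, h2 ▸ h1⟩
    have hζ' : ∀ t, HasDerivAt (fun t => ζ (θ t))
        ((s t ^ 2)⁻¹ • ((Matrix.J κ ℝ * B (θ t)) *ᵥ ζ (θ t))) t := fun t => by
      obtain ⟨z, hz⟩ := hζ t
      have h1 := ((hT' t).mulVec hz).unique (h t)
      rw [hTB', add_right_inj] at h1
      have h2 := congrArg (S t *ᵥ ·) h1
      simp only [mulVec_mulVec, hST, one_mulVec] at h2
      rwa [← h2]
    have hmono : StrictMono θ := strictMono_of_deriv_pos fun t => by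
      rw [(hθ t).deriv]; exact hθpos t
    set g := (hmono.orderIsoOfSurjective θ hbij.2).symm with hg
    have hgc : Continuous g := g.continuous
    have hθg : ∀ ϑ, θ (g ϑ) = ϑ := (hmono.orderIsoOfSurjective θ hbij.2).apply_symm_apply
    intro ϑ
    -- Return to the true anomaly as time: the inverse of `θ` has derivative `s²`, which cancels the
    -- factor `s⁻²`.
    have hgd : HasDerivAt g ((s (g ϑ) ^ 2)⁻¹)⁻¹ ϑ :=
      HasDerivAt.of_local_left_inverse hgc.continuousAt (hθ (g ϑ)) (hθpos _).ne'
        (Eventually.of_forall hθg)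
    have h1 := (hζ' (g ϑ)).scomp ϑ hgd
    have h2 : (fun t => ζ (θ t)) ∘ g = ζ := by
      funext ϑ
      simp [hθg]
    rw [h2, smul_smul, inv_mul_cancel₀ (hθpos _).ne', one_smul, hθg] at h1
    exact h1
  · intro h t
    rw [hTB']
    exact (hT' t).mulVec ((h (θ t)).scomp t (hθ t))

/-! ## Homographic solutions -/

theorem isHamSol_phaseCurve {μ : ι → ℝ} (hμ : ∀ i, μ i ≠ 0) {V : (ι → ℝ) → ℝ}
    {Q Q' Q'' : ℝ → ι → ℝ} (hV : ∀ t, ∃ G H, HasGradHess V G H (Q t))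
    (hQ : ∀ t, HasDerivAt Q (Q' t) t) (hQ' : ∀ t, HasDerivAt Q' (Q'' t) t)
    (hN : ∀ t i, μ i * Q'' t i = grad V (Q t) i) :
    IsHamSol (ham μ V) (phaseCurve μ Q) := by
  have hd : deriv Q = Q' := funext fun t => (hQ t).deriv
  intro t
  obtain ⟨G, H, hG⟩ := hV t
  have h1 : HasGradHess V G H fun i => phaseCurve μ Q t (Sum.inr i) := hG
  rw [(hasGradHess_ham μ h1).grad_eq, Matrix.J, fromBlocks_mulVec, hasDerivAt_pi]
  rintro (i | i)
  · have h2 := ((hasDerivAt_pi.1 (hQ' t)) i).const_mul (μ i)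
    rw [hN, hG.grad_eq] at h2
    simpa [phaseCurve, hd, neg_mulVec, Function.comp_def] using h2
  · have h2 := (hasDerivAt_pi.1 (hQ t)) i
    simpa [phaseCurve, hd, Function.comp_def, hμ i] using h2

theorem hess_ham_phaseCurve (μ : ι → ℝ) {V : (ι → ℝ) → ℝ} {Q : ℝ → ι → ℝ} {t : ℝ}
    (hV : ∃ G H, HasGradHess V G H (Q t)) :
    hess (ham μ V) (phaseCurve μ Q t) =
      fromBlocks (diagonal fun i => (μ i)⁻¹) 0 0 (-hess V (Q t)) := by
  obtain ⟨G, H, hG⟩ := hV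
  have h1 : HasGradHess V G H fun i => phaseCurve μ Q t (Sum.inr i) := hG
  rw [(hasGradHess_ham μ h1).hess_eq, hG.hess_eq]

variable {Λ p e : ℝ} {r θ : ℝ → ℝ}

theorem hasDerivAt_homographic (h : IsKeplerOrbit Λ p e r θ) (hp : 0 < p) (he : 0 ≤ e) (he1 : e < 1)
    (𝕁 : Matrix ι ι ℝ) (a : ι → ℝ) (t : ℝ) :
    HasDerivAt (fun t => r t • (rot 𝕁 (θ t) *ᵥ a))
      ((-(√(Λ * p) / p) * Real.sin (θ t)) • a +
        (√(Λ * p) / p * (Real.cos (θ t) + e)) • (𝕁 *ᵥ a)) t := by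
  have h1 := ((h.hasDerivAt_cos hp he he1 t).smul_const a).add
    ((h.hasDerivAt_sin hp he he1 t).smul_const (𝕁 *ᵥ a))
  refine h1.congr_of_eventuallyEq (Eventually.of_forall fun t => ?_)
  simp only [rot, add_mulVec, smul_mulVec, one_mulVec, Pi.add_apply]
  module

theorem hasDerivAt_homographic_deriv (h : IsKeplerOrbit Λ p e r θ) (hΛ : 0 < Λ) (hp : 0 < p)
    (𝕁 : Matrix ι ι ℝ) (a : ι → ℝ) (t : ℝ) :
    HasDerivAt (fun t => (-(√(Λ * p) / p) * Real.sin (θ t)) • a +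
        (√(Λ * p) / p * (Real.cos (θ t) + e)) • (𝕁 *ᵥ a))
      ((-(Λ / r t ^ 2)) • (rot 𝕁 (θ t) *ᵥ a)) t := by
  have h1 := (((h.2 t).sin.const_mul (-(√(Λ * p) / p))).smul_const a).add
    ((((h.2 t).cos.add_const e).const_mul (√(Λ * p) / p)).smul_const (𝕁 *ᵥ a))
  refine h1.congr_deriv ?_
  have hL : √(Λ * p) * √(Λ * p) = Λ * p := Real.mul_self_sqrt (by positivity)
  have hL2 : Λ / r t ^ 2 = √(Λ * p) / p * (√(Λ * p) / r t ^ 2) := by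
    rw [div_mul_div_comm, hL]; field_simp
  simp only [rot, add_mulVec, smul_mulVec, one_mulVec, hL2]
  module

theorem isHamSol_homographic {μ : ι → ℝ} (hμ : ∀ i, μ i ≠ 0) {V : (ι → ℝ) → ℝ}
    (h : IsKeplerOrbit Λ p e r θ) (hΛ : 0 < Λ) (hp : 0 < p) (he : 0 ≤ e) (he1 : e < 1)
    (𝕁 : Matrix ι ι ℝ) (a : ι → ℝ)
    (hV : ∀ t, ∃ G H, HasGradHess V G H (r t • (rot 𝕁 (θ t) *ᵥ a)))
    (hN : ∀ t, grad V (r t • (rot 𝕁 (θ t) *ᵥ a)) =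
      (-(Λ / r t ^ 2)) • (diagonal μ *ᵥ (rot 𝕁 (θ t) *ᵥ a))) :
    IsHamSol (ham μ V) (phaseCurve μ fun t => r t • (rot 𝕁 (θ t) *ᵥ a)) :=
  isHamSol_phaseCurve hμ hV (hasDerivAt_homographic h hp he he1 𝕁 a)
    (hasDerivAt_homographic_deriv h hΛ hp 𝕁 a) fun t i => by
      rw [hN]
      simp only [Pi.smul_apply, mulVec_diagonal, smul_eq_mul]
      ring

/-- The scale is `r` divided by `(Λp)^{1/4}`, so the position stays at the constant `x` with `A x =
(Λp)^{1/4} a`. The momentum `𝕁'x` together with the `s'` term must reproduce the velocity. -/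
theorem pulseMap_mulVec_equilibrium (h : IsKeplerOrbit Λ p e r θ) (hΛ : 0 < Λ) (hp : 0 < p)
    (he : 0 ≤ e) (he1 : e < 1) (μ : ι → ℝ) {𝕁 : Matrix ι ι ℝ} {𝕁' : Matrix κ κ ℝ} {A : Matrix ι κ ℝ}
    (h𝕁 : 𝕁 * 𝕁 = -1) (hJA : 𝕁 * A = A * 𝕁') {a : ι → ℝ} {x : κ → ℝ}
    (hx : A *ᵥ x = √(√(Λ * p)) • a) (t : ℝ) :
    pulseMap μ A 𝕁' (scale Λ p r t) (deriv (scale Λ p r) t) (θ t) *ᵥ Sum.elim (𝕁' *ᵥ x) x =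
      phaseCurve μ (fun t => r t • (rot 𝕁 (θ t) *ᵥ a)) t := by
  have hr := (h.radius_pos hp he he1 t).ne'
  have hL : 0 < √(Λ * p) := Real.sqrt_pos.2 (mul_pos hΛ hp)
  have hL2 : √(√(Λ * p)) ^ 2 = √(Λ * p) := Real.sq_sqrt hL.le
  have hσ : √(√(Λ * p)) ≠ 0 := (Real.sqrt_pos.2 hL).ne'
  have hX : (A * rot 𝕁' (θ t)) *ᵥ x = √(√(Λ * p)) • (rot 𝕁 (θ t) *ᵥ a) := by
    rw [← rot_comm hJA, ← mulVec_mulVec, hx, mulVec_smul]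
  have hY : (A * rot 𝕁' (θ t)) *ᵥ (𝕁' *ᵥ x) = √(√(Λ * p)) • (rot 𝕁 (θ t) *ᵥ (𝕁 *ᵥ a)) := by
    rw [← rot_comm hJA, ← mulVec_mulVec, mulVec_mulVec x, ← hJA, ← mulVec_mulVec, hx, mulVec_smul,
      mulVec_smul]
  have hm := h.radius_mul he he1 t
  have hk : √(Λ * p) / r t = √(Λ * p) / p * (1 + e * Real.cos (θ t)) := by
    have : √(Λ * p) / p * (r t * (1 + e * Real.cos (θ t))) = √(Λ * p) := by
      rw [hm]; field_simp
    rw [div_eq_iff hr]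
    linear_combination -this
  have hX' : (diagonal μ * A * rot 𝕁' (θ t)) *ᵥ x =
      diagonal μ *ᵥ (√(√(Λ * p)) • (rot 𝕁 (θ t) *ᵥ a)) := by
    rw [Matrix.mul_assoc, ← mulVec_mulVec, hX]
  have hY' : (diagonal μ * A * rot 𝕁' (θ t)) *ᵥ (𝕁' *ᵥ x) =
      diagonal μ *ᵥ (√(√(Λ * p)) • ((-Real.sin (θ t)) • a + Real.cos (θ t) • (𝕁 *ᵥ a))) := by
    rw [Matrix.mul_assoc, ← mulVec_mulVec, hY, mulVec_mulVec a, ← rot_deriv_eq h𝕁, add_mulVec,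
      smul_mulVec, smul_mulVec, one_mulVec]
  rw [pulseMap_eq, fromBlocks_mulVec]
  funext i
  rcases i with i | i
  · simp only [Sum.elim_inl, phaseCurve, Sum.elim_comp_inl, Sum.elim_comp_inr]
    rw [(hasDerivAt_homographic h hp he he1 𝕁 a t).deriv, smul_mulVec,
      smul_mulVec, hX', hY', h.deriv_scale hp he he1]
    simp only [mulVec_smul, Pi.add_apply, Pi.smul_apply, mulVec_diagonal, smul_eq_mul, rot,
      add_mulVec, smul_mulVec, one_mulVec, mulVec_add]
    have e1 : (scale Λ p r t)⁻¹ * √(√(Λ * p)) = √(Λ * p) / r t := by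
      rw [scale]
      nth_rw 3 [← hL2]
      field_simp
    have e2 : √(Λ * p) / p * e * Real.sin (θ t) / √(√(Λ * p)) * √(√(Λ * p)) =
        √(Λ * p) / p * e * Real.sin (θ t) := by field_simp
    have hsc := Real.sin_sq_add_cos_sq (θ t)
    generalize (𝕁 *ᵥ a) i = b
    generalize √(√(Λ * p)) = σ at *
    generalize √(Λ * p) / p = k at *
    generalize (scale Λ p r t)⁻¹ = q at *
    rw [hk] at e1
    -- The term `s'` gives the radial velocity `k e sin θ` along `R a`, the term `s⁻¹` gives the
    -- transversal velocity `k (1 + e cos θ)` along `R 𝕁 a`. By `sin² + cos² = 1` their sum is `-k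
    -- sin θ a + k (cos θ + e) 𝕁 a`.
    linear_combination (μ i * (Real.cos (θ t) * b - Real.sin (θ t) * a i)) * e1 +
      (μ i * (Real.cos (θ t) * a i + Real.sin (θ t) * b)) * e2 + (μ i * k * e * b) * hsc
  · simp only [Sum.elim_inr, phaseCurve, Sum.elim_comp_inl, Sum.elim_comp_inr, zero_mulVec,
      zero_add]
    rw [smul_mulVec, hX, smul_smul, scale, div_mul_cancel₀ _ hσ]

/-- The scale of a Kepler orbit satisfies the equations which the new coordinates need. -/
theorem scale_equations (h : IsKeplerOrbit Λ p e r θ) (hΛ : 0 < Λ) (hp : 0 < p)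
    (he : 0 ≤ e) (he1 : e < 1) :
    ∃ s'' : ℝ → ℝ, (∀ t, scale Λ p r t ≠ 0) ∧
      (∀ t, HasDerivAt (scale Λ p r) (deriv (scale Λ p r) t) t) ∧
      (∀ t, HasDerivAt (deriv (scale Λ p r)) (s'' t) t) ∧
      (∀ t, HasDerivAt θ ((scale Λ p r t ^ 2)⁻¹) t) ∧
      (∀ t, scale Λ p r t ^ 3 * s'' t = 1 - (1 + e * Real.cos (θ t))⁻¹) ∧
      ∀ t, scale Λ p r t ^ 4 * (r t ^ 3)⁻¹ = (1 + e * Real.cos (θ t))⁻¹ * Λ⁻¹ := by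
  have hL : 0 < √(Λ * p) := Real.sqrt_pos.2 (mul_pos hΛ hp)
  have hL2 : √(√(Λ * p)) ^ 2 = √(Λ * p) := Real.sq_sqrt hL.le
  have hL3 : √(Λ * p) ^ 2 = Λ * p := Real.sq_sqrt (mul_pos hΛ hp).le
  have hσ : √(√(Λ * p)) ≠ 0 := (Real.sqrt_pos.2 hL).ne'
  have hr := fun t => (h.radius_pos hp he he1 t).ne'
  refine ⟨fun t => √(Λ * p) / p * e * (Real.cos (θ t) * (√(Λ * p) / r t ^ 2)) / √(√(Λ * p)),
    fun t => div_ne_zero (hr t) hσ, fun t => ?_, fun t => ?_, fun t => ?_, fun t => ?_, fun t => ?_⟩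
  · exact (h.hasDerivAt_scale hp he he1 t).differentiableAt.hasDerivAt
  · rw [h.deriv_scale hp he he1]
    exact ((h.2 t).sin.const_mul _).div_const _
  · refine (h.2 t).congr_deriv ?_
    rw [scale, div_pow, hL2, inv_div]
  · rw [h.inv_one_add hp, scale]
    have hm := h.radius_mul he he1 t
    have h2 := hr t
    have h4 : √(√(Λ * p)) ^ 4 = √(Λ * p) ^ 2 := by
      rw [show √(√(Λ * p)) ^ 4 = (√(√(Λ * p)) ^ 2) ^ 2 by ring, hL2]
    -- With `(√√(Λp))⁴ = (√(Λp))²` the left side becomes `r e cos θ / p`, which is `1 - r/p` by the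
    -- conic equation.
    have h5 : (r t / √(√(Λ * p))) ^ 3 * (√(Λ * p) / p * e *
        (Real.cos (θ t) * (√(Λ * p) / r t ^ 2)) / √(√(Λ * p))) =
        √(Λ * p) ^ 2 / √(√(Λ * p)) ^ 4 * (r t * (e * Real.cos (θ t)) / p) := by
      field_simp
    rw [h5, h4, div_self (by positivity), one_mul]
    field_simp
    linarith
  · rw [h.inv_one_add hp, scale]
    have h2 := hr t
    have h4 : √(√(Λ * p)) ^ 4 = Λ * p := by
      rw [show √(√(Λ * p)) ^ 4 = (√(√(Λ * p)) ^ 2) ^ 2 by ring, hL2, hL3]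
    rw [div_pow, h4]
    field_simp

end Pulse

/-! ## The blocks of the coordinates -/

/-- `𝕁` in the essential coordinates. -/
def JEss (n : ℕ) : Matrix (Ess n) (Ess n) ℝ :=
  blockDiagonal' fun l : Fin (n / 2) => JJ (Fin (half n (l.val + 1)))

theorem JConf_eq (n : ℕ) : JConf n = fromBlocks (JJ (Fin 1)) 0 0 (JEss n) := rfl

theorem JEss_mul_self (n : ℕ) : JEss n * JEss n = -1 := by
  rw [JEss, ← blockDiagonal'_mul]
  simp only [JJ_mul_self]
  rw [← blockDiagonal'_one, ← blockDiagonal'_neg]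
  rfl

theorem JEss_transpose (n : ℕ) : (JEss n)ᵀ = -JEss n := by
  rw [JEss, blockDiagonal'_transpose, ← blockDiagonal'_neg]
  simp only [JJ_transpose]
  rfl

theorem JConf_mul_self (n : ℕ) : JConf n * JConf n = -1 := by
  rw [JConf_eq, fromBlocks_multiply, JJ_mul_self, JEss_mul_self]
  simp [← fromBlocks_one, fromBlocks_neg]

theorem JConf_transpose (n : ℕ) : (JConf n)ᵀ = -JConf n := by
  rw [JConf_eq, fromBlocks_transpose, JJ_transpose, JEss_transpose]
  simp [fromBlocks_neg]

/-- The Hessian of the potential in the coordinates `X = (z, w)`. -/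
def UConf (n : ℕ) (m : ℝ) : Matrix (Conf n) (Conf n) ℝ :=
  fromBlocks (UKep n m) 0 0 (blockDiagonal' fun l : Fin (n / 2) => UBlk n m (l.val + 1))

theorem hess_mul_ARed {n : ℕ} (hn : 3 ≤ n) {m : ℝ} (hm : 0 < m) :
    hess (pot n m) (cfg n) * ARed n m = MM n m * ARed n m * UConf n m := by
  have h : (MM n m)⁻¹ * hess (pot n m) (cfg n) * ARed n m = ARed n m * UConf n m := by
    rw [ARed_eq, UConf, mul_fromCols, fromCols_mul_fromBlocks, hess_mul_AKep hn hm,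
      mul_AEss (fun l => hess_mul_ABlk hn hm (by omega) (by omega))]
    simp
  rw [Matrix.mul_assoc, ← h, ← Matrix.mul_assoc, ← Matrix.mul_assoc,
    Matrix.mul_nonsing_inv _ (isUnit_MM hm n), Matrix.one_mul]

theorem diamond_eq (n : ℕ) (m e ϑ : ℝ) :
    diamond (BKep n m e ϑ) (diamondSum fun l : Fin (n / 2) => BBlk n m e (l.val + 1) ϑ) =
      fromBlocks 1 (-JConf n) (JConf n)
        (1 - (1 + e * Real.cos ϑ)⁻¹ • (1 + (lam n m)⁻¹ • UConf n m)) := by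
  simp only [diamond, diamondSum, BKep, BBlk, sysMat, toBlocks_fromBlocks₁₁, toBlocks_fromBlocks₁₂,
    toBlocks_fromBlocks₂₁, toBlocks_fromBlocks₂₂]
  generalize (1 + e * Real.cos ϑ)⁻¹ = ρ
  generalize (lam n m)⁻¹ = Λ
  have h1 : (blockDiagonal' fun l : Fin (n / 2) =>
      (1 : Matrix (Blk n (l.val + 1)) (Blk n (l.val + 1)) ℝ)) = 1 := blockDiagonal'_one
  have h2 : (blockDiagonal' fun l : Fin (n / 2) => -JJ (Fin (half n (l.val + 1)))) = -JEss n :=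
    blockDiagonal'_neg fun l : Fin (n / 2) => JJ (Fin (half n (l.val + 1)))
  have h3 : (blockDiagonal' fun l : Fin (n / 2) =>
      (1 : Matrix (Blk n (l.val + 1)) (Blk n (l.val + 1)) ℝ) - ρ • (1 + Λ • UBlk n m (l.val + 1))) =
      1 - ρ • (1 + Λ • blockDiagonal' fun l : Fin (n / 2) => UBlk n m (l.val + 1)) := by
    rw [← blockDiagonal'_smul, ← h1, ← blockDiagonal'_add, ← blockDiagonal'_smul,
      ← blockDiagonal'_sub]
    rfl
  rw [h1, h2, h3]
  have h4 : (1 : Matrix (Conf n) (Conf n) ℝ) = fromBlocks 1 0 0 1 := fromBlocks_one.symm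
  rw [h4, JConf_eq, UConf, JEss]
  simp only [sub_eq_add_neg, fromBlocks_neg, fromBlocks_smul, fromBlocks_add, neg_zero, smul_zero,
    add_zero]

theorem transpose_ARed_mul {n : ℕ} (hn : 3 ≤ n) {m : ℝ} (hm : 0 < m) :
    (ARed n m)ᵀ * MM n m * ARed n m = 1 ∧ (ACen n m)ᵀ * (MM n m * ARed n m) = 0 := by
  have h := transpose_AFull_mul hn hm
  rw [AFull, transpose_fromCols, fromRows_mul, fromRows_mul_fromCols, ← fromBlocks_one,
    fromBlocks_inj] at h
  rw [← Matrix.mul_assoc]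
  exact ⟨h.2.2.2, h.2.1⟩

theorem ACen_add_ARed {n : ℕ} (hn : 3 ≤ n) {m : ℝ} (hm : 0 < m) :
    ACen n m * ((ACen n m)ᵀ * MM n m) + ARed n m * ((ARed n m)ᵀ * MM n m) = 1 := by
  have h := AFull_mul_transpose hn hm
  rwa [AFull, transpose_fromCols, fromRows_mul, fromCols_mul_fromRows] at h

/-- The pulsation is the case `M = 1`, `A = 1` of a symplectic matrix; being square, it has its left
inverse also as right inverse. -/
theorem pulse_surjective {κ : Type} [Fintype κ] [DecidableEq κ] {𝕁 : Matrix κ κ ℝ}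
    (h𝕁 : 𝕁 * 𝕁 = -1) (h𝕁' : 𝕁ᵀ = -𝕁) {s : ℝ} (hs : s ≠ 0) (s' φ : ℝ) :
    Function.Surjective fun ζ => pulse 𝕁 s s' φ *ᵥ ζ := by
  have e : pulseMap (fun _ : κ => (1 : ℝ)) 1 𝕁 s s' φ = pulse 𝕁 s s' φ := by
    simp [pulseMap]
  have h := left_inverse_of_symplectic (pulseMap_symplectic (μ := fun _ : κ => (1 : ℝ)) (A := 1)
    h𝕁 h𝕁' (by simp) hs s' φ)
  rw [e, mul_eq_one_comm] at h
  exact fun v => ⟨(-J κ ℝ * (pulse 𝕁 s s' φ)ᵀ * J κ ℝ) *ᵥ v, by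
    simp only [mulVec_mulVec, h, one_mulVec]⟩

/-! ## Symplectic complements -/

section Symp

variable {ι : Type} [Fintype ι] [DecidableEq ι]

theorem symp_elim (x : ι ⊕ ι → ℝ) (u v : ι → ℝ) :
    symp x (Sum.elim u v) = (fun i => x (Sum.inl i)) ⬝ᵥ v - (fun i => x (Sum.inr i)) ⬝ᵥ u := by
  rw [symp, Matrix.J, fromBlocks_mulVec]
  simp [dotProduct, Fintype.sum_sum_type, Function.comp_def, neg_mulVec]
  ring

theorem symp_add_right (x y z : ι ⊕ ι → ℝ) : symp x (y + z) = symp x y + symp x z := by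
  simp [symp, dotProduct_add]

theorem symp_smul_right (x : ι ⊕ ι → ℝ) (c : ℝ) (y : ι ⊕ ι → ℝ) :
    symp x (c • y) = c * symp x y := by
  simp [symp, dotProduct_smul]

theorem sympOrth_span (S : Set (ι ⊕ ι → ℝ)) :
    sympOrth (Submodule.span ℝ S : Set (ι ⊕ ι → ℝ)) = sympOrth S := by
  ext x
  refine ⟨fun h y hy => h y (Submodule.subset_span hy), fun h y hy => ?_⟩
  induction hy using Submodule.span_induction with
  | mem y hy => exact h y hy
  | zero => simp [symp]
  | add y z _ _ hy hz => rw [symp_add_right, hy, hz, add_zero]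
  | smul c y _ hy => rw [symp_smul_right, hy, mul_zero]

theorem sympOrth_union (S T : Set (ι ⊕ ι → ℝ)) :
    sympOrth (S ∪ T) = sympOrth S ∩ sympOrth T := by
  ext x
  simp only [sympOrth, Set.mem_union, Set.mem_ofPred_eq, Set.mem_inter_iff]
  exact ⟨fun h => ⟨fun y hy => h y (Or.inl hy), fun y hy => h y (Or.inr hy)⟩,
    fun h y hy => hy.elim (h.1 y) (h.2 y)⟩

theorem eq_zero_of_symp_eq_zero {x : ι ⊕ ι → ℝ} (h : ∀ y, symp x y = 0) : x = 0 := by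
  have h1 : Matrix.J ι ℝ *ᵥ x = 0 := dotProduct_eq_zero _ h
  have h2 := congrArg (Matrix.J ι ℝ *ᵥ ·) h1
  simpa [mulVec_mulVec, Matrix.J_squared, neg_mulVec] using h2

end Symp

theorem symp_diamondVec {α β : Type} [Fintype α] [DecidableEq α] [Fintype β] [DecidableEq β]
    (z z' : α ⊕ α → ℝ) (w w' : β ⊕ β → ℝ) :
    symp (diamondVec z w) (diamondVec z' w') = symp z z' + symp w w' := by
  have hz := symp_elim z (fun i => z' (Sum.inl i)) (fun i => z' (Sum.inr i))
  have hw := symp_elim w (fun i => w' (Sum.inl i)) (fun i => w' (Sum.inr i))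
  rw [show Sum.elim (fun i => z' (Sum.inl i)) (fun i => z' (Sum.inr i)) = z' from
    Sum.elim_comp_inl_inr z'] at hz
  rw [show Sum.elim (fun i => w' (Sum.inl i)) (fun i => w' (Sum.inr i)) = w' from
    Sum.elim_comp_inl_inr w'] at hw
  rw [hz, hw, diamondVec, diamondVec, symp_elim]
  simp [dotProduct, Fintype.sum_sum_type]
  ring

theorem exists_diamondVec {α β : Type} (ζ : (α ⊕ β) ⊕ (α ⊕ β) → ℝ) :
    ∃ z w, ζ = diamondVec z w := by
  refine ⟨Sum.elim (fun i => ζ (Sum.inl (Sum.inl i))) fun i => ζ (Sum.inr (Sum.inl i)),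
    Sum.elim (fun i => ζ (Sum.inl (Sum.inr i))) fun i => ζ (Sum.inr (Sum.inr i)), ?_⟩
  funext i
  rcases i with (i | i) | (i | i) <;> rfl

/-! ## The images of the new coordinates -/

theorem transpose_ACen_mulVec_eq_zero {n : ℕ} (hn : 3 ≤ n) {m : ℝ} (hm : 0 < m)
    (P : Body n → ℝ) : (ACen n m)ᵀ *ᵥ P = 0 ↔
      P ⬝ᵥ cHat n = 0 ∧ P ⬝ᵥ (JJ (Fin (n + 1)) *ᵥ cHat n) = 0 := by
  have hc : 1 / √(m + n) ≠ 0 := by positivity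
  have h0 : ((ACen n m)ᵀ *ᵥ P) (0, 0) = 1 / √(m + n) * (P ⬝ᵥ cHat n) := by
    rw [← smul_eq_mul, ← dotProduct_smul, dotProduct_comm]
    rfl
  have h1 : ((ACen n m)ᵀ *ᵥ P) (0, 1) = 1 / √(m + n) * (P ⬝ᵥ (JJ (Fin (n + 1)) *ᵥ cHat n)) := by
    rw [← smul_eq_mul, ← dotProduct_smul, dotProduct_comm, ← mulVec_smul]
    rfl
  constructor
  · intro h
    rw [h] at h0 h1
    exact ⟨(mul_eq_zero.1 h0.symm).resolve_left hc, (mul_eq_zero.1 h1.symm).resolve_left hc⟩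
  · rintro ⟨e0, e1⟩
    rw [e0, mul_zero] at h0
    rw [e1, mul_zero] at h1
    funext ⟨i, s⟩
    obtain rfl : i = 0 := Subsingleton.elim _ _
    fin_cases s
    exacts [h0, h1]

/-- Pairing with `(0, ĉ)` and `(0, 𝕁ĉ)` tests the total momentum, pairing with `(Mĉ, 0)` and `(M𝕁ĉ,
0)` tests the centre of mass. -/
theorem mem_sympOrth_E1 {n : ℕ} (hn : 3 ≤ n) {m : ℝ} (hm : 0 < m) (x : Body n ⊕ Body n → ℝ) :
    x ∈ sympOrth (E1 n m : Set (Body n ⊕ Body n → ℝ)) ↔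
      (ACen n m)ᵀ *ᵥ (fun i => x (Sum.inl i)) = 0 ∧
        (ACen n m)ᵀ *ᵥ (MM n m *ᵥ fun i => x (Sum.inr i)) = 0 := by
  have hM : ∀ u v : Body n → ℝ, (MM n m *ᵥ u) ⬝ᵥ v = u ⬝ᵥ (MM n m *ᵥ v) := fun u v => by
    rw [dotProduct_mulVec, ← mulVec_transpose, MM, diagonal_transpose]
  rw [E1, sympOrth_span, transpose_ACen_mulVec_eq_zero hn hm, transpose_ACen_mulVec_eq_zero hn hm,
    hM, hM]
  simp only [sympOrth, Set.mem_ofPred_eq, Set.mem_insert_iff, Set.mem_singleton_iff, forall_eq_or_imp,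
    forall_eq, symp_elim, dotProduct_zero, sub_zero, zero_sub, neg_eq_zero]
  tauto

theorem TT_eq (n : ℕ) (m p : ℝ) (r θ : ℝ → ℝ) (t : ℝ) :
    TT n m p r θ t = pulseMap (cmass n m) (ARed n m) (JConf n) (scale (lam n m) p r t)
      (deriv (scale (lam n m) p r) t) (θ t) := rfl

theorem TT_mulVec (n : ℕ) (m p : ℝ) (r θ : ℝ → ℝ) (t : ℝ) (ζ : Conf n ⊕ Conf n → ℝ) :
    TT n m p r θ t *ᵥ ζ = fromBlocks (MM n m * ARed n m) 0 0 (ARed n m) *ᵥ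
      (pulse (JConf n) (scale (lam n m) p r t) (deriv (scale (lam n m) p r) t) (θ t) *ᵥ ζ) := by
  rw [TT, mulVec_mulVec]

theorem fromBlocks_diag_mulVec {α β γ δ : Type} [Fintype γ] [Fintype δ]
    (X : Matrix α γ ℝ) (Y : Matrix β δ ℝ) (ζ : γ ⊕ δ → ℝ) :
    fromBlocks X 0 0 Y *ᵥ ζ =
      Sum.elim (X *ᵥ fun i => ζ (Sum.inl i)) (Y *ᵥ fun i => ζ (Sum.inr i)) := by
  rw [fromBlocks_mulVec]
  simp [Function.comp_def]

/-- The columns of `A_cen` are orthogonal to those of `A'`, which gives one inclusion. For the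
other, the resolution of the identity by `A` loses its `A_cen` part on vectors with vanishing total
momentum and centre of mass; for momenta it is conjugated by `M`. -/
theorem range_TT {n : ℕ} (hn : 3 ≤ n) {m : ℝ} (hm : 0 < m) (p : ℝ) (r θ : ℝ → ℝ) (t : ℝ)
    (hs : scale (lam n m) p r t ≠ 0) :
    Set.range (fun ζ => TT n m p r θ t *ᵥ ζ) = sympOrth (E1 n m) := by
  obtain ⟨-, hC⟩ := transpose_ARed_mul hn hm
  have hC' : (ACen n m)ᵀ * (MM n m * ARed n m) = 0 := hC
  ext x
  rw [mem_sympOrth_E1 hn hm]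
  constructor
  · rintro ⟨ζ, rfl⟩
    simp only [TT_mulVec]
    generalize pulse (JConf n) (scale (lam n m) p r t) (deriv (scale (lam n m) p r) t) (θ t) *ᵥ ζ = η
    simp only [fromBlocks_diag_mulVec, Sum.elim_inl, Sum.elim_inr, mulVec_mulVec, hC', zero_mulVec,
      and_self]
  · rintro ⟨h1, h2⟩
    have hid := ACen_add_ARed hn hm
    set P := fun i => x (Sum.inl i) with hP
    set Q := fun i => x (Sum.inr i) with hQ
    have hQ' : ARed n m *ᵥ ((ARed n m)ᵀ *ᵥ (MM n m *ᵥ Q)) = Q := by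
      have := congrArg (· *ᵥ Q) hid
      simp only [add_mulVec, ← mulVec_mulVec, h2, mulVec_zero, zero_add, one_mulVec] at this
      exact this
    have hinv : MM n m * (MM n m)⁻¹ = 1 := Matrix.mul_nonsing_inv _ (isUnit_MM hm n)
    have hP' : (MM n m * ARed n m) *ᵥ ((ARed n m)ᵀ *ᵥ P) = P := by
      have := congrArg (fun X => MM n m *ᵥ (X *ᵥ ((MM n m)⁻¹ *ᵥ P))) hid
      simp only [add_mulVec, ← mulVec_mulVec, one_mulVec] at this
      have e : MM n m *ᵥ ((MM n m)⁻¹ *ᵥ P) = P := by rw [mulVec_mulVec, hinv, one_mulVec]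
      rw [e, h1, mulVec_zero, zero_add] at this
      rw [← mulVec_mulVec]
      exact this
    obtain ⟨ζ, hζ⟩ := pulse_surjective (JConf_mul_self n) (JConf_transpose n) hs
      (deriv (scale (lam n m) p r) t) (θ t)
      (Sum.elim ((ARed n m)ᵀ *ᵥ P) ((ARed n m)ᵀ *ᵥ (MM n m *ᵥ Q)))
    refine ⟨ζ, ?_⟩
    simp only at hζ ⊢
    rw [TT_mulVec, hζ, fromBlocks_diag_mulVec]
    simp only [Sum.elim_inl, Sum.elim_inr]
    rw [hP', hQ']
    exact Sum.elim_comp_inl_inr x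

theorem rot_fromBlocks {α β : Type} [DecidableEq α] [DecidableEq β] (X : Matrix α α ℝ)
    (Y : Matrix β β ℝ) (φ : ℝ) :
    rot (fromBlocks X 0 0 Y) φ = fromBlocks (rot X φ) 0 0 (rot Y φ) := by
  simp [rot, ← fromBlocks_one, fromBlocks_smul, fromBlocks_add]

theorem pulse_mulVec {κ : Type} [Fintype κ] [DecidableEq κ] (𝕁 : Matrix κ κ ℝ) (s s' φ : ℝ)
    (ζ : κ ⊕ κ → ℝ) :
    pulse 𝕁 s s' φ *ᵥ ζ = Sum.elim
      (s⁻¹ • (rot 𝕁 φ *ᵥ fun i => ζ (Sum.inl i)) + s' • (rot 𝕁 φ *ᵥ fun i => ζ (Sum.inr i)))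
      (s • (rot 𝕁 φ *ᵥ fun i => ζ (Sum.inr i))) := by
  rw [pulse, fromBlocks_mulVec]
  simp [Function.comp_def, smul_mulVec]

theorem pulse_diamondVec {n : ℕ} (s s' φ : ℝ) (z : Kep ⊕ Kep → ℝ) (w : Ess n ⊕ Ess n → ℝ) :
    pulse (JConf n) s s' φ *ᵥ diamondVec z w =
      diamondVec (pulse (JJ (Fin 1)) s s' φ *ᵥ z) (pulse (JEss n) s s' φ *ᵥ w) := by
  have key : ∀ (a : Kep → ℝ) (b : Ess n → ℝ), rot (JConf n) φ *ᵥ Sum.elim a b =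
      Sum.elim (rot (JJ (Fin 1)) φ *ᵥ a) (rot (JEss n) φ *ᵥ b) := fun a b => by
    rw [JConf_eq, rot_fromBlocks, fromBlocks_diag_mulVec]
    rfl
  rw [pulse_mulVec, pulse_mulVec, pulse_mulVec]
  simp only [diamondVec, Sum.elim_inl, Sum.elim_inr, key]
  funext i
  rcases i with (i | i) | (i | i) <;> rfl

theorem AKep_mulVec (n : ℕ) (x : Kep → ℝ) :
    AKep n *ᵥ x = (x (0, 0) * (1 / √(n : ℝ))) • cfg n +
      (x (0, 1) * (1 / √(n : ℝ))) • (JJ (Fin (n + 1)) *ᵥ cfg n) := by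
  funext q
  simp only [AKep, pairCols, mulVec_smul]
  rw [mulVec, dotProduct, Fintype.sum_prod_type]
  simp only [Finset.univ_unique, Fin.default_eq_zero, Finset.sum_singleton, Fin.sum_univ_two,
    Matrix.of_apply, Matrix.cons_val_zero, Matrix.cons_val_one, Pi.smul_apply, Pi.add_apply,
    smul_eq_mul]
  ring

theorem JJ_mul_MM (n : ℕ) (m : ℝ) : JJ (Fin (n + 1)) * MM n m = MM n m * JJ (Fin (n + 1)) := by
  ext ⟨i, s⟩ ⟨j, t⟩
  rw [MM, Matrix.mul_diagonal, Matrix.diagonal_mul]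
  by_cases h : i = j
  · subst h
    exact mul_comm _ _
  · simp [JJ, h]

/-- The pulsation acts invertibly within the Kepler coordinates, so it does not change their image.
That image consists of the pairs `(M A_kep y, A_kep x)`, and `M` commutes with `𝕁`. -/
theorem range_TT_kep {n : ℕ} (hn : 3 ≤ n) (m : ℝ) (p : ℝ) (r θ : ℝ → ℝ) (t : ℝ)
    (hs : scale (lam n m) p r t ≠ 0) :
    Set.range (fun z : Kep ⊕ Kep → ℝ =>
      TT n m p r θ t *ᵥ diamondVec z (0 : Ess n ⊕ Ess n → ℝ)) = E2 n m := by
  have hn' : √(n : ℝ) ≠ 0 := by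
    have : (0 : ℝ) < n := by exact_mod_cast (by omega : 0 < n)
    positivity
  have hT : ∀ z : Kep ⊕ Kep → ℝ, TT n m p r θ t *ᵥ diamondVec z (0 : Ess n ⊕ Ess n → ℝ) =
      Sum.elim (MM n m *ᵥ (AKep n *ᵥ fun i => (pulse (JJ (Fin 1)) (scale (lam n m) p r t)
          (deriv (scale (lam n m) p r) t) (θ t) *ᵥ z) (Sum.inl i)))
        (AKep n *ᵥ fun i => (pulse (JJ (Fin 1)) (scale (lam n m) p r t)
          (deriv (scale (lam n m) p r) t) (θ t) *ᵥ z) (Sum.inr i)) := fun z => by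
    rw [TT_mulVec, pulse_diamondVec, mulVec_zero, fromBlocks_diag_mulVec, ← mulVec_mulVec]
    simp only [diamondVec, Sum.elim_inl, Sum.elim_inr, ARed_eq, fromCols_mulVec,
      Function.comp_def, Pi.zero_apply]
    have : (fun _ => 0 : Ess n → ℝ) = 0 := rfl
    simp [this]
  have hMJ : JJ (Fin (n + 1)) *ᵥ (MM n m *ᵥ cfg n) = MM n m *ᵥ (JJ (Fin (n + 1)) *ᵥ cfg n) := by
    rw [mulVec_mulVec, mulVec_mulVec, JJ_mul_MM]
  ext x
  rw [SetLike.mem_coe, E2, hMJ]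
  simp only [Submodule.mem_span_insert, Submodule.mem_span_singleton]
  constructor
  · rintro ⟨z, rfl⟩
    simp only [hT, AKep_mulVec, mulVec_add, mulVec_smul]
    generalize pulse (JJ (Fin 1)) (scale (lam n m) p r t) (deriv (scale (lam n m) p r) t) (θ t) *ᵥ z
      = ζ
    refine ⟨ζ (Sum.inr (0, 0)) * (1 / √(n : ℝ)), _, ⟨ζ (Sum.inr (0, 1)) * (1 / √(n : ℝ)), _,
      ⟨ζ (Sum.inl (0, 0)) * (1 / √(n : ℝ)), _, ⟨ζ (Sum.inl (0, 1)) * (1 / √(n : ℝ)), rfl⟩, rfl⟩,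
        rfl⟩, ?_⟩
    funext i
    rcases i with i | i <;> simp
  · rintro ⟨a, _, ⟨b, _, ⟨c, _, ⟨d, rfl⟩, rfl⟩, rfl⟩, rfl⟩
    obtain ⟨z, hz⟩ := pulse_surjective (JJ_mul_self (κ := Fin 1)) JJ_transpose hs
      (deriv (scale (lam n m) p r) t) (θ t)
      (Sum.elim (fun i => √(n : ℝ) * ![c, d] i.2) (fun i => √(n : ℝ) * ![a, b] i.2))
    refine ⟨z, ?_⟩
    simp only at hz ⊢
    rw [hT, hz]
    simp only [Sum.elim_inl, Sum.elim_inr, AKep_mulVec, mulVec_add, mulVec_smul, Matrix.cons_val_zero,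
      Matrix.cons_val_one]
    have e : ∀ c : ℝ, √(n : ℝ) * c * (1 / √(n : ℝ)) = c := fun c => by field_simp
    simp only [e]
    funext i
    rcases i with i | i <;> simp

/-- A vector orthogonal to `E₁` has coordinates `(z, w)`. As `T` preserves the symplectic form and
the symplectic sum is orthogonal, being orthogonal to `E₂` means that `z` is orthogonal to all
Kepler coordinates, hence zero. -/
theorem range_TT_ess {n : ℕ} (hn : 3 ≤ n) {m : ℝ} (hm : 0 < m) (p : ℝ) (r θ : ℝ → ℝ) (t : ℝ)
    (hs : scale (lam n m) p r t ≠ 0)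
    (hT : (TT n m p r θ t)ᵀ * Matrix.J (Body n) ℝ * TT n m p r θ t = Matrix.J (Conf n) ℝ) :
    Set.range (fun w : Ess n ⊕ Ess n → ℝ =>
      TT n m p r θ t *ᵥ diamondVec (0 : Kep ⊕ Kep → ℝ) w) = E3 n m := by
  ext x
  rw [E3, sympOrth_union, Set.mem_inter_iff, ← range_TT hn hm p r θ t hs,
    ← range_TT_kep hn m p r θ t hs]
  constructor
  · rintro ⟨w, rfl⟩
    refine ⟨⟨_, rfl⟩, ?_⟩
    rintro _ ⟨z, rfl⟩
    rw [symp_mulVec hT, symp_diamondVec]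
    simp [symp]
  · rintro ⟨⟨ζ, rfl⟩, h⟩
    obtain ⟨z, w, rfl⟩ := exists_diamondVec ζ
    have hz : z = 0 := eq_zero_of_symp_eq_zero fun z' => by
      have := h _ ⟨z', rfl⟩
      rw [symp_mulVec hT, symp_diamondVec] at this
      simpa [symp] using this
    exact ⟨w, by rw [hz]⟩

/-! ## The homographic motion in the new coordinates -/

/-- The central body sits at the origin and all other masses are `1`, so the mass matrix acts
trivially here. -/
theorem MM_mulVec_rot_cfg (n : ℕ) (m φ : ℝ) :
    MM n m *ᵥ (rot (JJ (Fin (n + 1))) φ *ᵥ cfg n) = rot (JJ (Fin (n + 1))) φ *ᵥ cfg n := by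
  refine cx_injective ?_
  rw [cx_MM, cx_rot, massC_smul, cx_cfg, massC_mode]

theorem cmass_ne_zero {n : ℕ} {m : ℝ} (hm : 0 < m) (i : Body n) : cmass n m i ≠ 0 := by
  rw [cmass, mass]
  split_ifs
  exacts [hm.ne', one_ne_zero]

section NBody

variable {n : ℕ} {m p e : ℝ} {r θ : ℝ → ℝ}

theorem exists_hasGradHess_homogr (hn : 3 ≤ n) (h : IsKeplerOrbit (lam n m) p e r θ) (hp : 0 < p)
    (he : 0 ≤ e) (he1 : e < 1) (t : ℝ) : ∃ G H, HasGradHess (pot n m) G H (homogr n r θ t) :=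
  ⟨_, _, hasGradHess_pot n m
    (cx_smul_rot_cfg_injective (by omega) (h.radius_pos hp he he1 t) (θ t))⟩

theorem isHamSol_homogr (hn : 3 ≤ n) (hm : 0 < m) (h : IsKeplerOrbit (lam n m) p e r θ)
    (hp : 0 < p) (he : 0 ≤ e) (he1 : e < 1) :
    IsHamSol (hamN n m) (phaseCurve (cmass n m) (homogr n r θ)) := by
  have hn0 : n ≠ 0 := by omega
  refine isHamSol_homographic (cmass_ne_zero hm) h (lam_pos hn0 hm) hp he he1
    (JJ (Fin (n + 1))) (cfg n) (exists_hasGradHess_homogr hn h hp he he1) fun t => ?_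
  rw [grad_pot_smul_rot hn m (h.radius_pos hp he he1 t), lam_eq hn0]
  exact congrArg _ (MM_mulVec_rot_cfg n m (θ t)).symm

theorem kepEq_eq (σ : ℝ) : kepEq σ =
    Sum.elim (JJ (Fin 1) *ᵥ fun i => (![σ, 0] : Fin 2 → ℝ) i.2)
      (fun i => (![σ, 0] : Fin 2 → ℝ) i.2) := by
  rw [kepEq]
  congr 1
  funext ⟨i, s⟩
  rw [JJ_mulVec]
  fin_cases s <;> simp

theorem xiZero_eq (n : ℕ) (σ : ℝ) : xiZero n σ =
    Sum.elim (JConf n *ᵥ Sum.elim (fun i => (![σ, 0] : Fin 2 → ℝ) i.2) 0)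
      (Sum.elim (fun i => (![σ, 0] : Fin 2 → ℝ) i.2) 0) := by
  rw [xiZero, kepEq_eq, JConf_eq, fromBlocks_diag_mulVec]
  have : (fun _ => 0 : Ess n → ℝ) = 0 := rfl
  simp only [diamondVec, Sum.elim_inl, Sum.elim_inr, Pi.zero_apply, this, mulVec_zero]

theorem TT_mulVec_xiZero (hn : 3 ≤ n) (hm : 0 < m) (h : IsKeplerOrbit (lam n m) p e r θ)
    (hp : 0 < p) (he : 0 ≤ e) (he1 : e < 1) (t : ℝ) :
    TT n m p r θ t *ᵥ xiZero n (√(n * √(lam n m * p))) =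
      phaseCurve (cmass n m) (homogr n r θ) t := by
  have hn0 : n ≠ 0 := by omega
  have hn' : (0 : ℝ) < n := by exact_mod_cast (by omega : 0 < n)
  have hs : √(n : ℝ) ≠ 0 := by positivity
  rw [TT_eq, xiZero_eq]
  refine pulseMap_mulVec_equilibrium h (lam_pos hn0 hm) hp he he1 (cmass n m)
    (JJ_mul_self (κ := Fin (n + 1))) (JJ_mul_ARed n m) ?_ t
  rw [ARed_eq, fromCols_mulVec]
  simp only [Sum.elim_comp_inl, Sum.elim_comp_inr, mulVec_zero, add_zero]
  rw [AKep_mulVec, Real.sqrt_mul hn'.le]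
  simp only [Matrix.cons_val_zero, Matrix.cons_val_one, zero_mul, zero_smul, add_zero]
  congr 1
  field_simp

/-- The two ingredients of the linearization: conjugation by the rotation and the block form of the
Hessian at the polygon. The rotation passes through `A'` and `M` because both are compatible with
`𝕁`. -/
theorem hess_homogr_mul (hn : 3 ≤ n) (hm : 0 < m) {ρ : ℝ} (hρ : 0 < ρ) (φ : ℝ) :
    hess (pot n m) (ρ • (rot (JJ (Fin (n + 1))) φ *ᵥ cfg n)) * (ARed n m * rot (JConf n) φ) =
      (ρ ^ 3)⁻¹ • (MM n m * ARed n m * rot (JConf n) φ * UConf n m) := by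
  have hMA : JJ (Fin (n + 1)) * (MM n m * ARed n m) = MM n m * ARed n m * JConf n := by
    rw [← Matrix.mul_assoc, JJ_mul_MM, Matrix.mul_assoc, JJ_mul_ARed, Matrix.mul_assoc]
  rw [← rot_comm (JJ_mul_ARed n m), ← Matrix.mul_assoc, hess_pot_smul_rot (by omega) m hρ,
    Matrix.smul_mul, Matrix.mul_assoc, hess_mul_ARed hn hm, ← Matrix.mul_assoc, rot_comm hMA]

theorem isLinSol_TT_iff (hn : 3 ≤ n) (hm : 0 < m) (h : IsKeplerOrbit (lam n m) p e r θ)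
    (hp : 0 < p) (he : 0 ≤ e) (he1 : e < 1) (ζ : ℝ → (Conf n ⊕ Conf n) → ℝ) :
    IsLinSol (fun t => hess (hamN n m) (phaseCurve (cmass n m) (homogr n r θ) t))
        (fun t => TT n m p r θ t *ᵥ ζ (θ t)) ↔
      IsLinSol (fun ϑ => diamond (BKep n m e ϑ)
        (diamondSum fun l : Fin (n / 2) => BBlk n m e (l.val + 1) ϑ)) ζ := by
  have hn0 : n ≠ 0 := by omega
  have hΛ := lam_pos hn0 hm
  obtain ⟨s'', h0, h1, h2, h3, h4, h5⟩ := scale_equations h hΛ hp he he1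
  have hH : (fun t => hess (hamN n m) (phaseCurve (cmass n m) (homogr n r θ) t)) = fun t =>
      fromBlocks (diagonal fun i => (cmass n m i)⁻¹) 0 0 (-hess (pot n m) (homogr n r θ t)) :=
    funext fun t => hess_ham_phaseCurve (cmass n m) (exists_hasGradHess_homogr hn h hp he he1 t)
  simp only [hH, diamond_eq, TT_eq]
  exact isLinSol_pulseMap_iff (cmass_ne_zero hm) (JConf_mul_self n) (JConf_transpose n)
    (transpose_ARed_mul hn hm).1 h0 h1 h2 h3 (h.bijective hΛ hp he he1)
    (fun t => hess_homogr_mul hn hm (h.radius_pos hp he he1 t) (θ t))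
    (ρ := fun ϑ => (1 + e * Real.cos ϑ)⁻¹) h4 h5 ζ

end NBody

/-! ## The Kepler problem -/

/-- The first unit vector of the plane. -/
def kepUnit : Kep → ℝ := fun i => ![1, 0] i.2

theorem cx_kepUnit : cx kepUnit 0 = 1 := by
  apply Complex.ext <;> simp [cx, kepUnit]

theorem cx_smul_rot_kepUnit (r φ : ℝ) :
    cx (r • (rot (JJ (Fin 1)) φ *ᵥ kepUnit)) 0 = r * Complex.exp (φ * Complex.I) := by
  rw [cx_smul, cx_rot, Pi.smul_apply, Pi.smul_apply, cx_kepUnit]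
  simp

theorem kepMotion_eq (r θ : ℝ → ℝ) :
    kepMotion r θ = fun t => r t • (rot (JJ (Fin 1)) (θ t) *ᵥ kepUnit) := by
  funext t ⟨i, s⟩
  rw [rot, add_mulVec, smul_mulVec, smul_mulVec, one_mulVec]
  simp only [Pi.smul_apply, Pi.add_apply, JJ_mulVec, kepMotion, kepUnit, smul_eq_mul]
  fin_cases s <;> simp

theorem cx_injective_kep {ξ η : Kep → ℝ} (h : cx ξ 0 = cx η 0) : ξ = η :=
  cx_injective (funext fun i => by rwa [Subsingleton.elim i 0])

theorem cx_smul_rot_kepUnit_ne_zero {r : ℝ} (hr : 0 < r) (φ : ℝ) :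
    cx (r • (rot (JJ (Fin 1)) φ *ᵥ kepUnit)) 0 ≠ 0 := by
  rw [cx_smul_rot_kepUnit]
  exact mul_ne_zero (by exact_mod_cast hr.ne') (Complex.exp_ne_zero _)

theorem grad_potKep_smul_rot (Λ : ℝ) {r : ℝ} (hr : 0 < r) (φ : ℝ) :
    grad (potKep Λ) (r • (rot (JJ (Fin 1)) φ *ᵥ kepUnit)) =
      (-(Λ / r ^ 2)) • (rot (JJ (Fin 1)) φ *ᵥ kepUnit) := by
  refine cx_injective_kep ?_
  have hr' : (r : ℂ) ≠ 0 := by exact_mod_cast hr.ne'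
  rw [cx_grad_potKep Λ (cx_smul_rot_kepUnit_ne_zero hr φ), cx_smul_rot_kepUnit,
    cx_smul_rot_kepUnit, norm_mul, Complex.norm_exp_ofReal_mul_I, Complex.norm_real,
    Real.norm_of_nonneg hr.le]
  push_cast
  field_simp

/-- At the first unit vector the Hessian of `λ/‖x‖` is `diag(2λ, -λ)`; since `λ = σ_n/2 + m` this is
exactly `UKep`. Hence the Kepler block of the polygon is the linearized Kepler problem. -/
theorem hess_potKep_mul {n : ℕ} (hn : n ≠ 0) (m : ℝ) {r : ℝ} (hr : 0 < r) (φ : ℝ) :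
    hess (potKep (lam n m)) (r • (rot (JJ (Fin 1)) φ *ᵥ kepUnit)) * rot (JJ (Fin 1)) φ =
      (r ^ 3)⁻¹ • (rot (JJ (Fin 1)) φ * UKep n m) := by
  rw [← Matrix.toLin'.injective.eq_iff]
  refine LinearMap.ext fun ξ => cx_injective_kep ?_
  simp only [Matrix.toLin'_apply, smul_mulVec, ← mulVec_mulVec]
  have hU : cx (UKep n m *ᵥ ξ) 0 = lam n m * invNormHessC 1 (cx ξ 0) := by
    rw [lam_eq hn]
    apply Complex.ext <;>
    simp [cx, UKep, mulVec, dotProduct, Fintype.sum_prod_type, invNormHessC]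
    all_goals ring
  rw [cx_hess_potKep _ (cx_smul_rot_kepUnit_ne_zero hr φ), cx_smul_rot_kepUnit, cx_rot, cx_smul,
    cx_rot]
  have h1 := invNormHessC_mul r hr _ (Complex.norm_exp_ofReal_mul_I φ) 1 (cx ξ 0)
  rw [mul_one] at h1
  simp only [Pi.smul_apply, smul_eq_mul]
  rw [h1, hU]
  ring

section Kepler

variable {n : ℕ} {m p e : ℝ} {r θ : ℝ → ℝ}

theorem TKep_eq (μ p : ℝ) (r θ : ℝ → ℝ) (t : ℝ) :
    TKep μ p r θ t = pulseMap (fun _ => 1) 1 (JJ (Fin 1)) (scale μ p r t)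
      (deriv (scale μ p r) t) (θ t) := by
  simp [TKep, pulseMap]

theorem exists_hasGradHess_kepMotion (h : IsKeplerOrbit (lam n m) p e r θ) (hp : 0 < p)
    (he : 0 ≤ e) (he1 : e < 1) (t : ℝ) :
    ∃ G H, HasGradHess (potKep (lam n m)) G H (r t • (rot (JJ (Fin 1)) (θ t) *ᵥ kepUnit)) :=
  ⟨_, _, hasGradHess_potKep _ (cx_smul_rot_kepUnit_ne_zero (h.radius_pos hp he he1 t) (θ t))⟩

theorem isHamSol_kepMotion (hn : 3 ≤ n) (hm : 0 < m) (h : IsKeplerOrbit (lam n m) p e r θ)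
    (hp : 0 < p) (he : 0 ≤ e) (he1 : e < 1) :
    IsHamSol (hamKep (lam n m)) (phaseCurve (fun _ => 1) (kepMotion r θ)) := by
  rw [kepMotion_eq]
  refine isHamSol_homographic (fun _ => one_ne_zero) h (lam_pos (by omega) hm) hp he he1
    (JJ (Fin 1)) kepUnit (exists_hasGradHess_kepMotion h hp he he1) fun t => ?_
  refine (grad_potKep_smul_rot _ (h.radius_pos hp he he1 t) (θ t)).trans ?_
  simp

theorem TKep_mulVec_kepEq (hn : 3 ≤ n) (hm : 0 < m) (h : IsKeplerOrbit (lam n m) p e r θ)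
    (hp : 0 < p) (he : 0 ≤ e) (he1 : e < 1) (t : ℝ) :
    TKep (lam n m) p r θ t *ᵥ kepEq (√(√(lam n m * p))) =
      phaseCurve (fun _ => 1) (kepMotion r θ) t := by
  rw [TKep_eq, kepEq_eq, kepMotion_eq]
  refine pulseMap_mulVec_equilibrium h (lam_pos (by omega) hm) hp he he1 (fun _ => 1)
    (JJ_mul_self (κ := Fin 1)) (by simp) ?_ t
  rw [one_mulVec]
  funext ⟨i, s⟩
  fin_cases s <;> simp [kepUnit]

/-- The general reduction with unit masses and `A = 1`: the scale equations depend on the Kepler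
orbit alone. -/
theorem isLinSol_TKep_iff (hn : 3 ≤ n) (hm : 0 < m) (h : IsKeplerOrbit (lam n m) p e r θ)
    (hp : 0 < p) (he : 0 ≤ e) (he1 : e < 1) (ζ : ℝ → Kep ⊕ Kep → ℝ) :
    IsLinSol (fun t => hess (hamKep (lam n m)) (phaseCurve (fun _ => 1) (kepMotion r θ) t))
        (fun t => TKep (lam n m) p r θ t *ᵥ ζ (θ t)) ↔
      IsLinSol (fun ϑ => BKep n m e ϑ) ζ := by
  have hn0 : n ≠ 0 := by omega
  have hΛ := lam_pos hn0 hm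
  obtain ⟨s'', h0, h1, h2, h3, h4, h5⟩ := scale_equations h hΛ hp he he1
  have hH : (fun t => hess (hamKep (lam n m)) (phaseCurve (fun _ => 1) (kepMotion r θ) t)) =
      fun t => fromBlocks (diagonal fun _ => (1 : ℝ)⁻¹) 0 0
        (-hess (potKep (lam n m)) (r t • (rot (JJ (Fin 1)) (θ t) *ᵥ kepUnit))) := by
    rw [kepMotion_eq]
    exact funext fun t => hess_ham_phaseCurve (fun _ => 1)
      (exists_hasGradHess_kepMotion h hp he he1 t)
  simp only [hH, TKep_eq]
  refine isLinSol_pulseMap_iff (μ := fun _ => 1) (A := 1) (fun _ => one_ne_zero)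
    (JJ_mul_self (κ := Fin 1)) JJ_transpose (by simp) h0 h1 h2 h3 (h.bijective hΛ hp he he1)
    (fun t => ?_) (ρ := fun ϑ => (1 + e * Real.cos ϑ)⁻¹) h4 h5 ζ
  simp only [Matrix.one_mul, Matrix.mul_one, diagonal_one]
  exact hess_potKep_mul hn0 m (h.radius_pos hp he he1 t) (θ t)

end Kepler

end NGon

end

theorem theorem3p4 (n : ℕ) (hn : 3 ≤ n) (m : ℝ) (hm : 0 < m) :
    -- the linear transformation `A` and the blocks of the mass-weighted Hessian of `U` at `a`
    (lam n m = sigmaN n / 2 + m ∧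
      (AFull n m)ᵀ * MM n m * AFull n m = 1 ∧
      JJ (Fin (n + 1)) * AFull n m = AFull n m * fromBlocks (JJ (Fin 1)) 0 0 (JConf n) ∧
      (MM n m)⁻¹ * hess (pot n m) (cfg n) * AKep n = AKep n * UKep n m ∧
      ∀ l : ℕ, 1 ≤ l → l ≤ n / 2 →
        (MM n m)⁻¹ * hess (pot n m) (cfg n) * ABlk n m l = ABlk n m l * UBlk n m l) ∧
    -- every elliptic orbit: semi-latus rectum `p`, eccentricity `e`, true anomaly `θ(t)`
    ∀ (p e : ℝ) (r θ : ℝ → ℝ), 0 < p → 0 ≤ e → e < 1 → IsKeplerOrbit (lam n m) p e r θ →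
      -- the true anomaly is a new time
      Function.Bijective θ ∧
      -- the new coordinates are symplectic on the phase space reduced by the centre of mass;
      -- the first block spans `E₂` and the second one the essential part `E₃`
      (∀ t : ℝ, (TT n m p r θ t)ᵀ * Matrix.J (Body n) ℝ * TT n m p r θ t = Matrix.J (Conf n) ℝ ∧
        Set.range (fun ζ => TT n m p r θ t *ᵥ ζ) = sympOrth (E1 n m) ∧
        Set.range (fun z : Kep ⊕ Kep → ℝ =>
          TT n m p r θ t *ᵥ diamondVec z (0 : Ess n ⊕ Ess n → ℝ)) = E2 n m ∧
        Set.range (fun w : Ess n ⊕ Ess n → ℝ =>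
          TT n m p r θ t *ᵥ diamondVec (0 : Kep ⊕ Kep → ℝ) w) = E3 n m) ∧
      -- the homographic motion is a solution and becomes the equilibrium `ξ̄₀`
      IsHamSol (hamN n m) (phaseCurve (cmass n m) (homogr n r θ)) ∧
      (∀ t : ℝ, TT n m p r θ t *ᵥ xiZero n (√(n * √(lam n m * p))) =
        phaseCurve (cmass n m) (homogr n r θ) t) ∧
      -- the linearized system in the new coordinates and the new time
      (∀ ζ : ℝ → (Conf n ⊕ Conf n) → ℝ,
        IsLinSol (fun t => hess (hamN n m) (phaseCurve (cmass n m) (homogr n r θ) t))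
            (fun t => TT n m p r θ t *ᵥ ζ (θ t)) ↔
          IsLinSol (fun ϑ => diamond (BKep n m e ϑ)
            (diamondSum fun l : Fin (n / 2) => BBlk n m e (l.val + 1) ϑ)) ζ) ∧
      -- `B₂` is the linearized Kepler problem along the Kepler orbit
      IsHamSol (hamKep (lam n m)) (phaseCurve (fun _ => 1) (kepMotion r θ)) ∧
      (∀ t : ℝ, TKep (lam n m) p r θ t *ᵥ kepEq (√(√(lam n m * p))) =
        phaseCurve (fun _ => 1) (kepMotion r θ) t) ∧
      (∀ ζ : ℝ → Kep ⊕ Kep → ℝ,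
        IsLinSol (fun t => hess (hamKep (lam n m)) (phaseCurve (fun _ => 1) (kepMotion r θ) t))
            (fun t => TKep (lam n m) p r θ t *ᵥ ζ (θ t)) ↔
          IsLinSol (fun ϑ => BKep n m e ϑ) ζ) := by
  have hn0 : n ≠ 0 := by omega
  refine ⟨⟨lam_eq hn0 m, transpose_AFull_mul hn hm, JJ_mul_AFull n m, hess_mul_AKep hn hm,
    fun l h1 hl => hess_mul_ABlk hn hm h1 hl⟩, fun p e r θ hp he he1 h => ?_⟩
  have hΛ := lam_pos hn0 hm
  obtain ⟨-, hs, -⟩ := scale_equations h hΛ hp he he1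
  have hT : ∀ t, (TT n m p r θ t)ᵀ * Matrix.J (Body n) ℝ * TT n m p r θ t =
      Matrix.J (Conf n) ℝ := fun t =>
    pulseMap_symplectic (JConf_mul_self n) (JConf_transpose n) (transpose_ARed_mul hn hm).1
      (hs t) _ _
  exact ⟨h.bijective hΛ hp he he1,
    fun t => ⟨hT t, range_TT hn hm p r θ t (hs t), range_TT_kep hn m p r θ t (hs t),
      range_TT_ess hn hm p r θ t (hs t) (hT t)⟩,
    isHamSol_homogr hn hm h hp he he1, TT_mulVec_xiZero hn hm h hp he he1,
    isLinSol_TT_iff hn hm h hp he he1, isHamSol_kepMotion hn hm h hp he he1,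
    TKep_mulVec_kepEq hn hm h hp he he1, isLinSol_TKep_iff hn hm h hp he he1⟩
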